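/- **Setup.** Let $q>1$ be real, $a\ge 1$ and $h\ge 0$ integers, $\mathscr O_a=\{-(a-\tfrac12),-(a-\tfrac32),\dots,a-\tfrac32,a-\tfrac12\}$. The dartboard has $m\ge1$ columns $i=0,\dots,m-1$ of width $1/m$; column $i$ has the offset $r_i=\lfloor i/2\rfloor/m+\tfrac12\mathbf 1[i\text{ odd}]$. For a number $L\in\{0,1,2,\dots\}\cup\{\infty\}$, column $i$ is cut into the cells $j=0,1,2,\dots$ ($j\le L$), where cell $j$ spans the vertical interval $[q^{-(r_i+j+1)},q^{-(r_i+j)})$, except that the last cell $j=L$ (if $L<\infty$) spans $[0,q^{-(r_i+L)})$; the rest $[q^{-r_i},1]$ is an always occupied dummy cell, regarded as cell $-1$. The height of cell $j$ of column $i$ is $j+\tfrac12\mathbf 1[i\text{ odd}]$. Each element of a universe of size $U$ is hashed to an independent uniformly random point (a dart) of the unit square. Let $g_i$ be the height of the highest cell of column $i$ containing a dart (of the dummy cell if there is none). The *Curtain sketch* stores the curtain $(\hat g_i)$, i.e. the least vector with $\hat g_i\ge g_i$ and $\hat g_i-\hat g_{i-1}\in\mathscr O_a$, and $h$ bits per column,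 telling which of the $h$ cells at heights $\hat g_i,\dots,\hat g_i-h+1$ (if column $i$ is in tension, i.e. $\hat g_i-\hat g_{i-1}=-(a-\tfrac12)$ or $\hat g_{i+1}-\hat g_i=a-\tfrac12$), respectively $\hat g_i-1,\dots,\hat g_i-h$ (otherwise), contain a dart. Cells above the curtain, and recorded cells without a dart, are free; all others are occupied. For a state $S$ let $P(S)$ be the total area of its free cells, which is the probability that a new dart changes $S$. The *Martingale Curtain* estimate $\hat\lambda$ starts at $0$, and whenever a stream element changes the state from $S$ to another state, $1/P(S)$ is added to $\hat\lambda$. Let $\lambda$ be the number of distinct elements of the stream, and $$C(q,a,h)=\frac{q\ln q}{2(q-1)}\left(\frac{q-1}{q}+\frac{2}{q^{h}(q^{a-1/2}-1)}+\frac1{q^{h+1}}\right).$$ **Theorem.** 1. If $L=\infty$, then $\mathbb E\hat\lambda=\lambda$ for every stream and every $m\geq 1$. If $L<\infty$, then $\mathbb E\hat\lambda$ is the expected number of distinct elements whose first occurrence meets a state $S$ with $P(S)>0$ (thus $\hat\lambda$ is unbiased up to saturation of the finite dartboard). 2. Let $L=\lceil\log_q U\rceil$. As $m\to\infty$, $\lambda/m\to\infty$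 and $(\ln\ln U)/m\to 0$, uniformly over all streams from the universe, $\hat\lambda$ has a finite variance, with $$\frac{1}{\lambda^2}\operatorname{Var}(\hat\lambda)=(1+o(1))\,\frac{C(q,a,h)}{m},\qquad \mathbb E\hat\lambda=\lambda\left(1+o(1/m)\right).$$ 3. Let $L=\lceil\log_q U\rceil$, and let the memory be the number of bits of a fixed-length binary code for the sketch (curtain vectors with $\hat g_0\in\{-1,0,\dots,L\}$ and offsets in $\mathscr O_a$, and $h\times m$ bit arrays) plus $\lceil\log_2U\rceil$ bits for the estimate. As $m\to\infty$, $\lambda/m\to\infty$ and $(\ln U)/m\to0$, the product of the memory and the relative variance tends to the limiting memory-variance product $$\mathsf{MVP}=(\log_2(2a)+h)\,C(q,a,h).$$ For $(q,a,h)=(2.91,2,1)$ this is $2.31$ up to an error of at most $0.005$. -/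

import Mathlib

open MeasureTheory ProbabilityTheory

noncomputable section

namespace MartingaleCurtain

/-! ### The smoothed sawtooth dartboard -/

/-- Even columns carry integer cell heights, odd columns carry half-integer ones. -/
def shift {m : ℕ} (i : Fin m) : ℚ := ((i.val % 2 : ℕ) : ℚ) / 2

/-- The cell `(i, j)` is the `j`-th cell, counted from the widest one, of column `i`. -/
abbrev Cell (m : ℕ) : Type := Fin m × ℕ

/-- Sawtooth height of a cell. -/
def height {m : ℕ} (c : Cell m) : ℚ := (c.2 : ℚ) + shift c.1

/-- The uniform smoothing offsets `0, 1/2, 1/m, 1/2 + 1/m, 2/m, 1/2 + 2/m, …`. -/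
def smoothing {m : ℕ} (i : Fin m) : ℝ := ((i.val / 2 : ℕ) : ℝ) / (m : ℝ) + (shift i : ℝ)

/-- A dart is a uniformly random column together with a uniformly random ordinate in `[0, 1]`. -/
def dartLaw (m : ℕ) : Measure (Fin m × ℝ) :=
  (uniformOn (Set.univ : Set (Fin m))).prod (volume.restrict (Set.Icc (0 : ℝ) 1))

/-- The cell hit by a dart. With `r = smoothing i`, cell `j` of column `i` spans
`[q ^ (-(r + j + 1)), q ^ (-(r + j)))`, except that for a finite number `L` the cell `j = L` is the
last one and spans `[0, q ^ (-(r + L)))`. The remaining part `[q ^ (-r), 1]` of the column is the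
dummy cell; darts landing there are discarded. -/
def cellOf {m : ℕ} (q : ℝ) (L : ℕ∞) (d : Fin m × ℝ) : Option (Cell m) :=
  open Classical in
  if d.2 < q ^ (-(smoothing d.1)) then
    some (d.1, sSup {j : ℕ | (j : ℕ∞) ≤ L ∧ d.2 < q ^ (-(smoothing d.1 + (j : ℝ)))})
  else none

/-! ### Curtains -/

/-- The allowable offsets `-(a - 1/2), -(a - 3/2), …, a - 3/2, a - 1/2`. -/
def offsets (a : ℕ) : Set ℚ := {x | ∃ s : ℕ, s < 2 * a ∧ x = (s : ℚ) - ((a : ℚ) - 1 / 2)}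

/-- Consecutive differences of the vector `w` are allowable offsets. -/
def IsValid (a : ℕ) {m : ℕ} (w : Fin m → ℚ) : Prop :=
  ∀ i j : Fin m, j.val = i.val + 1 → w j - w i ∈ offsets a

/-- The curtain of `v`; by `curtain_isLeast` it is the minimal valid vector dominating `v`. -/
def curtain (a : ℕ) {m : ℕ} (v : Fin m → ℚ) (i : Fin m) : ℚ :=
  Finset.univ.sup' ⟨i, Finset.mem_univ i⟩
    (fun j : Fin m => v j - |((i.val : ℚ) - (j.val : ℚ))| * ((a : ℚ) - 1 / 2))

/-- Column `i` is in tension: lowering its curtain cell by one would violate an offset. -/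
def InTension (a : ℕ) {m : ℕ} (w : Fin m → ℚ) (i : Fin m) : Prop :=
  ∃ i' : Fin m, (i'.val + 1 = i.val ∧ w i - w i' = -((a : ℚ) - 1 / 2)) ∨
    (i.val + 1 = i'.val ∧ w i' - w i = (a : ℚ) - 1 / 2)

/-- Height of the topmost cell of column `i` whose status is recorded by a bit: the curtain cell in
a column in tension, the cell just below it otherwise. -/
def recordTop (a : ℕ) {m : ℕ} (w : Fin m → ℚ) (i : Fin m) : ℚ :=
  open Classical in if InTension a w i then w i else w i - 1

/-! ### The sketch -/

/-- The memory content of the sketch: a curtain and an `h × m` bit array. -/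
@[ext] structure State (m h : ℕ) where
  /-- the curtain -/
  curt : Fin m → ℚ
  /-- the bit array -/
  bits : Fin h → Fin m → Bool

/-- Height of the highest cell of column `i` that was hit; the always occupied dummy cell, which
lies one level below cell `0`, if there is none. -/
def highest {m : ℕ} (D : Finset (Cell m)) (i : Fin m) : ℚ :=
  (((D.filter (fun c => c.1 = i)).sup (fun c => c.2 + 1) : ℕ) : ℚ) - 1 + shift i

/-- The state of the sketch once the cells in `D` have been hit. -/
def sketch (a h : ℕ) {m : ℕ} (D : Finset (Cell m)) : State m h where
  curt := curtain a (highest D)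
  bits r i := open Classical in decide (∃ c ∈ D, c.1 = i ∧
    height c = recordTop a (curtain a (highest D)) i - ((r.val : ℕ) : ℚ))

/-- The status of a cell, read off from the memory content. Cells above the curtain are free; the
`h` recorded cells are occupied iff their bit is set; all other cells are occupied. -/
def Occupied (a : ℕ) {m h : ℕ} (s : State m h) (c : Cell m) : Prop :=
  height c ≤ s.curt c.1 ∧
    ∀ r : Fin h, height c = recordTop a s.curt c.1 - ((r.val : ℕ) : ℚ) → s.bits r c.1 = true

/-- The state changing probability of a state: the total area of its free cells. By
`sketch_insert_ne_iff` it is the probability that a fresh dart changes the state. -/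
def changeProb (q : ℝ) (L : ℕ∞) (a : ℕ) {m h : ℕ} (s : State m h) : ℝ :=
  (dartLaw m).real {d | ∃ c, cellOf q L d = some c ∧ ¬ Occupied a s c}

/-! ### Running the sketch on a stream -/

/-- A uniformly random hash function from the universe `{0, …, U - 1}` to darts. -/
def oracle (m U : ℕ) : Measure (Fin U → Fin m × ℝ) := Measure.pi (fun _ => dartLaw m)

/-- The state after processing the stream `l`. -/
def stateAfter (q : ℝ) (L : ℕ∞) (a h : ℕ) {m U : ℕ} (hash : Fin U → Fin m × ℝ)
    (l : List (Fin U)) : State m h :=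
  sketch a h (l.filterMap (fun x => cellOf q L (hash x))).toFinset

/-- The martingale estimate after processing the stream `l`: every element that changes the
state adds the inverse of the state changing probability of the state that it found. -/
def estimate (q : ℝ) (L : ℕ∞) (a h : ℕ) {m U : ℕ} (l : List (Fin U))
    (hash : Fin U → Fin m × ℝ) : ℝ :=
  open Classical in
  ∑ k ∈ Finset.range l.length,
    if stateAfter q L a h hash (l.take (k + 1)) ≠ stateAfter q L a h hash (l.take k) then
      (changeProb q L a (stateAfter q L a h hash (l.take k)))⁻¹
    else 0

/-- The true cardinality of a stream: its number of distinct elements. -/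
def cardinality {U : ℕ} (l : List (Fin U)) : ℕ := l.toFinset.card

/-- The relative variance of the estimate. -/
def relVar (q : ℝ) (L : ℕ∞) (a h m : ℕ) {U : ℕ} (l : List (Fin U)) : ℝ :=
  variance (estimate q L a h l) (oracle m U) / (cardinality l : ℝ) ^ 2

/-! ### Memory -/

/-- The number of levels used for a universe of size `U`: the last cell of a column has
measure at most `1 / (m * U)`. -/
def levels (q : ℝ) (U : ℕ) : ℕ := ⌈Real.logb q (U : ℝ)⌉₊

/-- The memory contents of a sketch with cells `0, …, L` in each column: the curtain height in
column `0` is one of `-1, 0, …, L`, and all offsets are allowable. -/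
def codes (L a m h : ℕ) : Set (State m h) :=
  {s | (∀ i : Fin m, i.val = 0 → ∃ j : ℕ, j ≤ L + 1 ∧ s.curt i = (j : ℚ) - 1) ∧
    IsValid a s.curt}

/-- Number of bits used: a fixed-length binary code for the sketch proper, and one word of
`⌈log₂ U⌉` bits for the estimate. -/
def memory (q : ℝ) (a h m U : ℕ) : ℕ :=
  Nat.clog 2 (codes (levels q U) a m h).ncard + Nat.clog 2 U

/-! ### The constants -/

/-- The limit of `m` times the relative variance. -/
def varConst (q : ℝ) (a h : ℕ) : ℝ :=
  q * Real.log q / (2 * (q - 1)) *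
    ((q - 1) / q + 2 / (q ^ h * (q ^ ((a : ℝ) - 1 / 2) - 1)) + 1 / q ^ (h + 1))

/-- The limiting memory-variance product. -/
def mvpConst (q : ℝ) (a h : ℕ) : ℝ :=
  (Real.logb 2 (2 * (a : ℝ)) + (h : ℝ)) * varConst q a h

/-! ### The definitions match their descriptions -/

theorem le_curtain_of (a : ℕ) {m : ℕ} (v : Fin m → ℚ) (i j : Fin m) :
    v j - |((i.val : ℚ) - (j.val : ℚ))| * ((a : ℚ) - 1 / 2) ≤ curtain a v i :=
  Finset.le_sup' (fun j : Fin m => v j - |((i.val : ℚ) - (j.val : ℚ))| * ((a : ℚ) - 1 / 2))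
    (Finset.mem_univ j)

theorem le_curtain (a : ℕ) {m : ℕ} (v : Fin m → ℚ) (i : Fin m) : v i ≤ curtain a v i := by
  simpa using le_curtain_of a v i i

theorem exists_curtain_eq (a : ℕ) {m : ℕ} (v : Fin m → ℚ) (i : Fin m) :
    ∃ j : Fin m, curtain a v i = v j - |((i.val : ℚ) - (j.val : ℚ))| * ((a : ℚ) - 1 / 2) := by
  obtain ⟨j, -, hj⟩ := Finset.exists_mem_eq_sup' (s := (Finset.univ : Finset (Fin m)))
    ⟨i, Finset.mem_univ i⟩
    (fun j : Fin m => v j - |((i.val : ℚ) - (j.val : ℚ))| * ((a : ℚ) - 1 / 2))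
  exact ⟨j, hj⟩

theorem curtain_le_add {a : ℕ} (ha : 1 ≤ a) {m : ℕ} (v : Fin m → ℚ) (i k : Fin m) :
    curtain a v k - |((i.val : ℚ) - (k.val : ℚ))| * ((a : ℚ) - 1 / 2) ≤ curtain a v i := by
  obtain ⟨j, hj⟩ := exists_curtain_eq a v k
  have h1 := le_curtain_of a v i j
  have h2 : |((i.val : ℚ) - (j.val : ℚ))| ≤
      |((i.val : ℚ) - (k.val : ℚ))| + |((k.val : ℚ) - (j.val : ℚ))| := abs_sub_le _ _ _
  have ha' : (1 : ℚ) ≤ a := by exact_mod_cast ha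
  nlinarith

/-- A vector of heights of genuine cells or dummy cells. -/
def IsAligned {m : ℕ} (v : Fin m → ℚ) : Prop := ∀ i, ∃ n : ℤ, v i = (n : ℚ) + shift i

theorem two_mul_shift {m : ℕ} (i : Fin m) : 2 * shift i = ((i.val % 2 : ℕ) : ℚ) := by
  unfold shift; ring

/-- Aligned vectors take even or odd half-integer values according to the column. -/
theorem isAligned_iff {m : ℕ} (v : Fin m → ℚ) :
    IsAligned v ↔ ∀ i, ∃ n : ℤ, 2 * v i = 2 * (n : ℚ) + (i.val : ℚ) := by
  refine forall_congr' fun i => ?_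
  have h1 := two_mul_shift i
  have h2 : ((i.val % 2 : ℕ) : ℚ) + 2 * ((i.val / 2 : ℕ) : ℚ) = (i.val : ℚ) := by
    exact_mod_cast Nat.mod_add_div i.val 2
  constructor
  · rintro ⟨n, hn⟩
    refine ⟨n - (i.val / 2 : ℕ), ?_⟩
    rw [Int.cast_sub, Int.cast_natCast]
    linarith
  · rintro ⟨n, hn⟩
    refine ⟨n + (i.val / 2 : ℕ), ?_⟩
    rw [Int.cast_add, Int.cast_natCast]
    linarith

theorem curtain_aligned (a : ℕ) {m : ℕ} {v : Fin m → ℚ} (hv : IsAligned v) :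
    IsAligned (curtain a v) := by
  rw [isAligned_iff] at hv ⊢
  intro i
  obtain ⟨j, hj⟩ := exists_curtain_eq a v i
  obtain ⟨n, hn⟩ := hv j
  rcases le_total (i.val : ℚ) (j.val : ℚ) with hij | hij
  · rw [abs_of_nonpos (by linarith)] at hj
    refine ⟨n + a * ((i.val : ℤ) - j.val) + (j.val - i.val), ?_⟩
    rw [hj]; push_cast; linarith
  · rw [abs_of_nonneg (by linarith)] at hj
    refine ⟨n - a * ((i.val : ℤ) - j.val), ?_⟩
    rw [hj]; push_cast; linarith

theorem curtain_isValid {a : ℕ} (ha : 1 ≤ a) {m : ℕ} {v : Fin m → ℚ} (hv : IsAligned v) :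
    IsValid a (curtain a v) := by
  intro i j hij
  have hal := (isAligned_iff _).1 (curtain_aligned a hv)
  obtain ⟨n, hn⟩ := hal i
  obtain ⟨k, hk⟩ := hal j
  have hij' : (j.val : ℚ) = i.val + 1 := by exact_mod_cast hij
  have h1 := curtain_le_add ha v i j
  have h2 := curtain_le_add ha v j i
  rw [hij'] at h1 h2
  rw [show ((i.val : ℚ) - (i.val + 1)) = -1 by ring, abs_neg, abs_one, one_mul] at h1
  rw [show ((i.val : ℚ) + 1 - i.val) = 1 by ring, abs_one, one_mul] at h2
  have h3 : (0 : ℤ) ≤ k - n + a := by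
    have : (-1 : ℚ) < (k - n + a : ℤ) := by push_cast; linarith
    have : (-1 : ℤ) < k - n + a := by exact_mod_cast this
    linarith
  have h4 : k - n + a < 2 * a := by
    have : ((k - n + a : ℤ) : ℚ) < ((2 * a : ℤ) : ℚ) := by push_cast; linarith
    exact_mod_cast this
  refine ⟨(k - n + a).toNat, by omega, ?_⟩
  have h5 : (((k - n + a).toNat : ℕ) : ℚ) = (k : ℚ) - n + a := by
    have : (((k - n + a).toNat : ℕ) : ℤ) = k - n + a := Int.toNat_of_nonneg h3
    exact_mod_cast this
  rw [h5]; linarith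

theorem abs_le_of_mem_offsets {a : ℕ} {x : ℚ} (hx : x ∈ offsets a) : |x| ≤ (a : ℚ) - 1 / 2 := by
  obtain ⟨s, hs, rfl⟩ := hx
  have h1 : (s : ℚ) + 1 ≤ 2 * a := by exact_mod_cast hs
  have h2 : (0 : ℚ) ≤ s := by positivity
  rw [abs_le]; constructor <;> linarith

theorem IsValid.sub_le {a : ℕ} {m : ℕ} {w : Fin m → ℚ} (hw : IsValid a w) :
    ∀ (n : ℕ) (i j : Fin m), j.val = i.val + n → |w j - w i| ≤ (n : ℚ) * ((a : ℚ) - 1 / 2) := by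
  intro n
  induction n with
  | zero =>
    intro i j hij
    have : i = j := Fin.ext (by omega)
    simp [this]
  | succ n ih =>
    intro i j hij
    have hk : i.val + n < m := by have := j.isLt; omega
    have h1 := ih i ⟨i.val + n, hk⟩ rfl
    have h2 := abs_le_of_mem_offsets (hw ⟨i.val + n, hk⟩ j (by simp; omega))
    have h3 := abs_sub_le (w j) (w ⟨i.val + n, hk⟩) (w i)
    push_cast
    linarith

/-- The curtain of `v` is the minimal valid vector that dominates `v`. -/
theorem curtain_isLeast {a : ℕ} (ha : 1 ≤ a) {m : ℕ} {v : Fin m → ℚ} (hv : IsAligned v) :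
    IsLeast {w : Fin m → ℚ | IsValid a w ∧ ∀ i, v i ≤ w i} (curtain a v) := by
  refine ⟨⟨curtain_isValid ha hv, le_curtain a v⟩, ?_⟩
  rintro w ⟨hw, hvw⟩ i
  obtain ⟨j, hj⟩ := exists_curtain_eq a v i
  rw [hj]
  have h1 := hvw j
  rcases le_total i.val j.val with hij | hij
  · have h2 := hw.sub_le (j.val - i.val) i j (by omega)
    rw [Nat.cast_sub hij] at h2
    have hij' : (i.val : ℚ) ≤ j.val := by exact_mod_cast hij
    rw [abs_of_nonpos (by linarith)]
    have := (abs_le.1 h2).2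
    linarith
  · have h2 := hw.sub_le (i.val - j.val) j i (by omega)
    rw [Nat.cast_sub hij] at h2
    have hij' : (j.val : ℚ) ≤ i.val := by exact_mod_cast hij
    rw [abs_of_nonneg (by linarith)]
    have := (abs_le.1 h2).1
    linarith

theorem highest_aligned {m : ℕ} (D : Finset (Cell m)) : IsAligned (highest D) := by
  intro i
  refine ⟨(((D.filter (fun c => c.1 = i)).sup (fun c => c.2 + 1) : ℕ) : ℤ) - 1, ?_⟩
  unfold highest; push_cast; ring

theorem height_le_highest {m : ℕ} {D : Finset (Cell m)} {c : Cell m} (hc : c ∈ D) :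
    height c ≤ highest D c.1 := by
  have h1 : c.2 + 1 ≤ (D.filter (fun c' => c'.1 = c.1)).sup (fun c => c.2 + 1) :=
    Finset.le_sup (f := fun c : Cell m => c.2 + 1) (by simp [hc])
  have h2 : (c.2 : ℚ) + 1 ≤ (((D.filter (fun c' => c'.1 = c.1)).sup (fun c => c.2 + 1) : ℕ) : ℚ) := by
    exact_mod_cast h1
  unfold height highest; linarith

theorem mem_of_height_eq_highest {m : ℕ} {D : Finset (Cell m)} {c : Cell m}
    (hc : height c = highest D c.1) : c ∈ D := by
  unfold height highest at hc
  have h1 : (D.filter (fun c' => c'.1 = c.1)).sup (fun c => c.2 + 1) = c.2 + 1 := by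
    have : (((D.filter (fun c' => c'.1 = c.1)).sup (fun c => c.2 + 1) : ℕ) : ℚ) = (c.2 : ℚ) + 1 := by
      linarith
    exact_mod_cast this
  have hne : (D.filter (fun c' => c'.1 = c.1)).Nonempty := by
    by_contra hcon
    rw [Finset.not_nonempty_iff_eq_empty] at hcon
    rw [hcon] at h1
    simp at h1
  obtain ⟨c', hc', he⟩ := Finset.exists_mem_eq_sup _ hne (fun c : Cell m => c.2 + 1)
  rw [he] at h1
  simp only [Finset.mem_filter] at hc'
  have : c' = c := Prod.ext hc'.2 (by omega)
  exact this ▸ hc'.1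

theorem highest_insert {m : ℕ} (D : Finset (Cell m)) (c : Cell m) (i : Fin m) :
    highest (insert c D) i = if c.1 = i then max (height c) (highest D i) else highest D i := by
  unfold highest height
  rw [Finset.filter_insert]
  split_ifs with h
  · rw [Finset.sup_insert, ← h]
    have e : ∀ x y : ℕ, (((x ⊔ y : ℕ)) : ℚ) = max (x : ℚ) (y : ℚ) := fun x y => by
      exact_mod_cast rfl
    rw [e]
    push_cast
    rw [← max_sub_sub_right, ← max_add_add_right]
    congr 1
    ring
  · rfl

/-- Hitting a cell below the curtain does not move the curtain. -/
theorem curtain_insert_of_le {a : ℕ} (ha : 1 ≤ a) {m : ℕ} {D : Finset (Cell m)} {c : Cell m}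
    (hc : height c ≤ curtain a (highest D) c.1) :
    curtain a (highest (insert c D)) = curtain a (highest D) := by
  apply le_antisymm
  · apply (curtain_isLeast ha (highest_aligned _)).2
    refine ⟨curtain_isValid ha (highest_aligned _), fun i => ?_⟩
    rw [highest_insert]
    split_ifs with h
    · subst h
      exact max_le hc (le_curtain _ _ _)
    · exact le_curtain _ _ _
  · apply (curtain_isLeast ha (highest_aligned _)).2
    refine ⟨curtain_isValid ha (highest_aligned _), fun i => le_trans ?_ (le_curtain _ _ _)⟩
    rw [highest_insert]
    split_ifs with h
    · exact le_max_right _ _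
    · exact le_rfl

/-- The curtain cell of a column that is not in tension is the highest cell hit there. -/
theorem curtain_eq_of_not_inTension {a : ℕ} (ha : 1 ≤ a) {m : ℕ} {v : Fin m → ℚ} {i : Fin m}
    (hi : ¬ InTension a (curtain a v) i) : curtain a v i = v i := by
  obtain ⟨j, hj⟩ := exists_curtain_eq a v i
  rcases lt_trichotomy i.val j.val with hij | hij | hij
  · exfalso
    apply hi
    have hk : i.val + 1 < m := by have := j.isLt; omega
    refine ⟨⟨i.val + 1, hk⟩, Or.inr ⟨rfl, ?_⟩⟩
    have h1 := le_curtain_of a v ⟨i.val + 1, hk⟩ j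
    have h2 := curtain_le_add ha v i ⟨i.val + 1, hk⟩
    have hij' : (i.val : ℚ) + 1 ≤ j.val := by exact_mod_cast hij
    rw [abs_of_nonpos (by linarith)] at hj
    push_cast at h1 h2
    rw [abs_of_nonpos (by linarith)] at h1
    rw [show ((i.val : ℚ) - (i.val + 1)) = -1 by ring, abs_neg, abs_one, one_mul] at h2
    linarith
  · have : i = j := Fin.ext hij
    subst this
    simpa using hj
  · exfalso
    apply hi
    have hk : i.val - 1 < m := by have := i.isLt; omega
    refine ⟨⟨i.val - 1, hk⟩, Or.inl ⟨by simp; omega, ?_⟩⟩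
    have h1 := le_curtain_of a v ⟨i.val - 1, hk⟩ j
    have h2 := curtain_le_add ha v i ⟨i.val - 1, hk⟩
    have hij' : (j.val : ℚ) + 1 ≤ i.val := by exact_mod_cast hij
    have hc : ((i.val - 1 : ℕ) : ℚ) = (i.val : ℚ) - 1 := by
      rw [Nat.cast_sub (by omega)]; simp
    rw [abs_of_nonneg (by linarith)] at hj
    simp only [hc] at h1 h2
    rw [abs_of_nonneg (by linarith)] at h1
    rw [show ((i.val : ℚ) - (i.val - 1)) = 1 by ring, abs_one, one_mul] at h2
    linarith

/-- Every hit cell is occupied. -/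
theorem occupied_of_mem (a h : ℕ) {m : ℕ} {D : Finset (Cell m)} {c : Cell m} (hc : c ∈ D) :
    Occupied a (sketch a h D) c :=
  ⟨(height_le_highest hc).trans (le_curtain a _ _), fun r hr => by
    simp only [sketch, decide_eq_true_eq]
    exact ⟨c, hc, rfl, hr⟩⟩

/-- A dart changes the state if and only if it lands in a free cell. -/
theorem sketch_insert_ne_iff {a : ℕ} (ha : 1 ≤ a) (h : ℕ) {m : ℕ} (D : Finset (Cell m))
    (c : Cell m) : sketch a h (insert c D) ≠ sketch a h D ↔ ¬ Occupied a (sketch a h D) c := by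
  constructor
  · intro hne hocc
    apply hne
    have hcur := curtain_insert_of_le ha hocc.1
    ext i j
    · exact congrFun hcur i
    · have key : (∃ c' ∈ insert c D, c'.1 = j ∧ height c' =
            recordTop a (curtain a (highest D)) j - ((i.val : ℕ) : ℚ)) ↔
          (∃ c' ∈ D, c'.1 = j ∧ height c' =
            recordTop a (curtain a (highest D)) j - ((i.val : ℕ) : ℚ)) := by
        constructor
        · rintro ⟨c', hc', hj, hh⟩
          rcases Finset.mem_insert.1 hc' with rfl | hc'
          · subst hj
            have := hocc.2 i hh
            simpa only [sketch, decide_eq_true_eq] using this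
          · exact ⟨c', hc', hj, hh⟩
        · rintro ⟨c', hc', hj, hh⟩
          exact ⟨c', Finset.mem_insert_of_mem hc', hj, hh⟩
      simp only [sketch, hcur, key]
  · intro hfree heq
    apply hfree
    rw [← heq]
    exact occupied_of_mem a h (Finset.mem_insert_self c D)

end MartingaleCurtain

end

open MeasureTheory ProbabilityTheory

noncomputable section

set_option linter.unusedSectionVars false

namespace MartingaleCurtain

/-! ### Free cells as void events -/

/-! Void events. A cell is free exactly when no cell that blocks it has been hit
(`occupied_sketch_iff`). The blocking cells are the cell itself, those of its own column more than
`h` levels above it, and, in a column at distance `d`, those at least `h + d * (a - 1/2)` higher.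
The darts are independent, so after `k` distinct elements a cell is free with probability `(1 - b) ^
k`, where `b` is the area of its blocking cells (`blkArea`). Away from the borders, with `y = q ^
(-(smoothing i + j))`, this area is about `y / m * K` for `K = closedConst q a h 0`: the cell
itself, the tail of its own column and a geometric series on each side give the three terms of the
constant.

Mean. The offsets `smoothing i` fill the unit interval with spacing about `1 / m`. So the sum over
all cells of area times `exp (-(k * y * K / m))` is a Riemann sum for the integral of `q ^ (-x) *
exp (-(κ * q ^ (-x)))`, whose primitive `gumbel` is explicit. The free area `P` after `k` elements
therefore has mean about `(m / k) / (2 * C)` with `C = varConst q a h` (`mean_freeArea_le`,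
`le_mean_partArea`, `inv_two_mul_varConst`).

Martingale. A fresh element adds `1 / P` with probability `P`, hence `1` on average while `P > 0`.
The estimate minus the number of elements that met a live state (`compens`) is a martingale whose
increments are orthogonal, with second moments `E[1 / P - live]`
(`integral_sq_martEst_sub_compens`). If `E[1 / P]` is close to `1 / E[P]`, that is to `2 * C * k /
m`, then summation over `k < λ` gives `C * λ ^ 2 / m`.

Inverse. The lower bound for `E[1 / P]` is Jensen's inequality in tangent form
(`le_integral_inv_freeArea`). For the upper bound, the free area of the small cells has relative
variance of order `1 / m`, because one dart blocks little area (`variance_partArea_le`), and a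
Chebyshev argument passes to the inverse (`inv_le_of_le`) unless `P` is far too small. That
exception is handled level by level with exponential moments (`prob_totalReach_le`). All levels
contribute equally, and the total is of order `k * (L + m) * exp (-(c * m))`; as `L` is about `log_q
U`, the condition `ln ln U = o(m)` makes it negligible. The same tail bound makes saturation
exponentially rare, which controls the bias and the fluctuation of `compens`
(`variance_martEst_near`).

Memory. A code is an initial height, `m - 1` offsets and `h * m` bits, chosen freely, so the
logarithm of their number is `m * (log₂ (2 * a) + h)` up to terms negligible when `ln U = o(m)`. -/

/-- Hitting `c'` makes the cell `c` occupied. -/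
def Blocks (a h : ℕ) {m : ℕ} (c c' : Cell m) : Prop :=
  c' = c ∨ (c'.1 = c.1 ∧ c.2 + h < c'.2) ∨
    (c'.1 ≠ c.1 ∧ height c + (h : ℚ) + |(c.1.val : ℚ) - (c'.1.val : ℚ)| * ((a : ℚ) - 1 / 2) ≤
      height c')

theorem shift_nonneg {m : ℕ} (i : Fin m) : 0 ≤ shift i := by unfold shift; positivity

theorem shift_le_half {m : ℕ} (i : Fin m) : shift i ≤ 1 / 2 := by
  have h1 : ((i.val % 2 : ℕ) : ℚ) ≤ 1 := by exact_mod_cast Nat.lt_succ_iff.1 (Nat.mod_lt _ two_pos)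
  unfold shift; linarith

theorem height_nonneg {m : ℕ} (c : Cell m) : 0 ≤ height c :=
  add_nonneg (Nat.cast_nonneg _) (shift_nonneg _)

/-- The dummy cell has height at most `-1/2`, so a nonnegative value can only come from a hit. -/
theorem exists_mem_of_highest_nonneg {m : ℕ} {D : Finset (Cell m)} {i : Fin m}
    (hi : 0 ≤ highest D i) : ∃ n : ℕ, (i, n) ∈ D ∧ height (i, n) = highest D i := by
  have h1 := shift_le_half i
  set s := (D.filter (fun c => c.1 = i)).sup (fun c => c.2 + 1) with hs
  have h2 : highest D i = (s : ℚ) - 1 + shift i := rfl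
  have h3 : 0 < s := by
    rcases Nat.eq_zero_or_pos s with h | h
    · rw [h2, h] at hi; push_cast at hi; linarith
    · exact h
  have h4 : height (i, s - 1) = highest D i := by
    rw [h2]; unfold height; push_cast [Nat.cast_sub h3]; ring
  exact ⟨s - 1, mem_of_height_eq_highest h4, h4⟩

theorem height_injective_snd {m : ℕ} {c c' : Cell m} (h1 : c'.1 = c.1)
    (h2 : height c' = height c) : c' = c := by
  refine Prod.ext h1 ?_
  unfold height at h2
  rw [h1] at h2
  exact_mod_cast add_right_cancel h2

/-- If the curtain is in tension at `i`, it is supported by a cell hit in another column. -/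
theorem exists_support_of_inTension {a : ℕ} (ha : 1 ≤ a) {m : ℕ} {v : Fin m → ℚ} {i : Fin m}
    (hi : InTension a (curtain a v) i) :
    ∃ j, j ≠ i ∧ curtain a v i = v j - |(i.val : ℚ) - (j.val : ℚ)| * ((a : ℚ) - 1 / 2) := by
  have ha' : (1 : ℚ) ≤ a := by exact_mod_cast ha
  -- Tension means that a neighbour `k` lies a full slope above `i`. A column that supports the
  -- curtain at `k` then supports it at `i` as well, and it is not `i` itself because slopes descend
  -- away from their support.
  have key : ∀ k : Fin m, |(i.val : ℚ) - (k.val : ℚ)| = 1 →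
      curtain a v k = curtain a v i + ((a : ℚ) - 1 / 2) →
      ∃ j, j ≠ i ∧ curtain a v i = v j - |(i.val : ℚ) - (j.val : ℚ)| * ((a : ℚ) - 1 / 2) := by
    intro k hk he
    obtain ⟨j, hj⟩ := exists_curtain_eq a v k
    have h1 := le_curtain_of a v i j
    have h2 : |((i.val : ℚ) - (j.val : ℚ))| ≤
        |((i.val : ℚ) - (k.val : ℚ))| + |((k.val : ℚ) - (j.val : ℚ))| := abs_sub_le _ _ _
    refine ⟨j, ?_, ?_⟩
    · rintro rfl
      have h3 := abs_nonneg ((k.val : ℚ) - (j.val : ℚ))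
      rw [sub_self, abs_zero] at h1
      nlinarith
    · apply le_antisymm _ h1
      rw [hk] at h2
      nlinarith
  obtain ⟨k, ⟨h1, h2⟩ | ⟨h1, h2⟩⟩ := hi
  · refine key k ?_ (by linarith)
    have : (i.val : ℚ) = k.val + 1 := by exact_mod_cast h1.symm
    rw [this]; norm_num
  · refine key k ?_ (by linarith)
    have : (k.val : ℚ) = i.val + 1 := by exact_mod_cast h1.symm
    rw [this]; norm_num

/-- Where the curtain is not in tension, it lies strictly above all slopes from other columns. -/
theorem lt_of_not_inTension {a : ℕ} (ha : 1 ≤ a) {m : ℕ} {v : Fin m → ℚ} {i : Fin m}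
    (hi : ¬ InTension a (curtain a v) i) {j : Fin m} (hj : j ≠ i) :
    v j < curtain a v i + |(i.val : ℚ) - (j.val : ℚ)| * ((a : ℚ) - 1 / 2) := by
  -- Here `k` is the neighbour of `i` on the way to `j`. Without tension the curtain rises from `i`
  -- to `k` by strictly less than the slope, and this strictness is passed on to `j`.
  have key : ∀ k : Fin m, |(i.val : ℚ) - (k.val : ℚ)| = 1 →
      |(i.val : ℚ) - (j.val : ℚ)| = 1 + |(k.val : ℚ) - (j.val : ℚ)| →
      curtain a v k ≠ curtain a v i + ((a : ℚ) - 1 / 2) →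
      v j < curtain a v i + |(i.val : ℚ) - (j.val : ℚ)| * ((a : ℚ) - 1 / 2) := by
    intro k hk hkj he
    have h1 := le_curtain_of a v k j
    have h2 := curtain_le_add ha v i k
    rw [hk] at h2
    have h3 : curtain a v k < curtain a v i + ((a : ℚ) - 1 / 2) := lt_of_le_of_ne (by linarith) he
    rw [hkj]; linarith
  rcases lt_or_gt_of_ne (fun h => hj (Fin.ext h) : j.val ≠ i.val) with hlt | hlt
  · have hk : i.val - 1 < m := by have := i.isLt; omega
    have hc : ((i.val - 1 : ℕ) : ℚ) = (i.val : ℚ) - 1 := by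
      rw [Nat.cast_sub (by omega)]; simp
    have hlt' : (j.val : ℚ) + 1 ≤ i.val := by exact_mod_cast hlt
    refine key ⟨i.val - 1, hk⟩ ?_ ?_ ?_
    · simp only [hc]; norm_num
    · simp only [hc]; rw [abs_of_nonneg (by linarith), abs_of_nonneg (by linarith)]; ring
    · intro h
      exact hi ⟨⟨i.val - 1, hk⟩, Or.inl ⟨by simp; omega, by linarith⟩⟩
  · have hk : i.val + 1 < m := by have := j.isLt; omega
    have hlt' : (i.val : ℚ) + 1 ≤ j.val := by exact_mod_cast hlt
    refine key ⟨i.val + 1, hk⟩ ?_ ?_ ?_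
    · push_cast; norm_num
    · push_cast; rw [abs_of_nonpos (by linarith), abs_of_nonpos (by linarith)]; ring
    · intro h
      exact hi ⟨⟨i.val + 1, hk⟩, Or.inr ⟨rfl, by linarith⟩⟩

/-- A cell is occupied if and only if one of the cells that block it has been hit. -/
theorem occupied_sketch_iff {a : ℕ} (ha : 1 ≤ a) (h : ℕ) {m : ℕ} (D : Finset (Cell m))
    (c : Cell m) : Occupied a (sketch a h D) c ↔ ∃ c' ∈ D, Blocks a h c c' := by
  have ha' : (1 : ℚ) ≤ a := by exact_mod_cast ha
  constructor
  · rintro ⟨h1, h2⟩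
    by_contra hcon
    push Not at hcon
    have hcD : c ∉ D := fun hc => hcon c hc (Or.inl rfl)
    set g := curtain a (highest D) c.1 with hg
    have h1 : height c ≤ g := h1
    -- Curtain and cell heights in one column share their fractional part, so the depth of `c` below
    -- the curtain is a natural number `n`.
    obtain ⟨n, hn⟩ : ∃ n : ℕ, g = height c + n := by
      obtain ⟨z, hz⟩ := curtain_aligned a (highest_aligned D) c.1
      rw [← hg] at hz
      have h3 : (0 : ℤ) ≤ z - c.2 := by
        have : (0 : ℚ) ≤ ((z - c.2 : ℤ) : ℚ) := by
          push_cast; rw [hz] at h1; unfold height at h1; linarith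
        exact_mod_cast this
      refine ⟨(z - c.2).toNat, ?_⟩
      have h5 : (((z - c.2).toNat : ℕ) : ℚ) = (z : ℚ) - c.2 := by
        have : (((z - c.2).toNat : ℕ) : ℤ) = z - c.2 := Int.toNat_of_nonneg h3
        exact_mod_cast this
      rw [h5, hz]; unfold height; ring
    have hbit : ∀ r : Fin h, height c ≠ recordTop a (curtain a (highest D)) c.1 - ((r.val : ℕ) : ℚ) := by
      intro r hr
      have := h2 r hr
      simp only [sketch, decide_eq_true_eq] at this
      obtain ⟨c', hc', he, hh⟩ := this
      rw [← hr] at hh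
      exact hcD (height_injective_snd he hh ▸ hc')
    -- In tension the recorded depths are `0, …, h - 1`; otherwise they are `1, …, h`, and depth `0`
    -- is a hit cell. An occupied cell that was not hit is therefore at depth at least `h`,
    -- respectively more than `h`. These are the thresholds in `Blocks` for another column and for
    -- its own.
    by_cases ht : InTension a (curtain a (highest D)) c.1
    · obtain ⟨j, hj, he⟩ := exists_support_of_inTension ha ht
      have hpos : 0 ≤ highest D j := by
        have := height_nonneg c
        have h4 := abs_nonneg ((c.1.val : ℚ) - (j.val : ℚ))
        rw [← hg] at he
        nlinarith
      obtain ⟨k, hk, hkh⟩ := exists_mem_of_highest_nonneg hpos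
      have h6 : n < h := by
        by_contra hcon2
        refine hcon _ hk (Or.inr (Or.inr ⟨hj, ?_⟩))
        have : (h : ℚ) ≤ n := by exact_mod_cast not_lt.1 hcon2
        rw [hkh]
        rw [← hg] at he
        linarith
      apply hbit ⟨n, h6⟩
      rw [recordTop, if_pos ht, ← hg, hn]; simp
    · have he := curtain_eq_of_not_inTension ha ht
      rw [← hg] at he
      have hpos : 0 ≤ highest D c.1 := by
        rw [← he]; exact (height_nonneg c).trans h1
      obtain ⟨k, hk, hkh⟩ := exists_mem_of_highest_nonneg hpos
      have hkn : k = c.2 + n := by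
        rw [← he, hn] at hkh
        unfold height at hkh
        have : (k : ℚ) = ((c.2 + n : ℕ) : ℚ) := by push_cast; simp at hkh; linarith
        exact_mod_cast this
      have h0 : n ≠ 0 := by
        rintro rfl
        apply hcD
        have : (c.1, k) = c := Prod.ext rfl (by simpa using hkn)
        exact this ▸ hk
      have h6 : n ≤ h := by
        by_contra hcon2
        exact hcon _ hk (Or.inr (Or.inl ⟨rfl, by simp; omega⟩))
      apply hbit ⟨n - 1, by omega⟩
      rw [recordTop, if_neg ht, ← hg, hn]
      push_cast [Nat.cast_sub (Nat.one_le_iff_ne_zero.2 h0)]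
      ring
  · rintro ⟨c', hc', hb⟩
    by_contra hfree
    have hcD : c ∉ D := fun hc => hfree (occupied_of_mem a h hc)
    set g := curtain a (highest D) c.1 with hg
    have hle := height_le_highest hc'
    have hup := le_curtain_of a (highest D) c.1 c'.1
    rw [← hg] at hup
    -- A free cell is above the curtain or among the recorded cells. Only without tension can its
    -- depth equal `h`.
    have hcase : g < height c ∨ (InTension a (curtain a (highest D)) c.1 ∧ g < height c + h) ∨
        (¬ InTension a (curtain a (highest D)) c.1 ∧ g ≤ height c + h) := by
      by_contra hcon
      push Not at hcon
      obtain ⟨k1, k2, k3⟩ := hcon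
      apply hfree
      refine ⟨k1, fun r hr => ?_⟩
      exfalso
      have hr1 : ((r.val : ℕ) : ℚ) + 1 ≤ h := by exact_mod_cast r.isLt
      by_cases ht : InTension a (curtain a (highest D)) c.1
      · have := k2 ht
        have e : recordTop a (curtain a (highest D)) c.1 = g := by rw [recordTop, if_pos ht]
        simp only [sketch, e] at hr
        linarith
      · have := k3 ht
        have e : recordTop a (curtain a (highest D)) c.1 = g - 1 := by rw [recordTop, if_neg ht]
        simp only [sketch, e] at hr
        linarith
    have hh0 : (0 : ℚ) ≤ h := Nat.cast_nonneg h
    have hgle : g ≤ height c + h := by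
      rcases hcase with k | ⟨-, k⟩ | ⟨-, k⟩ <;> linarith
    rcases hb with rfl | ⟨h1, h2⟩ | ⟨h1, h2⟩
    · exact hcD hc'
    · rw [h1, sub_self, abs_zero, zero_mul, sub_zero] at hup
      rw [h1] at hle
      have h3 : height c + h < height c' := by
        have : (c.2 : ℚ) + h < c'.2 := by exact_mod_cast h2
        unfold height; rw [h1]; linarith
      linarith
    · rcases hcase with k | ⟨-, k⟩ | ⟨ht, k⟩
      · linarith
      · linarith
      -- At depth exactly `h` the weak slope inequality would not exclude a blocking hit; the strict
      -- one does.
      · have := lt_of_not_inTension ha ht h1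
        rw [← hg] at this
        linarith

/-! ### The law of the cell hit by a dart -/

instance instMeasurableSpaceOption {β : Type*} : MeasurableSpace (Option β) := ⊤

instance instDiscreteMeasurableSpaceOption {β : Type*} : DiscreteMeasurableSpace (Option β) :=
  ⟨fun _ => trivial⟩

theorem smoothing_nonneg {m : ℕ} (i : Fin m) : 0 ≤ smoothing i := by
  unfold smoothing
  have : (0 : ℝ) ≤ (shift i : ℝ) := by exact_mod_cast shift_nonneg i
  positivity

theorem smoothing_le_one {m : ℕ} (i : Fin m) : smoothing i ≤ 1 := by
  unfold smoothing
  have h1 : (shift i : ℝ) ≤ 1 / 2 := by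
    have := shift_le_half i
    have h2 : ((shift i : ℚ) : ℝ) ≤ ((1 / 2 : ℚ) : ℝ) := by exact_mod_cast this
    simpa using h2
  have h2 : ((i.val / 2 : ℕ) : ℝ) / (m : ℝ) ≤ 1 / 2 := by
    have hm : (0 : ℝ) < m := by exact_mod_cast (Nat.zero_le _).trans_lt i.isLt
    rw [div_le_iff₀ hm]
    have h3 : ((i.val / 2 : ℕ) : ℝ) * 2 ≤ m := by
      exact_mod_cast (Nat.div_mul_le_self _ _).trans i.isLt.le
    linarith
  linarith

/-- The last alternative reflects a default value: for `L = ⊤` an ordinate `≤ 0` lies below every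
boundary, and `sSup` of an unbounded set of naturals is `0`. For finite `L` it cannot occur. -/
theorem cellOf_eq_some_iff {q : ℝ} (hq : 1 < q) {m : ℕ} (L : ℕ∞) (d : Fin m × ℝ) (i : Fin m)
    (j : ℕ) : cellOf q L d = some (i, j) ↔ d.1 = i ∧ d.2 < q ^ (-(smoothing i)) ∧
      ((((j : ℕ∞) ≤ L ∧ d.2 < q ^ (-(smoothing i + (j : ℝ)))) ∧
        ¬ (((j + 1 : ℕ) : ℕ∞) ≤ L ∧ d.2 < q ^ (-(smoothing i + ((j + 1 : ℕ) : ℝ))))) ∨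
      (j = 0 ∧ ∀ n : ℕ, (n : ℕ∞) ≤ L ∧ d.2 < q ^ (-(smoothing i + (n : ℝ))))) := by
  obtain ⟨i', y⟩ := d
  unfold cellOf
  simp only
  constructor
  · intro h
    split_ifs at h with h0
    simp only [Option.some.injEq, Prod.mk.injEq] at h
    obtain ⟨rfl, h⟩ := h
    refine ⟨rfl, h0, ?_⟩
    set A := {j : ℕ | (j : ℕ∞) ≤ L ∧ y < q ^ (-(smoothing i' + (j : ℝ)))} with hA
    have h0A : 0 ∈ A := by simp [hA, h0]
    by_cases hb : BddAbove A
    · left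
      have h1 := Nat.sSup_mem ⟨0, h0A⟩ hb
      rw [h] at h1
      refine ⟨h1, fun h2 => ?_⟩
      have : j + 1 ≤ sSup A := le_csSup hb h2
      omega
    · right
      refine ⟨?_, fun n => ?_⟩
      · rw [← h]; exact Nat.sSup_of_not_bddAbove hb
      · rw [not_bddAbove_iff] at hb
        obtain ⟨k, ⟨hk1, hk2⟩, hk⟩ := hb n
        have hk' : (n : ℝ) ≤ k := by exact_mod_cast hk.le
        refine ⟨le_trans (by exact_mod_cast hk.le) hk1, hk2.trans_le ?_⟩
        exact Real.rpow_le_rpow_of_exponent_le hq.le (by linarith)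
  · rintro ⟨rfl, h0, h⟩
    rw [if_pos h0]
    simp only [Option.some.injEq, Prod.mk.injEq, true_and]
    rcases h with ⟨h1, h2⟩ | ⟨rfl, h1⟩
    · refine IsGreatest.csSup_eq ⟨h1, fun k ⟨hk1, hk2⟩ => ?_⟩
      by_contra hcon
      rw [not_le] at hcon
      apply h2
      have hcon' : ((j + 1 : ℕ) : ℝ) ≤ k := by exact_mod_cast hcon
      refine ⟨le_trans (by exact_mod_cast hcon) hk1, hk2.trans_le ?_⟩
      exact Real.rpow_le_rpow_of_exponent_le hq.le (by linarith)
    · refine Nat.sSup_of_not_bddAbove ?_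
      rw [not_bddAbove_iff]
      exact fun n => ⟨n + 1, h1 _, Nat.lt_succ_self n⟩

theorem measurable_cellOf {q : ℝ} (hq : 1 < q) {m : ℕ} (L : ℕ∞) :
    Measurable (cellOf (m := m) q L) := by
  have hc : ∀ (i : Fin m) (b : ℝ), MeasurableSet {d : Fin m × ℝ | d.1 = i ∧ d.2 < b} := fun i b =>
    (measurableSet_eq_fun measurable_fst measurable_const).inter
      (measurableSet_lt measurable_snd measurable_const)
  refine measurable_to_countable' fun o => ?_
  have hsome : ∀ c : Cell m, MeasurableSet (cellOf (m := m) q L ⁻¹' {some c}) := by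
    rintro ⟨i, j⟩
    have : cellOf (m := m) q L ⁻¹' {some (i, j)} =
        {d | d.1 = i ∧ d.2 < q ^ (-(smoothing i))} ∩
        (({d | (j : ℕ∞) ≤ L} ∩ {d | d.2 < q ^ (-(smoothing i + (j : ℝ)))} ∩
        ({d | ((j + 1 : ℕ) : ℕ∞) ≤ L} ∩ {d | d.2 < q ^ (-(smoothing i + ((j + 1 : ℕ) : ℝ)))})ᶜ) ∪
        ({d | j = 0} ∩ ⋂ n : ℕ, ({d | (n : ℕ∞) ≤ L} ∩
          {d | d.2 < q ^ (-(smoothing i + (n : ℝ)))}))) := by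
      ext d
      rw [Set.mem_preimage, Set.mem_singleton_iff, cellOf_eq_some_iff hq]
      simp only [Set.mem_inter_iff, Set.mem_union, Set.mem_compl_iff, Set.mem_iInter,
        Set.mem_ofPred_eq, and_assoc]
    rw [this]
    have hlt : ∀ b : ℝ, MeasurableSet {d : Fin m × ℝ | d.2 < b} := fun b =>
      measurableSet_lt measurable_snd measurable_const
    exact (hc _ _).inter ((((MeasurableSet.const _).inter (hlt _)).inter
      ((MeasurableSet.const _).inter (hlt _)).compl).union
      ((MeasurableSet.const _).inter (MeasurableSet.iInter fun n =>
        (MeasurableSet.const _).inter (hlt _))))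
  rcases o with _ | c
  · have : cellOf (m := m) q L ⁻¹' {none} = (⋃ c, cellOf (m := m) q L ⁻¹' {some c})ᶜ := by
      ext d
      simp only [Set.mem_preimage, Set.mem_singleton_iff, Set.mem_compl_iff, Set.mem_iUnion]
      rw [← Option.ne_none_iff_exists'.not, not_not]
    rw [this]
    exact (MeasurableSet.iUnion hsome).compl
  · exact hsome c

instance isProbabilityMeasure_dartLaw {m : ℕ} [NeZero m] : IsProbabilityMeasure (dartLaw m) := by
  have h1 : IsProbabilityMeasure (uniformOn (Set.univ : Set (Fin m))) :=
    isProbabilityMeasure_uniformOn Set.finite_univ Set.univ_nonempty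
  have h2 : IsProbabilityMeasure (volume.restrict (Set.Icc (0 : ℝ) 1)) := ⟨by simp⟩
  unfold dartLaw
  infer_instance

theorem dartLaw_real_lt {m : ℕ} [NeZero m] (i : Fin m) {b : ℝ} (h0 : 0 ≤ b) (h1 : b ≤ 1) :
    (dartLaw m).real {d | d.1 = i ∧ d.2 < b} = b / m := by
  have : {d : Fin m × ℝ | d.1 = i ∧ d.2 < b} = {i} ×ˢ Set.Iio b := by
    ext d; simp
  have h2 : IsProbabilityMeasure (volume.restrict (Set.Icc (0 : ℝ) 1)) := ⟨by simp⟩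
  have h3 : Set.Iio b ∩ Set.Icc 0 1 = Set.Ico 0 b := by
    ext y
    simp only [Set.mem_inter_iff, Set.mem_Iio, Set.mem_Icc, Set.mem_Ico]
    constructor
    · rintro ⟨k1, k2, k3⟩; exact ⟨k2, k1⟩
    · rintro ⟨k1, k2⟩; exact ⟨k2, k1, k2.le.trans h1⟩
  rw [this, dartLaw, measureReal_def, Measure.prod_prod, uniformOn_univ,
    Measure.restrict_apply measurableSet_Iio, h3]
  simp only [Measure.count_singleton, Fintype.card_fin, Real.volume_Ico, sub_zero, one_div,
    ENNReal.toReal_mul, ENNReal.toReal_inv, ENNReal.toReal_natCast, ENNReal.toReal_ofReal h0]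
  rw [inv_mul_eq_div]

theorem rpow_smoothing_le_one {q : ℝ} (hq : 1 < q) {m : ℕ} (i : Fin m) (j : ℕ) :
    q ^ (-(smoothing i + (j : ℝ))) ≤ 1 := by
  apply Real.rpow_le_one_of_one_le_of_nonpos hq.le
  have := smoothing_nonneg i
  have : (0 : ℝ) ≤ j := Nat.cast_nonneg j
  linarith

/-- The area of the cells `j ≥ J` of column `i`. -/
def tailArea (q : ℝ) (L : ℕ) {m : ℕ} (i : Fin m) (J : ℕ) : ℝ :=
  if J ≤ L then q ^ (-(smoothing i + (J : ℝ))) / m else 0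

/-- The area of a cell. -/
def area (q : ℝ) (L : ℕ) {m : ℕ} (i : Fin m) (j : ℕ) : ℝ :=
  tailArea q L i j - tailArea q L i (j + 1)

/-- The cells of the dartboard with finitely many cells; `none` stands for the dummy cells. -/
abbrev Hit (m L : ℕ) : Type := Option (Fin m × Fin (L + 1))

/-- The cell described by an element of `Hit`. -/
def toCell {m L : ℕ} (o : Hit m L) : Option (Cell m) := o.map fun c => (c.1, (c.2 : ℕ))

/-- The cell hit by a dart, on a dartboard with finitely many cells. -/
def hitOf {m : ℕ} (q : ℝ) (L : ℕ) (d : Fin m × ℝ) : Hit m L :=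
  (cellOf q L d).map fun c => (c.1, Fin.ofNat (L + 1) c.2)

theorem cellOf_snd_le {q : ℝ} (hq : 1 < q) {m L : ℕ} {d : Fin m × ℝ} {c : Cell m}
    (hd : cellOf q L d = some c) : c.2 ≤ L := by
  obtain ⟨i, j⟩ := c
  rw [cellOf_eq_some_iff hq] at hd
  obtain ⟨-, -, ⟨⟨h, -⟩, -⟩ | ⟨-, h⟩⟩ := hd
  · exact_mod_cast h
  · have := (h (L + 1)).1
    have : L + 1 ≤ L := by exact_mod_cast this
    omega

theorem toCell_hitOf {q : ℝ} (hq : 1 < q) {m : ℕ} (L : ℕ) (d : Fin m × ℝ) :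
    toCell (hitOf q L d) = cellOf q L d := by
  unfold toCell hitOf
  rcases hd : cellOf q L d with _ | ⟨i, j⟩
  · rfl
  · have h1 := cellOf_snd_le hq hd
    simp only [Option.map_some, Option.some.injEq, Prod.mk.injEq, true_and, Fin.val_ofNat]
    exact Nat.mod_eq_of_lt (by simp at h1; omega)

theorem measurable_hitOf {q : ℝ} (hq : 1 < q) {m : ℕ} (L : ℕ) :
    Measurable (hitOf (m := m) q L) :=
  Measurable.of_discrete.comp (measurable_cellOf hq L)

/-- The law of the cell hit by a dart, on a dartboard with finitely many cells. -/
def hitLaw (q : ℝ) (m L : ℕ) : Measure (Hit m L) := (dartLaw m).map (hitOf q L)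

theorem hitLaw_real_singleton {q : ℝ} (hq : 1 < q) {m : ℕ} [NeZero m] (L : ℕ) (i : Fin m)
    (j : Fin (L + 1)) : (hitLaw q m L).real {some (i, j)} = area q L i j := by
  have h0 : ∀ J : ℕ, 0 ≤ q ^ (-(smoothing i + (J : ℝ))) := fun J =>
    (Real.rpow_pos_of_pos (by linarith) _).le
  have hT : ∀ J : ℕ, (dartLaw m).real {d | d.1 = i ∧ J ≤ L ∧ d.2 < q ^ (-(smoothing i + (J : ℝ)))} =
      tailArea q L i J := by
    intro J
    unfold tailArea
    split_ifs with hJ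
    · simp only [hJ, true_and]
      exact dartLaw_real_lt i (h0 J) (rpow_smoothing_le_one hq i J)
    · simp [hJ]
  have hM : ∀ J : ℕ,
      MeasurableSet {d : Fin m × ℝ | d.1 = i ∧ J ≤ L ∧ d.2 < q ^ (-(smoothing i + (J : ℝ)))} :=
    fun J => (measurableSet_eq_fun measurable_fst measurable_const).inter
      ((MeasurableSet.const _).inter (measurableSet_lt measurable_snd measurable_const))
  have hle : ∀ J : ℕ, q ^ (-(smoothing i + ((J + 1 : ℕ) : ℝ))) ≤ q ^ (-(smoothing i + (J : ℝ))) := by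
    intro J
    apply Real.rpow_le_rpow_of_exponent_le hq.le
    push_cast; linarith
  have hset : hitOf q L ⁻¹' {some (i, j)} =
      {d : Fin m × ℝ | d.1 = i ∧ (j : ℕ) ≤ L ∧ d.2 < q ^ (-(smoothing i + ((j : ℕ) : ℝ)))} \
      {d : Fin m × ℝ | d.1 = i ∧ (j : ℕ) + 1 ≤ L ∧
        d.2 < q ^ (-(smoothing i + (((j : ℕ) + 1 : ℕ) : ℝ)))} := by
    ext d
    have h1 : hitOf q L d = some (i, j) ↔ cellOf q L d = some (i, (j : ℕ)) := by
      rw [← toCell_hitOf hq]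
      unfold toCell
      rcases hitOf q L d with _ | ⟨i', j'⟩
      · simp
      · simp [Fin.ext_iff]
    rw [Set.mem_preimage, Set.mem_singleton_iff, h1, cellOf_eq_some_iff hq]
    have h2 : ¬ ∀ n : ℕ, (n : ℕ∞) ≤ (L : ℕ∞) ∧ d.2 < q ^ (-(smoothing i + (n : ℝ))) := by
      intro h
      have h3 : L + 1 ≤ L := by exact_mod_cast (h (L + 1)).1
      omega
    have h4 : d.2 < q ^ (-(smoothing i + ((j : ℕ) : ℝ))) → d.2 < q ^ (-(smoothing i)) := by
      intro h
      refine h.trans_le (Real.rpow_le_rpow_of_exponent_le hq.le ?_)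
      have : (0 : ℝ) ≤ ((j : ℕ) : ℝ) := Nat.cast_nonneg _
      linarith
    simp only [Nat.cast_le] at h2
    simp only [Set.mem_sdiff, Set.mem_ofPred_eq, Nat.cast_le]
    tauto
  unfold hitLaw area
  rw [map_measureReal_apply (measurable_hitOf hq L) (MeasurableSet.singleton _), hset,
    measureReal_sdiff _ (hM _), hT, hT]
  rintro d ⟨h1, h2, h3⟩
  exact ⟨h1, by omega, h3.trans_le (hle _)⟩

/-! ### Martingale estimators -/

section Estimator

variable {α : Type*} [MeasurableSpace α] [DiscreteMeasurableSpace α] [Countable α]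
  {ν : Measure α} [IsProbabilityMeasure ν] {U : ℕ}

/-- Resampling one coordinate preserves a product measure. This replaces conditional expectations: a
functional that ignores the coordinate `x` may be treated as fixed while the value at `x` is
integrated out. -/
theorem measurePreserving_update (ν : Measure α) [IsProbabilityMeasure ν] (x : Fin U) :
    MeasurePreserving (fun p : (Fin U → α) × α => Function.update p.1 x p.2)
      ((Measure.pi fun _ => ν).prod ν) (Measure.pi fun _ => ν) := by
  refine ⟨Measurable.of_discrete, (Measure.pi_eq fun s hs => ?_).symm⟩
  rw [Measure.map_apply Measurable.of_discrete (MeasurableSet.univ_pi hs)]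
  have : (fun p : (Fin U → α) × α => Function.update p.1 x p.2) ⁻¹' (Set.univ.pi s) =
      (Set.univ.pi (Function.update s x Set.univ)) ×ˢ s x := by
    ext ⟨ω, d⟩
    simp only [Set.mem_preimage, Set.mem_pi, Set.mem_univ, true_imp_iff, Set.mem_prod]
    constructor
    · intro h
      refine ⟨fun i => ?_, by simpa using h x⟩
      by_cases hi : i = x
      · subst hi; simp
      · simpa [hi] using h i
    · rintro ⟨h1, h2⟩ i
      by_cases hi : i = x
      · subst hi; simpa using h2
      · simpa [hi] using h1 i
  rw [this, Measure.prod_prod, Measure.pi_pi, ← Finset.mul_prod_erase _ _ (Finset.mem_univ x),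
    ← Finset.mul_prod_erase (a := x) _ _ (Finset.mem_univ x)]
  simp only [Function.update_self, measure_univ, one_mul]
  rw [mul_comm]
  congr 1
  refine Finset.prod_congr rfl fun i hi => ?_
  rw [Function.update_of_ne (Finset.ne_of_mem_erase hi)]

/-- Integrating out the value at a fresh index. -/
theorem integral_fresh {x : Fin U} {Φ : (Fin U → α) → α → ℝ}
    (hΦ : ∀ ω d, Φ (Function.update ω x d) = Φ ω)
    (hint : Integrable (fun p : (Fin U → α) × α => Φ p.1 p.2) ((Measure.pi fun _ => ν).prod ν)) :
    Integrable (fun ω => Φ ω (ω x)) (Measure.pi fun _ => ν) ∧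
    ∫ ω, Φ ω (ω x) ∂(Measure.pi fun _ => ν) = ∫ ω, ∫ d, Φ ω d ∂ν ∂(Measure.pi fun _ => ν) := by
  have hmp := measurePreserving_update ν x
  have hcomp : (fun ω => Φ ω (ω x)) ∘
      (fun p : (Fin U → α) × α => Function.update p.1 x p.2) = fun p => Φ p.1 p.2 := by
    funext p; simp [hΦ]
  constructor
  · rw [← hmp.integrable_comp (Measurable.of_discrete.aestronglyMeasurable), hcomp]
    exact hint
  · rw [← integral_prod _ hint, ← hcomp, ← hmp.map_eq,
      integral_map hmp.measurable.aemeasurable Measurable.of_discrete.aestronglyMeasurable,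
      hmp.map_eq]
    rfl

variable [DecidableEq α]

/-- The contribution of the element `x` to the estimate, if the elements of `T` preceded it. -/
def gain (Fr : Finset α → Set α) (ν : Measure α) (T : Finset (Fin U)) (x : Fin U)
    (ω : Fin U → α) : ℝ :=
  open Classical in if ω x ∈ Fr (T.image ω) then (ν.real (Fr (T.image ω)))⁻¹ else 0

/-- The martingale estimate; the stream is listed in reverse order. -/
def martEst (Fr : Finset α → Set α) (ν : Measure α) : List (Fin U) → (Fin U → α) → ℝ
  | [], _ => 0
  | x :: l, ω => martEst Fr ν l ω + gain Fr ν l.toFinset x ω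

/-- The indicator of the event that the state can still change. -/
def live (Fr : Finset α → Set α) (ν : Measure α) (T : Finset (Fin U)) (ω : Fin U → α) : ℝ :=
  if ν.real (Fr (T.image ω)) = 0 then 0 else 1

/-- The number of distinct elements that meet a state which can still change. -/
def compens (Fr : Finset α → Set α) (ν : Measure α) : List (Fin U) → (Fin U → α) → ℝ
  | [], _ => 0
  | x :: l, ω => compens Fr ν l ω + if x ∈ l then 0 else live Fr ν l.toFinset ω

theorem image_update_of_notMem {x : Fin U} {T : Finset (Fin U)} (hx : x ∉ T) (ω : Fin U → α)
    (d : α) : T.image (Function.update ω x d) = T.image ω :=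
  Finset.image_congr fun y hy => Function.update_of_ne (by rintro rfl; exact hx hy) _ _

variable {Fr : Finset α → Set α}

theorem live_update {x : Fin U} {T : Finset (Fin U)} (hx : x ∉ T) (ω : Fin U → α) (d : α) :
    live Fr ν T (Function.update ω x d) = live Fr ν T ω := by
  unfold live; rw [image_update_of_notMem hx]

theorem live_nonneg (T : Finset (Fin U)) (ω : Fin U → α) : 0 ≤ live Fr ν T ω := by
  unfold live; split_ifs <;> norm_num

theorem live_le_one (T : Finset (Fin U)) (ω : Fin U → α) : live Fr ν T ω ≤ 1 := by
  unfold live; split_ifs <;> norm_num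

theorem integrable_live (T : Finset (Fin U)) :
    Integrable (live Fr ν T) (Measure.pi fun _ => ν) :=
  Integrable.of_bound Measurable.of_discrete.aestronglyMeasurable 1
    (Filter.Eventually.of_forall fun ω => by
      rw [Real.norm_of_nonneg (live_nonneg T ω)]; exact live_le_one T ω)

theorem gain_eq_zero_of_mem (hFr : ∀ O, ∀ o ∈ O, o ∉ Fr O) {x : Fin U} {T : Finset (Fin U)}
    (hx : x ∈ T) (ω : Fin U → α) : gain Fr ν T x ω = 0 :=
  if_neg (hFr _ _ (Finset.mem_image_of_mem ω hx))

/-- Weighting by the inverse probability has mean one; since the inverse of `0` is `0`, the mean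
drops to zero for a null set. This is how saturation enters the estimate. -/
theorem integral_ite_inv (A : Set α) [DecidablePred (· ∈ A)] :
    ∫ d, (if d ∈ A then (ν.real A)⁻¹ else 0) ∂ν = if ν.real A = 0 then 0 else 1 := by
  have : (fun d => if d ∈ A then (ν.real A)⁻¹ else 0) = A.indicator fun _ => (ν.real A)⁻¹ := by
    funext d; simp [Set.indicator_apply]
  rw [this, integral_indicator_const _ (MeasurableSet.of_discrete), smul_eq_mul]
  split_ifs with h
  · rw [h, zero_mul]
  · exact mul_inv_cancel₀ h

/-- The set of free hits depends on the coordinates in `T` only, so `integral_fresh` applies.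
Although the inverse probabilities need not be bounded when `α` is infinite, the inner integrals are
at most one, which gives integrability. -/
theorem gain_fresh {x : Fin U} {T : Finset (Fin U)} (hx : x ∉ T) :
    Integrable (gain Fr ν T x) (Measure.pi fun _ => ν) ∧
    ∫ ω, gain Fr ν T x ω ∂(Measure.pi fun _ => ν) =
      ∫ ω, live Fr ν T ω ∂(Measure.pi fun _ => ν) := by
  classical
  let Φ : (Fin U → α) → α → ℝ := fun ω d =>
    if d ∈ Fr (T.image ω) then (ν.real (Fr (T.image ω)))⁻¹ else 0
  have h1 : ∀ ω d, Φ (Function.update ω x d) = Φ ω := by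
    intro ω d; simp only [Φ, image_update_of_notMem hx]
  have h0 : ∀ ω d, 0 ≤ Φ ω d := by
    intro ω d; simp only [Φ]; split_ifs
    · positivity
    · exact le_rfl
  have h2 : ∀ ω, ∫ d, Φ ω d ∂ν = live Fr ν T ω := fun ω => integral_ite_inv _
  have hint : Integrable (fun p : (Fin U → α) × α => Φ p.1 p.2)
      ((Measure.pi fun _ => ν).prod ν) := by
    rw [integrable_prod_iff Measurable.of_discrete.aestronglyMeasurable]
    constructor
    · refine Filter.Eventually.of_forall fun ω => ?_
      refine Integrable.of_bound Measurable.of_discrete.aestronglyMeasurable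
        (ν.real (Fr (T.image ω)))⁻¹ (Filter.Eventually.of_forall fun d => ?_)
      rw [Real.norm_of_nonneg (h0 ω d)]
      simp only [Φ]; split_ifs
      · exact le_rfl
      · positivity
    · have : (fun ω => ∫ d, ‖Φ ω d‖ ∂ν) = live Fr ν T := by
        funext ω
        rw [← h2 ω]
        exact integral_congr_ae (Filter.Eventually.of_forall fun d => Real.norm_of_nonneg (h0 ω d))
      exact this ▸ integrable_live T
  obtain ⟨h3, h4⟩ := integral_fresh h1 hint
  refine ⟨?_, ?_⟩
  · convert h3 using 1
    funext ω; unfold gain; rfl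
  · simp only [h2] at h4
    rw [← h4]
    rfl

theorem integrable_compens (l : List (Fin U)) :
    Integrable (compens Fr ν l) (Measure.pi fun _ => ν) := by
  induction l with
  | nil => exact integrable_const (0 : ℝ)
  | cons x l ih =>
    by_cases hx : x ∈ l
    · simpa [compens, hx] using ih
    · have : compens Fr ν (x :: l) = compens Fr ν l + live Fr ν l.toFinset := by
        funext ω; simp [compens, hx]
      rw [this]; exact ih.add (integrable_live _)

/-- The expected estimate. -/
theorem martEst_mean (hFr : ∀ O, ∀ o ∈ O, o ∉ Fr O) (l : List (Fin U)) :
    Integrable (martEst Fr ν l) (Measure.pi fun _ => ν) ∧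
    ∫ ω, martEst Fr ν l ω ∂(Measure.pi fun _ => ν) =
      ∫ ω, compens Fr ν l ω ∂(Measure.pi fun _ => ν) := by
  induction l with
  | nil => exact ⟨integrable_const (0 : ℝ), rfl⟩
  | cons x l ih =>
    by_cases hx : x ∈ l
    · have h1 : martEst Fr ν (x :: l) = martEst Fr ν l := by
        funext ω
        simp only [martEst]
        rw [gain_eq_zero_of_mem hFr (List.mem_toFinset.2 hx), add_zero]
      have h2 : compens Fr ν (x :: l) = compens Fr ν l := by
        funext ω; simp [compens, hx]
      rw [h1, h2]; exact ih
    · have h1 : compens Fr ν (x :: l) = fun ω => compens Fr ν l ω + live Fr ν l.toFinset ω := by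
        funext ω; simp [compens, hx]
      obtain ⟨h3, h4⟩ := gain_fresh (Fr := Fr) (ν := ν) (x := x) (T := l.toFinset) (by simpa using hx)
      refine ⟨ih.1.add h3, ?_⟩
      rw [h1, integral_add (integrable_compens l) (integrable_live _), ← ih.2, ← h4,
        ← integral_add ih.1 h3]
      rfl

end Estimator

/-! ### The second moment of the compensated estimate -/

section SecondMoment

variable {α : Type*} [MeasurableSpace α] [DiscreteMeasurableSpace α] [Finite α] [DecidableEq α]
  {ν : Measure α} [IsProbabilityMeasure ν] {U : ℕ} {Fr : Finset α → Set α}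

theorem martEst_update {x : Fin U} {l : List (Fin U)} (hx : x ∉ l) (ω : Fin U → α) (d : α) :
    martEst Fr ν l (Function.update ω x d) = martEst Fr ν l ω := by
  induction l with
  | nil => rfl
  | cons y l ih =>
    simp only [List.mem_cons, not_or] at hx
    simp only [martEst]
    rw [ih hx.2]
    unfold gain
    rw [image_update_of_notMem (by simpa using hx.2), Function.update_of_ne (Ne.symm hx.1)]

theorem compens_update {x : Fin U} {l : List (Fin U)} (hx : x ∉ l) (ω : Fin U → α) (d : α) :
    compens Fr ν l (Function.update ω x d) = compens Fr ν l ω := by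
  induction l with
  | nil => rfl
  | cons y l ih =>
    simp only [List.mem_cons, not_or] at hx
    simp only [compens]
    rw [ih hx.2, live_update (by simpa using hx.2)]

/-- The sum over the distinct elements of the expected quadratic increments. -/
def bracket (Fr : Finset α → Set α) (ν : Measure α) : List (Fin U) → ℝ
  | [] => 0
  | x :: l => bracket Fr ν l + if x ∈ l then 0 else
      ∫ ω, ((ν.real (Fr (l.toFinset.image ω)))⁻¹ - live Fr ν l.toFinset ω)
        ∂(Measure.pi fun _ => ν)

/-- Orthogonality of martingale increments. Given the past, the increment `g - live` of a fresh
element has mean zero, so the cross term disappears, and second moment `1 / P - live`, because `g ^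
2 = g / P` and `live ^ 2 = live`. A repeated element contributes nothing. -/
theorem integral_sq_martEst_sub_compens (hFr : ∀ O, ∀ o ∈ O, o ∉ Fr O) (l : List (Fin U)) :
    ∫ ω, (martEst Fr ν l ω - compens Fr ν l ω) ^ 2 ∂(Measure.pi fun _ => ν) =
      bracket Fr ν l := by
  classical
  induction l with
  | nil => simp [martEst, compens, bracket]
  | cons x l ih =>
    by_cases hx : x ∈ l
    · have h1 : ∀ ω, martEst Fr ν (x :: l) ω = martEst Fr ν l ω := by
        intro ω
        simp only [martEst]
        rw [gain_eq_zero_of_mem hFr (List.mem_toFinset.2 hx), add_zero]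
      have h2 : ∀ ω, compens Fr ν (x :: l) ω = compens Fr ν l ω := by
        intro ω; simp [compens, hx]
      simp only [h1, h2, bracket, hx, if_true, add_zero]
      exact ih
    · have hx' : x ∉ l.toFinset := by simpa using hx
      set T := l.toFinset with hT
      let g : (Fin U → α) → α → ℝ := fun ω d =>
        if d ∈ Fr (T.image ω) then (ν.real (Fr (T.image ω)))⁻¹ else 0
      let M : (Fin U → α) → ℝ := fun ω => martEst Fr ν l ω - compens Fr ν l ω
      let Φ : (Fin U → α) → α → ℝ := fun ω d =>
        2 * M ω * (g ω d - live Fr ν T ω) + (g ω d - live Fr ν T ω) ^ 2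
      have hΦ : ∀ ω d, Φ (Function.update ω x d) = Φ ω := by
        intro ω d
        simp only [Φ, M, g, martEst_update hx, compens_update hx, live_update hx',
          image_update_of_notMem hx']
      have hg : ∀ ω, ∫ d, g ω d ∂ν = live Fr ν T ω := fun ω => integral_ite_inv _
      have hg2 : ∀ ω, ∫ d, (g ω d) ^ 2 ∂ν = (ν.real (Fr (T.image ω)))⁻¹ := by
        intro ω
        have : ∀ d, (g ω d) ^ 2 = (ν.real (Fr (T.image ω)))⁻¹ * g ω d := by
          intro d; simp only [g]; split_ifs <;> ring
        simp only [this]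
        rw [integral_const_mul, hg]
        unfold live
        split_ifs with h0
        · rw [h0]; simp
        · simp
      have hlive : ∀ ω, live Fr ν T ω ^ 2 = live Fr ν T ω := by
        intro ω; unfold live; split_ifs <;> norm_num
      have hin : ∀ ω, ∫ d, Φ ω d ∂ν = (ν.real (Fr (T.image ω)))⁻¹ - live Fr ν T ω := by
        intro ω
        have e : ∀ d, Φ ω d = (2 * M ω - 2 * live Fr ν T ω) * g ω d + (g ω d) ^ 2 +
            (live Fr ν T ω ^ 2 - 2 * M ω * live Fr ν T ω) := by
          intro d; simp only [Φ]; ring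
        simp only [e]
        rw [integral_add (Integrable.of_finite) (Integrable.of_finite),
          integral_add (Integrable.of_finite) (Integrable.of_finite), integral_const_mul, hg, hg2,
          integral_const, hlive]
        simp only [probReal_univ, one_smul]
        have := hlive ω
        linear_combination (-2) * this
      have key := (integral_fresh (ν := ν) hΦ Integrable.of_finite).2
      simp only [hin] at key
      have e : ∀ ω, (martEst Fr ν (x :: l) ω - compens Fr ν (x :: l) ω) ^ 2 =
          (M ω) ^ 2 + Φ ω (ω x) := by
        intro ω
        have e1 : gain Fr ν T x ω = g ω (ω x) := rfl
        simp only [martEst, compens, hx, if_false, Φ, M, ← hT, e1]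
        ring
      simp only [e]
      rw [integral_add Integrable.of_finite Integrable.of_finite, key]
      simp only [bracket, hx, if_false, ← hT]
      rw [← ih]

/-- Termwise bounds for the quadratic increments. -/
theorem bracket_le {hi : ℕ → ℝ} {l : List (Fin U)}
    (h : ∀ T : Finset (Fin U), T.card < l.toFinset.card →
      ∫ ω, ((ν.real (Fr (T.image ω)))⁻¹ - live Fr ν T ω) ∂(Measure.pi fun _ => ν) ≤ hi T.card) :
    bracket Fr ν l ≤ ∑ k ∈ Finset.range l.toFinset.card, hi k := by
  induction l with
  | nil => simp [bracket]
  | cons x l ih =>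
    by_cases hx : x ∈ l
    · have e : (x :: l).toFinset = l.toFinset := by simp [hx]
      rw [e] at h ⊢
      simpa [bracket, hx] using ih h
    · have e : (x :: l).toFinset.card = l.toFinset.card + 1 := by simp [hx]
      rw [e] at h ⊢
      rw [Finset.sum_range_succ]
      simp only [bracket, hx, if_false]
      exact add_le_add (ih fun T hT => h T (by omega)) (h _ (by omega))

theorem le_bracket {lo : ℕ → ℝ} {l : List (Fin U)}
    (h : ∀ T : Finset (Fin U), T.card < l.toFinset.card →
      lo T.card ≤ ∫ ω, ((ν.real (Fr (T.image ω)))⁻¹ - live Fr ν T ω) ∂(Measure.pi fun _ => ν)) :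
    ∑ k ∈ Finset.range l.toFinset.card, lo k ≤ bracket Fr ν l := by
  induction l with
  | nil => simp [bracket]
  | cons x l ih =>
    by_cases hx : x ∈ l
    · have e : (x :: l).toFinset = l.toFinset := by simp [hx]
      rw [e] at h ⊢
      simpa [bracket, hx] using ih h
    · have e : (x :: l).toFinset.card = l.toFinset.card + 1 := by simp [hx]
      rw [e] at h ⊢
      rw [Finset.sum_range_succ]
      simp only [bracket, hx, if_false]
      exact add_le_add (ih fun T hT => h T (by omega)) (h _ (by omega))

end SecondMoment

/-! ### The sketch as a martingale estimator -/

section Transfer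

variable {α : Type*} [DecidableEq α] {m : ℕ}

/-- The set of cells among a set of hits. -/
def hitCells (emb : α → Option (Cell m)) (O : Finset α) : Finset (Cell m) :=
  Finset.eraseNone (O.image emb)

/-- The hits that change the state, once the hits in `O` have been processed. -/
def freeHits (a h : ℕ) (emb : α → Option (Cell m)) (O : Finset α) : Set α :=
  {o | ∃ c, emb o = some c ∧ ¬ Occupied a (sketch a h (hitCells emb O)) c}

theorem mem_hitCells {emb : α → Option (Cell m)} {O : Finset α} {c : Cell m} :
    c ∈ hitCells emb O ↔ ∃ o ∈ O, emb o = some c := by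
  simp [hitCells]

theorem notMem_freeHits (a h : ℕ) (emb : α → Option (Cell m)) (O : Finset α) (o : α)
    (ho : o ∈ O) : o ∉ freeHits a h emb O := by
  rintro ⟨c, hc, hocc⟩
  exact hocc (occupied_of_mem a h (mem_hitCells.2 ⟨o, ho, hc⟩))

/-- The sketch sees a dart only through a discrete reading `κ`, from which `emb` recovers the cell.
Taking `cellOf` with `id` covers the infinite dartboard, and `hitOf` with `toCell` the finite one.
-/
theorem stateAfter_eq {q : ℝ} {L : ℕ∞} {emb : α → Option (Cell m)} {κ : Fin m × ℝ → α}
    (hκ : ∀ d, emb (κ d) = cellOf q L d) (a h : ℕ) {U : ℕ} (hash : Fin U → Fin m × ℝ)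
    (l : List (Fin U)) : stateAfter q L a h hash l =
      sketch a h (hitCells emb (l.toFinset.image fun x => κ (hash x))) := by
  unfold stateAfter
  congr 1
  ext c
  simp only [List.mem_toFinset, List.mem_filterMap, mem_hitCells, Finset.mem_image]
  constructor
  · rintro ⟨x, hx, he⟩
    exact ⟨_, ⟨x, hx, rfl⟩, by rw [hκ]; exact he⟩
  · rintro ⟨o, ⟨x, hx, rfl⟩, he⟩
    exact ⟨x, hx, by rw [← hκ]; exact he⟩

variable [MeasurableSpace α] [DiscreteMeasurableSpace α]

theorem changeProb_eq {q : ℝ} {L : ℕ∞} {emb : α → Option (Cell m)} {κ : Fin m × ℝ → α}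
    (hκ : ∀ d, emb (κ d) = cellOf q L d) (hm : Measurable κ) (a h : ℕ) (O : Finset α) :
    changeProb q L a (sketch a h (hitCells emb O)) =
      ((dartLaw m).map κ).real (freeHits a h emb O) := by
  rw [map_measureReal_apply hm MeasurableSet.of_discrete]
  unfold changeProb freeHits
  simp only [Set.preimage_ofPred_eq, hκ]

/-- The reversal puts the latest element at the head, where the recursion of `martEst` expects it.
By `sketch_insert_ne_iff`, a change of state is the same as a hit in a free cell. -/
theorem estimate_eq {q : ℝ} {L : ℕ∞} {emb : α → Option (Cell m)} {κ : Fin m × ℝ → α}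
    (hκ : ∀ d, emb (κ d) = cellOf q L d) (hm : Measurable κ) {a : ℕ} (ha : 1 ≤ a) (h : ℕ) {U : ℕ}
    (hash : Fin U → Fin m × ℝ) (l : List (Fin U)) : estimate q L a h l hash =
      martEst (freeHits a h emb) ((dartLaw m).map κ) l.reverse (fun x => κ (hash x)) := by
  classical
  induction l using List.reverseRecOn with
  | nil => simp [estimate, martEst]
  | append_singleton l x ih =>
    rw [List.reverse_append, List.reverse_singleton, List.singleton_append]
    simp only [martEst]
    rw [← ih]
    unfold estimate
    rw [List.length_append, List.length_singleton, Finset.sum_range_succ]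
    congr 1
    · refine Finset.sum_congr rfl fun k hk => ?_
      rw [Finset.mem_range] at hk
      rw [List.take_append_of_le_length (by omega), List.take_append_of_le_length (by omega)]
    · rw [List.take_append_of_le_length le_rfl, List.take_length,
        List.take_of_length_le (by simp)]
      have hS := stateAfter_eq hκ a h hash l
      rw [hS, changeProb_eq hκ hm]
      unfold gain
      rw [List.toFinset_reverse]
      have key : stateAfter q L a h hash (l ++ [x]) ≠
          sketch a h (hitCells emb (l.toFinset.image fun x => κ (hash x))) ↔
          κ (hash x) ∈ freeHits a h emb (l.toFinset.image fun x => κ (hash x)) := by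
        rw [← hS]
        unfold freeHits
        rw [← hS]
        simp only [Set.mem_ofPred_eq, hκ]
        unfold stateAfter
        rw [List.filterMap_append]
        rcases hd : cellOf q L (hash x) with _ | c
        · simp [hd]
        · have : (l.filterMap (fun x => cellOf q L (hash x)) ++
              [x].filterMap (fun x => cellOf q L (hash x))).toFinset =
              insert c (l.filterMap (fun x => cellOf q L (hash x))).toFinset := by
            simp [hd, Finset.union_comm]
          rw [this, sketch_insert_ne_iff ha]
          simp
      simp only [key]

theorem map_oracle [NeZero m] {κ : Fin m × ℝ → α} (hm : Measurable κ) (U : ℕ) :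
    (oracle m U).map (fun hash x => κ (hash x)) = Measure.pi fun _ => (dartLaw m).map κ := by
  have : IsProbabilityMeasure ((dartLaw m).map κ) :=
    Measure.isProbabilityMeasure_map hm.aemeasurable
  exact Measure.pi_map_pi fun _ => hm.aemeasurable

variable [Countable α]

theorem integral_oracle [NeZero m] {κ : Fin m × ℝ → α} (hm : Measurable κ) {U : ℕ}
    (F : (Fin U → α) → ℝ) : ∫ hash, F (fun x => κ (hash x)) ∂(oracle m U) =
      ∫ ω, F ω ∂(Measure.pi fun _ => (dartLaw m).map κ) := by
  rw [← map_oracle hm, integral_map _ Measurable.of_discrete.aestronglyMeasurable]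
  exact (measurable_pi_lambda _ fun x => hm.comp (measurable_pi_apply x)).aemeasurable

theorem integrable_oracle [NeZero m] {κ : Fin m × ℝ → α} (hm : Measurable κ) {U : ℕ}
    {F : (Fin U → α) → ℝ} (hF : Integrable F (Measure.pi fun _ => (dartLaw m).map κ)) :
    Integrable (fun hash => F (fun x => κ (hash x))) (oracle m U) := by
  rw [← map_oracle hm] at hF
  exact hF.comp_measurable (measurable_pi_lambda _ fun x => hm.comp (measurable_pi_apply x))

theorem memLp_oracle [NeZero m] {κ : Fin m × ℝ → α} (hm : Measurable κ) {U : ℕ}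
    {F : (Fin U → α) → ℝ} (hF : MemLp F 2 (Measure.pi fun _ => (dartLaw m).map κ)) :
    MemLp (fun hash => F (fun x => κ (hash x))) 2 (oracle m U) := by
  rw [← map_oracle hm] at hF
  exact hF.comp_of_map
    (measurable_pi_lambda _ fun x => hm.comp (measurable_pi_apply x)).aemeasurable

theorem estimate_mean [NeZero m] {q : ℝ} {L : ℕ∞} {emb : α → Option (Cell m)}
    {κ : Fin m × ℝ → α} (hκ : ∀ d, emb (κ d) = cellOf q L d) (hm : Measurable κ) {a : ℕ}
    (ha : 1 ≤ a) (h : ℕ) {U : ℕ} (l : List (Fin U)) :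
    Integrable (estimate q L a h l) (oracle m U) ∧
    ∫ hash, estimate q L a h l hash ∂(oracle m U) =
      ∫ ω, compens (freeHits a h emb) ((dartLaw m).map κ) l.reverse ω
        ∂(Measure.pi fun _ => (dartLaw m).map κ) := by
  have : IsProbabilityMeasure ((dartLaw m).map κ) :=
    Measure.isProbabilityMeasure_map hm.aemeasurable
  have h1 : estimate q L a h l = fun hash =>
      martEst (freeHits a h emb) ((dartLaw m).map κ) l.reverse (fun x => κ (hash x)) := by
    funext hash; exact estimate_eq hκ hm ha h hash l
  obtain ⟨h2, h3⟩ := martEst_mean (ν := (dartLaw m).map κ) (notMem_freeHits a h emb) l.reverse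
  rw [h1]
  exact ⟨integrable_oracle hm h2, (integral_oracle hm _).trans h3⟩

theorem integral_live [NeZero m] {q : ℝ} {L : ℕ∞} {emb : α → Option (Cell m)}
    {κ : Fin m × ℝ → α} (hκ : ∀ d, emb (κ d) = cellOf q L d) (hm : Measurable κ) (a h : ℕ)
    {U : ℕ} (l : List (Fin U)) :
    ∫ ω, live (freeHits a h emb) ((dartLaw m).map κ) l.toFinset ω
        ∂(Measure.pi fun _ => (dartLaw m).map κ) =
      (oracle m U).real
        {hash | changeProb q L a (stateAfter q L a h hash l : State m h) ≠ 0} := by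
  classical
  have : IsProbabilityMeasure ((dartLaw m).map κ) :=
    Measure.isProbabilityMeasure_map hm.aemeasurable
  have hmeas : Measurable fun (hash : Fin U → Fin m × ℝ) x => κ (hash x) :=
    measurable_pi_lambda _ fun x => hm.comp (measurable_pi_apply x)
  set ν := (dartLaw m).map κ
  have h1 : live (freeHits a h emb) ν l.toFinset =
      {ω : Fin U → α | ν.real (freeHits a h emb (l.toFinset.image ω)) ≠ 0}.indicator
        (fun _ => (1 : ℝ)) := by
    funext ω
    by_cases h0 : ν.real (freeHits a h emb (l.toFinset.image ω)) = 0 <;>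
      simp [live, h0]
  rw [h1, integral_indicator_const _ MeasurableSet.of_discrete, smul_eq_mul, mul_one,
    ← map_oracle hm, map_measureReal_apply hmeas MeasurableSet.of_discrete]
  congr 1
  ext hash
  simp only [Set.mem_preimage, Set.mem_ofPred_eq]
  rw [stateAfter_eq hκ, changeProb_eq hκ hm]

theorem sum_fin_length_append {β : Type*} (g : List β → β → ℝ) (l : List β) (x : β) :
    ∑ k : Fin (l ++ [x]).length, g ((l ++ [x]).take k) ((l ++ [x]).get k) =
      ∑ k : Fin l.length, g (l.take k) (l.get k) + g l x := by
  have e : (l ++ [x]).length = l.length + 1 := by simp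
  rw [← Equiv.sum_comp (finCongr e.symm), Fin.sum_univ_castSucc]
  congr 1
  · refine Finset.sum_congr rfl fun k _ => ?_
    simp [List.take_append_of_le_length k.isLt.le]
  · simp

theorem integral_compens [NeZero m] {q : ℝ} {L : ℕ∞} {emb : α → Option (Cell m)}
    {κ : Fin m × ℝ → α} (hκ : ∀ d, emb (κ d) = cellOf q L d) (hm : Measurable κ) (a h : ℕ)
    {U : ℕ} (l : List (Fin U)) :
    ∫ ω, compens (freeHits a h emb) ((dartLaw m).map κ) l.reverse ω
        ∂(Measure.pi fun _ => (dartLaw m).map κ) =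
      ∑ k : Fin l.length, if l.get k ∈ l.take k then 0 else
          (oracle m U).real
            {hash | changeProb q L a (stateAfter q L a h hash (l.take k) : State m h) ≠ 0} := by
  have : IsProbabilityMeasure ((dartLaw m).map κ) :=
    Measure.isProbabilityMeasure_map hm.aemeasurable
  induction l using List.reverseRecOn with
  | nil => simp [compens]
  | append_singleton l x ih =>
    rw [sum_fin_length_append (fun l' y => if y ∈ l' then 0 else (oracle m U).real
      {hash | changeProb q L a (stateAfter q L a h hash l' : State m h) ≠ 0}), ← ih,
      List.reverse_append, List.reverse_singleton, List.singleton_append]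
    by_cases hx : x ∈ l
    · simp [compens, hx]
    · simp only [compens, List.mem_reverse, hx, if_false]
      rw [integral_add (integrable_compens _) (integrable_live _), List.toFinset_reverse,
        integral_live hκ hm]

end Transfer

/-- On the dartboard with infinitely many cells the state can always change. -/
theorem freeHits_pos {q : ℝ} (hq : 1 < q) {m : ℕ} [NeZero m] (a h : ℕ)
    (O : Finset (Option (Cell m))) :
    ((dartLaw m).map (cellOf q ⊤)).real (freeHits a h id O) ≠ 0 := by
  have hmeas := measurable_cellOf (m := m) hq ⊤
  have : IsProbabilityMeasure ((dartLaw m).map (cellOf q ⊤)) :=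
    Measure.isProbabilityMeasure_map hmeas.aemeasurable
  set S := sketch a h (hitCells id O) with hS
  -- A cell of column `0` above the curtain is free, and on the infinite board it has positive area.
  obtain ⟨j, hj⟩ := exists_nat_gt (S.curt 0)
  have hsub : {some ((0 : Fin m), j)} ⊆ freeHits a h id O := by
    rintro o rfl
    refine ⟨(0, j), rfl, fun hocc => ?_⟩
    have h1 : height ((0 : Fin m), j) ≤ S.curt 0 := hocc.1
    have h2 := shift_nonneg (0 : Fin m)
    have h3 : height ((0 : Fin m), j) = (j : ℚ) + shift 0 := rfl
    linarith
  have h0 : ∀ J : ℕ, 0 < q ^ (-(smoothing (0 : Fin m) + (J : ℝ))) := fun J =>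
    Real.rpow_pos_of_pos (by linarith) _
  have hlt : q ^ (-(smoothing (0 : Fin m) + ((j + 1 : ℕ) : ℝ))) <
      q ^ (-(smoothing (0 : Fin m) + (j : ℝ))) := by
    apply Real.rpow_lt_rpow_of_exponent_lt hq
    push_cast; linarith
  have hsub2 : {d : Fin m × ℝ | d.1 = 0 ∧ d.2 < q ^ (-(smoothing (0 : Fin m) + (j : ℝ)))} \
      {d : Fin m × ℝ | d.1 = 0 ∧ d.2 < q ^ (-(smoothing (0 : Fin m) + ((j + 1 : ℕ) : ℝ)))} ⊆
      cellOf q ⊤ ⁻¹' freeHits a h id O := by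
    rintro d ⟨⟨h1, h2⟩, h3⟩
    apply hsub
    rw [Set.mem_singleton_iff, cellOf_eq_some_iff hq]
    refine ⟨h1, h2.trans_le (Real.rpow_le_rpow_of_exponent_le hq.le ?_), Or.inl
      ⟨⟨le_top, h2⟩, fun h4 => h3 ⟨h1, h4.2⟩⟩⟩
    have : (0 : ℝ) ≤ (j : ℝ) := Nat.cast_nonneg _
    linarith
  have hmono := measureReal_mono (μ := dartLaw m) hsub2
  rw [measureReal_sdiff, dartLaw_real_lt _ (h0 _).le (rpow_smoothing_le_one hq _ _),
    dartLaw_real_lt _ (h0 _).le (rpow_smoothing_le_one hq _ _)] at hmono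
  · rw [map_measureReal_apply hmeas MeasurableSet.of_discrete]
    have hmpos : (0 : ℝ) < m := by exact_mod_cast NeZero.pos m
    have := div_lt_div_of_pos_right hlt hmpos
    exact ne_of_gt (by linarith)
  · rintro d ⟨h1, h2⟩
    exact ⟨h1, h2.trans hlt⟩
  · exact (measurableSet_eq_fun measurable_fst measurable_const).inter
      (measurableSet_lt measurable_snd measurable_const)

theorem compens_eq_card {α : Type*} [MeasurableSpace α] [DecidableEq α] {ν : Measure α} {U : ℕ}
    {Fr : Finset α → Set α} (hFr : ∀ O, ν.real (Fr O) ≠ 0) (l : List (Fin U)) (ω : Fin U → α) :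
    compens Fr ν l ω = (l.toFinset.card : ℝ) := by
  induction l with
  | nil => simp [compens]
  | cons x l ih =>
    by_cases hx : x ∈ l <;> simp [compens, hx, ih, live, hFr]

theorem estimate_unbiased {q : ℝ} (hq : 1 < q) {a : ℕ} (ha : 1 ≤ a) (h : ℕ) (m U : ℕ)
    (l : List (Fin U)) (hm : 0 < m) :
    Integrable (estimate q ⊤ a h l) (oracle m U) ∧
      ∫ hash, estimate q ⊤ a h l hash ∂(oracle m U) = (cardinality l : ℝ) := by
  have : NeZero m := ⟨hm.ne'⟩
  have hmeas := measurable_cellOf (m := m) hq ⊤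
  have : IsProbabilityMeasure ((dartLaw m).map (cellOf q ⊤)) :=
    Measure.isProbabilityMeasure_map hmeas.aemeasurable
  obtain ⟨h1, h2⟩ := estimate_mean (q := q) (L := ⊤) (emb := id)
    (κ := cellOf q ⊤) (fun _ => rfl) hmeas ha h l
  have e := compens_eq_card (Fr := freeHits a h (id : Option (Cell m) → Option (Cell m)))
    (freeHits_pos hq a h) l.reverse
  refine ⟨h1, h2.trans ((integral_congr_ae (Filter.Eventually.of_forall e)).trans ?_)⟩
  simp [cardinality]

theorem estimate_mean_finite {q : ℝ} (hq : 1 < q) {a : ℕ} (ha : 1 ≤ a) (h : ℕ) (L m U : ℕ)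
    (l : List (Fin U)) (hm : 0 < m) :
    Integrable (estimate q L a h l) (oracle m U) ∧
      ∫ hash, estimate q L a h l hash ∂(oracle m U) =
        ∑ k : Fin l.length, if l.get k ∈ l.take k then 0 else
          (oracle m U).real
            {hash | changeProb q L a (stateAfter q L a h hash (l.take k) : State m h) ≠ 0} := by
  have : NeZero m := ⟨hm.ne'⟩
  have hmeas := measurable_hitOf (m := m) hq L
  obtain ⟨h1, h2⟩ := estimate_mean (toCell_hitOf hq L) hmeas ha h l
  exact ⟨h1, h2.trans (integral_compens (toCell_hitOf hq L) hmeas a h l)⟩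

/-! ### The dartboard with finitely many cells -/

section Finite

variable {q : ℝ} {m L : ℕ}

theorem rpow_neg_smoothing_add (hq : 1 < q) (i : Fin m) (j : ℕ) :
    q ^ (-(smoothing i + (j : ℝ))) = q ^ (-(smoothing i)) * (q ^ j)⁻¹ := by
  rw [neg_add, Real.rpow_add (by linarith), Real.rpow_neg (by linarith) (j : ℝ), Real.rpow_natCast]

theorem rpow_neg_smoothing_le (hq : 1 < q) (i : Fin m) : q ^ (-(smoothing i)) ≤ 1 :=
  Real.rpow_le_one_of_one_le_of_nonpos hq.le (by have := smoothing_nonneg i; linarith)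

theorem inv_le_rpow_neg_smoothing (hq : 1 < q) (i : Fin m) : q⁻¹ ≤ q ^ (-(smoothing i)) := by
  rw [← Real.rpow_neg_one]
  exact Real.rpow_le_rpow_of_exponent_le hq.le (by have := smoothing_le_one i; linarith)

theorem tailArea_le (hq : 1 < q) (i : Fin m) (J : ℕ) :
    tailArea q L i J ≤ q ^ (-(smoothing i + (J : ℝ))) / m := by
  have : 0 < q ^ (-(smoothing i + (J : ℝ))) := Real.rpow_pos_of_pos (by linarith) _
  unfold tailArea
  split_ifs
  · exact le_rfl
  · positivity

theorem tailArea_nonneg (hq : 1 < q) (i : Fin m) (J : ℕ) : 0 ≤ tailArea q L i J := by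
  have : 0 < q ^ (-(smoothing i + (J : ℝ))) := Real.rpow_pos_of_pos (by linarith) _
  unfold tailArea
  split_ifs <;> positivity

theorem area_eq_of_lt (hq : 1 < q) (i : Fin m) {j : ℕ} (hj : j < L) :
    area q L i j = (1 - q⁻¹) * q ^ (-(smoothing i + (j : ℝ))) / m := by
  unfold area tailArea
  rw [if_pos hj.le, if_pos (by omega), rpow_neg_smoothing_add hq, rpow_neg_smoothing_add hq,
    pow_succ, mul_inv]
  ring

theorem area_last (i : Fin m) : area q L i L = q ^ (-(smoothing i + (L : ℝ))) / m := by
  unfold area tailArea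
  rw [if_pos le_rfl, if_neg (by omega), sub_zero]

theorem one_sub_inv_pos (hq : 1 < q) : 0 < 1 - q⁻¹ := by
  have := inv_lt_one_of_one_lt₀ hq
  linarith

theorem le_area (hq : 1 < q) (i : Fin m) {j : ℕ} (hj : j ≤ L) :
    (1 - q⁻¹) * q ^ (-(smoothing i + (j : ℝ))) / m ≤ area q L i j := by
  rcases hj.lt_or_eq with h | rfl
  · exact (area_eq_of_lt hq i h).ge
  · rw [area_last]
    have : 0 < q ^ (-(smoothing i + (j : ℝ))) := Real.rpow_pos_of_pos (by linarith) _
    have h2 : 0 < q⁻¹ := by positivity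
    gcongr
    nlinarith

theorem area_le_tailArea (hq : 1 < q) (i : Fin m) (j : ℕ) : area q L i j ≤ tailArea q L i j := by
  have := tailArea_nonneg (L := L) hq i (j + 1)
  unfold area; linarith

theorem area_le (hq : 1 < q) (i : Fin m) (j : ℕ) : area q L i j ≤ (q ^ j)⁻¹ / m := by
  refine (area_le_tailArea hq i j).trans ((tailArea_le hq i j).trans ?_)
  rw [rpow_neg_smoothing_add hq]
  have := rpow_neg_smoothing_le hq i
  have h2 : 0 < (q ^ j)⁻¹ := by positivity
  gcongr
  nlinarith

theorem area_nonneg (hq : 1 < q) (i : Fin m) (j : ℕ) : 0 ≤ area q L i j := by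
  rcases le_or_gt j L with h | h
  · refine le_trans ?_ (le_area hq i h)
    have : 0 < q ^ (-(smoothing i + (j : ℝ))) := Real.rpow_pos_of_pos (by linarith) _
    have := one_sub_inv_pos hq
    positivity
  · unfold area tailArea
    rw [if_neg (by omega), if_neg (by omega)]; simp

/-- Uniform lower bound for the cells of level `j`. -/
theorem const_le_area (hq : 1 < q) (i : Fin m) {j : ℕ} (hj : j ≤ L) :
    (1 - q⁻¹) * q⁻¹ * (q ^ j)⁻¹ / m ≤ area q L i j := by
  refine le_trans ?_ (le_area hq i hj)
  rw [rpow_neg_smoothing_add hq]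
  have h1 := inv_le_rpow_neg_smoothing hq i
  have h2 := one_sub_inv_pos hq
  have h3 : 0 < (q ^ j)⁻¹ := by positivity
  gcongr ?_ / _
  rw [mul_assoc]
  gcongr

variable [NeZero m]

theorem isProbabilityMeasure_hitLaw (hq : 1 < q) : IsProbabilityMeasure (hitLaw q m L) :=
  Measure.isProbabilityMeasure_map (measurable_hitOf hq L).aemeasurable

theorem integral_hitLaw (hq : 1 < q) (g : Hit m L → ℝ) :
    ∫ o, g o ∂(hitLaw q m L) = (hitLaw q m L).real {none} * g none +
      ∑ i, ∑ j : Fin (L + 1), area q L i j * g (some (i, j)) := by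
  have := isProbabilityMeasure_hitLaw (m := m) (L := L) hq
  rw [integral_fintype Integrable.of_finite, Fintype.sum_option]
  simp only [smul_eq_mul, Fintype.sum_prod_type, hitLaw_real_singleton hq]

/-- The indicator of the hits that block the cell `c`. -/
def blk (a h : ℕ) (c : Cell m) (o : Hit m L) : ℝ :=
  open Classical in if ∃ c', toCell o = some c' ∧ Blocks a h c c' then 1 else 0

/-- The indicator of the event that the cell `c` is free after the elements of `T`. -/
def freeInd (a h : ℕ) {U : ℕ} (T : Finset (Fin U)) (ω : Fin U → Hit m L) (c : Cell m) : ℝ :=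
  ∏ x ∈ T, (1 - blk a h c (ω x))

/-- The state changing probability after the elements of `T`. -/
def freeArea (q : ℝ) (a h : ℕ) {U : ℕ} (T : Finset (Fin U)) (ω : Fin U → Hit m L) : ℝ :=
  (hitLaw q m L).real (freeHits a h toCell (T.image ω))

theorem blk_nonneg (a h : ℕ) (c : Cell m) (o : Hit m L) : 0 ≤ blk a h c o := by
  unfold blk; split_ifs <;> norm_num

theorem blk_le_one (a h : ℕ) (c : Cell m) (o : Hit m L) : blk a h c o ≤ 1 := by
  unfold blk; split_ifs <;> norm_num

theorem freeInd_nonneg (a h : ℕ) {U : ℕ} (T : Finset (Fin U)) (ω : Fin U → Hit m L)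
    (c : Cell m) : 0 ≤ freeInd a h T ω c :=
  Finset.prod_nonneg fun x _ => by have := blk_le_one a h c (ω x); linarith

theorem freeInd_eq_ite {a : ℕ} (ha : 1 ≤ a) (h : ℕ) {U : ℕ} (T : Finset (Fin U))
    (ω : Fin U → Hit m L) (c : Cell m)
    [Decidable (Occupied a (sketch a h (hitCells toCell (T.image ω))) c)] : freeInd a h T ω c =
      if Occupied a (sketch a h (hitCells toCell (T.image ω))) c then 0 else 1 := by
  have hocc : Occupied a (sketch a h (hitCells toCell (T.image ω))) c ↔
      ∃ x ∈ T, ∃ c', toCell (ω x) = some c' ∧ Blocks a h c c' := by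
    rw [occupied_sketch_iff ha]
    simp only [mem_hitCells, Finset.mem_image]
    constructor
    · rintro ⟨c', ⟨o, ⟨x, hx, rfl⟩, he⟩, hb⟩
      exact ⟨x, hx, c', he, hb⟩
    · rintro ⟨x, hx, c', he, hb⟩
      exact ⟨c', ⟨_, ⟨x, hx, rfl⟩, he⟩, hb⟩
  unfold freeInd blk
  split_ifs with ho
  · obtain ⟨x, hx, hb⟩ := hocc.1 ho
    exact Finset.prod_eq_zero hx (by rw [if_pos hb, sub_self])
  · refine Finset.prod_eq_one fun x hx => ?_
    rw [if_neg fun hb => ho (hocc.2 ⟨x, hx, hb⟩), sub_zero]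

theorem freeArea_eq (hq : 1 < q) {a : ℕ} (ha : 1 ≤ a) (h : ℕ) {U : ℕ} (T : Finset (Fin U))
    (ω : Fin U → Hit m L) : freeArea q a h T ω =
      ∑ i, ∑ j ∈ Finset.range (L + 1), area q L i j * freeInd a h T ω (i, j) := by
  classical
  have := isProbabilityMeasure_hitLaw (m := m) (L := L) hq
  have h1 : freeArea q a h T ω = ∫ o, (freeHits a h toCell (T.image ω)).indicator
      (fun _ => (1 : ℝ)) o ∂(hitLaw q m L) := by
    rw [integral_indicator_const _ MeasurableSet.of_discrete]; simp [freeArea]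
  rw [h1, integral_hitLaw hq, Set.indicator_of_notMem, mul_zero, zero_add]
  · refine Finset.sum_congr rfl fun i _ => ?_
    rw [← Fin.sum_univ_eq_sum_range (fun j => area q L i j * freeInd a h T ω (i, j))]
    refine Finset.sum_congr rfl fun j _ => ?_
    rw [freeInd_eq_ite ha, Set.indicator_apply]
    have : (some (i, j) : Hit m L) ∈ freeHits a h toCell (T.image ω) ↔
        ¬ Occupied a (sketch a h (hitCells toCell (T.image ω))) (i, (j : ℕ)) := by
      simp [freeHits, toCell]
    by_cases ho : Occupied a (sketch a h (hitCells toCell (T.image ω))) (i, (j : ℕ)) <;>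
      simp [this, ho]
  · rintro ⟨c, hc, -⟩
    simp [toCell] at hc

/-- Independence of the hits of distinct elements. -/
theorem integral_prod_hits {α : Type*} [MeasurableSpace α] {ν : Measure α}
    [IsProbabilityMeasure ν] {U : ℕ} (T : Finset (Fin U)) (g : α → ℝ) :
    ∫ ω, ∏ x ∈ T, g (ω x) ∂(Measure.pi fun _ : Fin U => ν) = (∫ o, g o ∂ν) ^ T.card := by
  classical
  have h1 : ∀ ω : Fin U → α, ∏ x ∈ T, g (ω x) =
      ∏ x, (if x ∈ T then g else fun _ => 1) (ω x) := by
    intro ω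
    rw [← Finset.prod_subset (Finset.subset_univ T)
      (f := fun x => (if x ∈ T then g else fun _ => 1) (ω x))]
    · exact Finset.prod_congr rfl fun x hx => by simp [hx]
    · intro x _ hx; simp [hx]
  simp only [h1]
  rw [integral_fintype_prod_eq_prod (fun x => if x ∈ T then g else fun _ => 1),
    ← Finset.prod_subset (Finset.subset_univ T)]
  · rw [Finset.prod_congr rfl (g := fun _ => ∫ o, g o ∂ν) fun x hx => by simp [hx],
      Finset.prod_const]
  · intro x _ hx; simp [hx]

/-! ### Tail bounds -/

/-- A bound for the number of cells of level `j` that a hit blocks. -/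
def reach (j : ℕ) (o : Hit m L) : ℕ :=
  o.elim 0 fun c => if j ≤ (c.2 : ℕ) then 3 + 4 * (c.2 - j) else 0

theorem reach_antitone {j₁ j : ℕ} (hj : j₁ ≤ j) (o : Hit m L) : reach j o ≤ reach j₁ o := by
  rcases o with _ | ⟨i', j'⟩
  · exact le_rfl
  · simp only [reach, Option.elim_some]
    split_ifs <;> omega

/-- Since `a - 1/2 ≥ 1/2`, a slope loses at least half a level per column, and the shifts contribute
at most another half level. -/
theorem Blocks.reach {a : ℕ} (ha : 1 ≤ a) {h : ℕ} {c c' : Cell m} (hb : Blocks a h c c') :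
    c.2 ≤ c'.2 ∧ |(c.1.val : ℤ) - (c'.1.val : ℤ)| ≤ 2 * ((c'.2 : ℤ) - c.2) + 1 := by
  have ha' : (1 : ℚ) ≤ a := by exact_mod_cast ha
  rcases hb with rfl | ⟨h1, h2⟩ | ⟨-, h2⟩
  · simp
  · refine ⟨by omega, ?_⟩
    rw [h1, sub_self, abs_zero]
    omega
  · have h3 := shift_nonneg c.1
    have h4 := shift_le_half c'.1
    have h5 := abs_nonneg ((c.1.val : ℚ) - (c'.1.val : ℚ))
    have h6 : (0 : ℚ) ≤ h := Nat.cast_nonneg h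
    unfold height at h2
    have h7 : |(c.1.val : ℚ) - (c'.1.val : ℚ)| ≤ 2 * ((c'.2 : ℚ) - c.2) + 1 := by nlinarith
    constructor
    · have : (c.2 : ℚ) < c'.2 + 1 := by linarith
      have : c.2 < c'.2 + 1 := by exact_mod_cast this
      omega
    · have h8 : ((|(c.1.val : ℤ) - (c'.1.val : ℤ)| : ℤ) : ℚ) ≤
          ((2 * ((c'.2 : ℤ) - c.2) + 1 : ℤ) : ℚ) := by push_cast; exact h7
      exact_mod_cast h8

/-- The blocked cells of level `j` lie within distance `2 * n + 1` of a hit `n` levels higher, which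
allows `4 * n + 3` columns: the value of `reach`. -/
theorem sum_blk_le {a : ℕ} (ha : 1 ≤ a) (h j : ℕ) (o : Hit m L) :
    ∑ i : Fin m, blk a h (i, j) o ≤ reach j o := by
  classical
  unfold blk
  rw [← Finset.sum_filter, Finset.sum_const, nsmul_eq_mul, mul_one]
  norm_cast
  rcases o with _ | ⟨i', j'⟩
  · simp [toCell]
  · simp only [toCell, Option.map_some, Option.some.injEq, exists_eq_left', reach,
      Option.elim_some]
    split_ifs with hj
    · calc _ ≤ (Finset.Icc (i'.val - (2 * (j' - j) + 1)) (i'.val + (2 * (j' - j) + 1))).card := by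
            refine Finset.card_le_card_of_injOn (fun i => i.val) ?_
              (fun x _ y _ hxy => Fin.ext hxy)
            intro i hi
            simp only [Finset.coe_filter, Finset.mem_univ, true_and, Set.mem_ofPred_eq] at hi
            have := hi.reach ha
            simp only [abs_le] at this
            simp only [Finset.coe_Icc, Set.mem_Icc]
            omega
        _ ≤ _ := by rw [Nat.card_Icc]; omega
    · rw [nonpos_iff_eq_zero, Finset.card_eq_zero, Finset.filter_eq_empty_iff]
      intro i _ hb
      exact hj (hb.reach ha).1

/-- Exponential moments of `reach`. -/
theorem integral_pow_reach_le {s : ℝ} (hs : 1 < s) (hq : q = s ^ 16) (j : ℕ) :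
    ∫ o, (s ^ (2 * reach j o) - 1) ∂(hitLaw q m L) ≤ s ^ 6 / (1 - (s ^ 8)⁻¹) * (q ^ j)⁻¹ := by
  have hq1 : 1 < q := hq ▸ one_lt_pow₀ hs (by norm_num)
  have hm : (0 : ℝ) < m := by exact_mod_cast NeZero.pos m
  have hs0 : 0 < s := by linarith
  have hρ1 : (s ^ 8)⁻¹ < 1 := inv_lt_one_of_one_lt₀ (one_lt_pow₀ hs (by norm_num))
  have hρ0 : 0 ≤ (s ^ 8)⁻¹ := by positivity
  rw [integral_hitLaw hq1]
  have hnone : s ^ (2 * reach j (none : Hit m L)) - 1 = 0 := by simp [reach]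
  rw [hnone, mul_zero, zero_add]
  have hcol : ∀ i : Fin m, ∑ j' : Fin (L + 1), area q L i j' *
      (s ^ (2 * reach j (some (i, j') : Hit m L)) - 1) ≤
      s ^ 6 / (1 - (s ^ 8)⁻¹) * (q ^ j)⁻¹ / m := by
    intro i
    -- For a hit `n` levels above `j` the weight is `s ^ (6 + 8 * n)`, while the area falls like `q
    -- ^ (-n) = s ^ (-16 * n)`. A geometric series with ratio `s ^ (-8)` remains; this is the
    -- purpose of the sixteenth root `s`.
    have hterm : ∀ j' : ℕ, area q L i j' *
        (s ^ (2 * (if j ≤ j' then 3 + 4 * (j' - j) else 0)) - 1) ≤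
        if j ≤ j' then s ^ 6 * (q ^ j)⁻¹ / m * (s ^ 8)⁻¹ ^ (j' - j) else 0 := by
      intro j'
      split_ifs with hj
      · obtain ⟨n, rfl⟩ := Nat.exists_eq_add_of_le hj
        rw [Nat.add_sub_cancel_left]
        have h1 := area_le (L := L) hq1 i (j + n)
        have h2 := area_nonneg (L := L) hq1 i (j + n)
        have h3 : 1 ≤ s ^ (2 * (3 + 4 * n)) := one_le_pow₀ hs.le
        calc area q L i (j + n) * (s ^ (2 * (3 + 4 * n)) - 1)
            ≤ area q L i (j + n) * s ^ (2 * (3 + 4 * n)) := by gcongr; linarith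
          _ ≤ (q ^ (j + n))⁻¹ / m * s ^ (2 * (3 + 4 * n)) := by gcongr
          _ = s ^ 6 * (q ^ j)⁻¹ / m * (s ^ 8)⁻¹ ^ n := by
            have e1 : s ^ (2 * (3 + 4 * n)) = s ^ 6 * (s ^ 8) ^ n := by
              rw [← pow_mul, ← pow_add]; congr 1; ring
            have e2 : q ^ n = (s ^ 8) ^ n * (s ^ 8) ^ n := by
              rw [hq, ← mul_pow]; congr 1; ring
            rw [pow_add, e1, e2, inv_pow]
            field_simp
      · simp
    have e : ∀ j' : Fin (L + 1), reach j (some (i, j') : Hit m L) =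
        if j ≤ (j' : ℕ) then 3 + 4 * ((j' : ℕ) - j) else 0 := fun j' => rfl
    simp only [e]
    rw [Fin.sum_univ_eq_sum_range (fun j' => area q L i j' *
        (s ^ (2 * (if j ≤ j' then 3 + 4 * (j' - j) else 0)) - 1))]
    calc _ ≤ ∑ j' ∈ Finset.range (L + 1),
          (if j ≤ j' then s ^ 6 * (q ^ j)⁻¹ / m * (s ^ 8)⁻¹ ^ (j' - j) else 0) :=
          Finset.sum_le_sum fun j' _ => hterm j'
      _ = s ^ 6 * (q ^ j)⁻¹ / m * ∑ j' ∈ Finset.Ico j (L + 1), (s ^ 8)⁻¹ ^ (j' - j) := by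
          rw [← Finset.sum_filter, Finset.mul_sum]
          refine Finset.sum_congr ?_ fun _ _ => rfl
          ext x; simp only [Finset.mem_filter, Finset.mem_range, Finset.mem_Ico]; omega
      _ = s ^ 6 * (q ^ j)⁻¹ / m * ∑ n ∈ Finset.range (L + 1 - j), (s ^ 8)⁻¹ ^ n := by
          rw [Finset.sum_Ico_eq_sum_range]; simp
      _ ≤ s ^ 6 * (q ^ j)⁻¹ / m * (1 - (s ^ 8)⁻¹)⁻¹ := by
          have : 0 < q := by linarith
          gcongr
          rw [← tsum_geometric_of_lt_one hρ0 hρ1]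
          exact (summable_geometric_of_lt_one hρ0 hρ1).sum_le_tsum _
            fun _ _ => by positivity
      _ = _ := by ring
  calc _ ≤ ∑ _i : Fin m, s ^ 6 / (1 - (s ^ 8)⁻¹) * (q ^ j)⁻¹ / m :=
        Finset.sum_le_sum fun i _ => hcol i
    _ = _ := by
      rw [Finset.sum_const, Finset.card_univ, Fintype.card_fin, nsmul_eq_mul]
      field_simp

theorem integral_sq_reach_le {s : ℝ} (hs : 1 < s) (hq : q = s ^ 16) (j : ℕ) :
    ∫ o, (reach j o : ℝ) ^ 2 ∂(hitLaw q m L) ≤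
      s ^ 6 / (1 - (s ^ 8)⁻¹) / (s - 1) ^ 2 * (q ^ j)⁻¹ := by
  have hq1 : 1 < q := hq ▸ one_lt_pow₀ hs (by norm_num)
  have := isProbabilityMeasure_hitLaw (m := m) (L := L) hq1
  -- Bernoulli's inequality gives `1 + n * (s - 1) ≤ s ^ n`; squaring leaves `n ^ 2 * (s - 1) ^ 2 ≤
  -- s ^ (2 * n) - 1`.
  have h1 : ∀ o : Hit m L, (reach j o : ℝ) ^ 2 ≤ ((s - 1) ^ 2)⁻¹ * (s ^ (2 * reach j o) - 1) := by
    intro o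
    set n := reach j o
    have h2 : 1 + (n : ℝ) * (s - 1) ≤ s ^ n := by
      have := one_add_mul_le_pow (a := s - 1) (by linarith) n
      simpa using this
    have h3 : 0 ≤ (n : ℝ) * (s - 1) := mul_nonneg (Nat.cast_nonneg _) (by linarith)
    have h4 : (s - 1) ^ 2 ≠ 0 := pow_ne_zero _ (by linarith)
    rw [inv_mul_eq_div, le_div_iff₀ (by positivity), mul_comm 2 n, pow_mul]
    nlinarith
  calc _ ≤ ∫ o, ((s - 1) ^ 2)⁻¹ * (s ^ (2 * reach j o) - 1) ∂(hitLaw q m L) :=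
        integral_mono Integrable.of_finite Integrable.of_finite h1
    _ = ((s - 1) ^ 2)⁻¹ * ∫ o, (s ^ (2 * reach j o) - 1) ∂(hitLaw q m L) :=
        integral_const_mul _ _
    _ ≤ ((s - 1) ^ 2)⁻¹ * (s ^ 6 / (1 - (s ^ 8)⁻¹) * (q ^ j)⁻¹) := by
        gcongr; exact integral_pow_reach_le hs hq j
    _ = _ := by ring

/-- A bound for the number of occupied cells of level `j`. -/
def totalReach (j : ℕ) {U : ℕ} (T : Finset (Fin U)) (ω : Fin U → Hit m L) : ℕ :=
  ∑ x ∈ T, reach j (ω x)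

/-- It is exponentially unlikely that half of the cells of a rarely hit level are occupied. -/
theorem prob_totalReach_le {s : ℝ} (hs : 1 < s) (hq : q = s ^ 16) (j : ℕ) {U : ℕ}
    (T : Finset (Fin U))
    (hk : s ^ 6 / (1 - (s ^ 8)⁻¹) * (T.card / q ^ j) ≤ Real.log s / 2 * m) (hm2 : 2 ≤ s ^ m) :
    (Measure.pi fun _ : Fin U => hitLaw q m L).real {ω | m ≤ 2 * totalReach j T ω} ≤
      2 * (s ^ 6 / (1 - (s ^ 8)⁻¹)) * (T.card / q ^ j) * Real.exp (-(Real.log s / 2 * m)) := by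
  have hq1 : 1 < q := hq ▸ one_lt_pow₀ hs (by norm_num)
  have := isProbabilityMeasure_hitLaw (m := m) (L := L) hq1
  have hs0 : 0 < s := by linarith
  set C := s ^ 6 / (1 - (s ^ 8)⁻¹) with hC
  set t := C * (T.card / q ^ j) with ht
  set e := Real.log s / 2 * m with he
  have hρ1 : (s ^ 8)⁻¹ < 1 := inv_lt_one_of_one_lt₀ (one_lt_pow₀ hs (by norm_num))
  have hC0 : 0 < C := div_pos (by positivity) (by linarith)
  have ht0 : 0 ≤ t := by positivity
  have hsm : s ^ m = Real.exp e * Real.exp e := by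
    rw [← Real.exp_add, he, ← Real.rpow_natCast, Real.rpow_def_of_pos hs0]
    congr 1; ring
  set A := {ω : Fin U → Hit m L | m ≤ 2 * totalReach j T ω}
  set p := (Measure.pi fun _ : Fin U => hitLaw q m L).real A with hp
  have hp0 : 0 ≤ p := measureReal_nonneg
  -- Markov's inequality is applied to `s ^ (2 * R) - 1`, not to `s ^ (2 * R)`. The subtracted one
  -- leaves a factor `t`, proportional to `k / q ^ j`, which later cancels the weight `q ^ (j + 1)`
  -- of the level.
  have h1 : p * (s ^ m - 1) ≤ Real.exp t - 1 := by
    have h2 : p * (s ^ m - 1) = ∫ ω, A.indicator (fun _ => s ^ m - 1) ω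
        ∂(Measure.pi fun _ : Fin U => hitLaw q m L) := by
      rw [integral_indicator_const _ MeasurableSet.of_discrete, smul_eq_mul]
    have h3 : ∀ ω : Fin U → Hit m L, A.indicator (fun _ => s ^ m - 1) ω ≤
        ∏ x ∈ T, s ^ (2 * reach j (ω x)) - 1 := by
      intro ω
      have h4 : ∏ x ∈ T, s ^ (2 * reach j (ω x)) = s ^ (2 * totalReach j T ω) := by
        rw [Finset.prod_pow_eq_pow_sum, totalReach, Finset.mul_sum]
      rw [h4]
      by_cases hω : ω ∈ A
      · rw [Set.indicator_of_mem hω]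
        exact sub_le_sub_right (pow_le_pow_right₀ hs.le hω) _
      · rw [Set.indicator_of_notMem hω]
        exact sub_nonneg.2 (one_le_pow₀ hs.le)
    have h5 : ∫ o, s ^ (2 * reach j o) ∂(hitLaw q m L) ≤ 1 + C * (q ^ j)⁻¹ := by
      have := integral_pow_reach_le (m := m) (L := L) hs hq j
      rw [integral_sub Integrable.of_finite Integrable.of_finite] at this
      simp only [integral_const, probReal_univ, one_smul] at this
      linarith
    have h6 : 0 ≤ ∫ o, s ^ (2 * reach j o) ∂(hitLaw q m L) :=
      integral_nonneg fun o => by positivity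
    calc p * (s ^ m - 1) = _ := h2
      _ ≤ ∫ ω, (∏ x ∈ T, s ^ (2 * reach j (ω x)) - 1)
          ∂(Measure.pi fun _ : Fin U => hitLaw q m L) :=
          integral_mono Integrable.of_finite Integrable.of_finite h3
      _ = (∫ o, s ^ (2 * reach j o) ∂(hitLaw q m L)) ^ T.card - 1 := by
          rw [integral_sub Integrable.of_finite Integrable.of_finite,
            integral_prod_hits T (fun o : Hit m L => s ^ (2 * reach j o))]
          simp
      _ ≤ (1 + C * (q ^ j)⁻¹) ^ T.card - 1 := by gcongr
      _ ≤ (Real.exp (C * (q ^ j)⁻¹)) ^ T.card - 1 := by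
          have := Real.add_one_le_exp (C * (q ^ j)⁻¹)
          have h7 : 0 < q := by linarith
          gcongr
          linarith
      _ = Real.exp t - 1 := by
          rw [← Real.exp_nat_mul, ht]; congr 2; ring
  have h8 : Real.exp t - 1 ≤ t * Real.exp e := by
    have h9 := Real.add_one_le_exp (-t)
    have h10 : Real.exp t * Real.exp (-t) = 1 := by rw [← Real.exp_add]; simp
    have h11 : Real.exp t ≤ Real.exp e := Real.exp_le_exp.2 hk
    have h12 := Real.exp_pos t
    nlinarith
  -- From `s ^ m ≥ 2` one has `s ^ m - 1 ≥ s ^ m / 2`; hence the factor `2`.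
  have h13 : p * (Real.exp e * Real.exp e) ≤ 2 * t * Real.exp e := by
    rw [hsm] at h1 hm2
    nlinarith
  have h14 := Real.exp_pos e
  have h15 : p * Real.exp e ≤ 2 * t := by
    by_contra hcon
    rw [not_le] at hcon
    nlinarith
  rw [Real.exp_neg, ← div_eq_mul_inv, le_div_iff₀ h14]
  calc _ ≤ 2 * t := h15
    _ = _ := by rw [ht]; ring

/-! ### Lower bounds for the state changing probability -/

theorem one_sub_sum_le_freeInd (a h : ℕ) {U : ℕ} (T : Finset (Fin U)) (ω : Fin U → Hit m L)
    (c : Cell m) : 1 - ∑ x ∈ T, blk a h c (ω x) ≤ freeInd a h T ω c := by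
  classical
  induction T using Finset.induction_on with
  | empty => simp [freeInd]
  | insert x T hx ih =>
    have h1 := blk_nonneg a h c (ω x)
    have h2 : freeInd a h T ω c ≤ 1 := Finset.prod_le_one
      (fun x _ => by have := blk_le_one a h c (ω x); linarith)
      (fun x _ => by have := blk_nonneg a h c (ω x); linarith)
    rw [Finset.sum_insert hx, freeInd, Finset.prod_insert hx, ← freeInd]
    nlinarith

theorem sum_level_le_freeArea (hq : 1 < q) {a : ℕ} (ha : 1 ≤ a) (h : ℕ) {U : ℕ}
    (T : Finset (Fin U)) (ω : Fin U → Hit m L) {j : ℕ} (hj : j ≤ L) :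
    ∑ i, area q L i j * freeInd a h T ω (i, j) ≤ freeArea q a h T ω := by
  rw [freeArea_eq hq ha]
  refine Finset.sum_le_sum fun i _ => ?_
  exact Finset.single_le_sum (f := fun j => area q L i j * freeInd a h T ω (i, j))
    (fun j _ => mul_nonneg (area_nonneg hq _ _) (freeInd_nonneg _ _ _ _ _))
    (Finset.mem_range.2 (by omega))

/-- Fewer than `m / 2` cells of level `j` are blocked, and each of the others has area of order `q ^
(-j) / m`. -/
theorem le_freeArea_of_totalReach (hq : 1 < q) {a : ℕ} (ha : 1 ≤ a) (h : ℕ) {U : ℕ}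
    (T : Finset (Fin U)) (ω : Fin U → Hit m L) {j : ℕ} (hj : j ≤ L)
    (hr : 2 * totalReach j T ω < m) :
    (1 - q⁻¹) * q⁻¹ / 2 * (q ^ j)⁻¹ ≤ freeArea q a h T ω := by
  have hm : (0 : ℝ) < m := by exact_mod_cast NeZero.pos m
  have hr' : 2 * (totalReach j T ω : ℝ) < m := by exact_mod_cast hr
  have h1 : (m : ℝ) / 2 ≤ ∑ i : Fin m, freeInd a h T ω (i, j) := by
    calc (m : ℝ) / 2 ≤ m - totalReach j T ω := by linarith
      _ ≤ m - ∑ x ∈ T, ∑ i : Fin m, blk a h (i, j) (ω x) := by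
          rw [totalReach]; push_cast
          gcongr with x hx
          exact sum_blk_le ha h j (ω x)
      _ = ∑ i : Fin m, (1 - ∑ x ∈ T, blk a h (i, j) (ω x)) := by
          rw [Finset.sum_sub_distrib, Finset.sum_comm]; simp
      _ ≤ _ := Finset.sum_le_sum fun i _ => one_sub_sum_le_freeInd a h T ω _
  have h2 := one_sub_inv_pos hq
  have h3 : 0 < q := by linarith
  calc (1 - q⁻¹) * q⁻¹ / 2 * (q ^ j)⁻¹ = (1 - q⁻¹) * q⁻¹ * (q ^ j)⁻¹ / m * (m / 2) := by
        field_simp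
    _ ≤ (1 - q⁻¹) * q⁻¹ * (q ^ j)⁻¹ / m * ∑ i : Fin m, freeInd a h T ω (i, j) := by gcongr
    _ = ∑ i : Fin m, (1 - q⁻¹) * q⁻¹ * (q ^ j)⁻¹ / m * freeInd a h T ω (i, j) :=
        Finset.mul_sum _ _ _
    _ ≤ ∑ i, area q L i j * freeInd a h T ω (i, j) := by
        refine Finset.sum_le_sum fun i _ => ?_
        exact mul_le_mul_of_nonneg_right (const_le_area hq i hj) (freeInd_nonneg _ _ _ _ _)
    _ ≤ _ := sum_level_le_freeArea hq ha h T ω hj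

/-- If anything is free, then at least one whole cell is, and no cell is smaller than the order of
the last level. -/
theorem freeArea_eq_zero_or_le (hq : 1 < q) {a : ℕ} (ha : 1 ≤ a) (h : ℕ) {U : ℕ}
    (T : Finset (Fin U)) (ω : Fin U → Hit m L) : freeArea q a h T ω = 0 ∨
      (1 - q⁻¹) * q⁻¹ / m * (q ^ L)⁻¹ ≤ freeArea q a h T ω := by
  classical
  have h2 := one_sub_inv_pos hq
  have h3 : 0 < q := by linarith
  by_cases hex : ∃ i : Fin m, ∃ j ∈ Finset.range (L + 1), freeInd a h T ω (i, j) = 1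
  · right
    obtain ⟨i, j, hj, h1⟩ := hex
    have hj' : j ≤ L := by rw [Finset.mem_range] at hj; omega
    calc (1 - q⁻¹) * q⁻¹ / m * (q ^ L)⁻¹ ≤ (1 - q⁻¹) * q⁻¹ / m * (q ^ j)⁻¹ := by
          gcongr
          exact hq.le
      _ = (1 - q⁻¹) * q⁻¹ * (q ^ j)⁻¹ / m := by ring
      _ ≤ area q L i j := const_le_area hq i hj'
      _ = area q L i j * freeInd a h T ω (i, j) := by rw [h1, mul_one]
      _ ≤ ∑ i, area q L i j * freeInd a h T ω (i, j) :=
          Finset.single_le_sum (f := fun i => area q L i j * freeInd a h T ω (i, j))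
            (fun i _ => mul_nonneg (area_nonneg hq _ _) (freeInd_nonneg _ _ _ _ _))
            (Finset.mem_univ i)
      _ ≤ _ := sum_level_le_freeArea hq ha h T ω hj'
  · left
    push Not at hex
    rw [freeArea_eq hq ha]
    refine Finset.sum_eq_zero fun i _ => Finset.sum_eq_zero fun j hj => ?_
    have h1 := hex i j hj
    rw [freeInd_eq_ite ha] at h1 ⊢
    split_ifs at h1 ⊢ with ho
    · simp
    · exact absurd rfl h1

end Finite

/-! ### The expected inverse of the state changing probability -/

section InverseMean

variable {q : ℝ} {m L : ℕ} [NeZero m]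

/-- The joint law of the hits of all elements of the universe. -/
abbrev hitsLaw (q : ℝ) (m L U : ℕ) : Measure (Fin U → Hit m L) :=
  Measure.pi fun _ => hitLaw q m L

theorem freeArea_nonneg (a h : ℕ) {U : ℕ} (T : Finset (Fin U)) (ω : Fin U → Hit m L) :
    0 ≤ freeArea q a h T ω := measureReal_nonneg

/-- Call a level bad if its total reach is at least `m / 2`. If `j₀` is bad, either some bad level
`j` is followed by a good one, so that `1 / P` is of order `q ^ (j + 1)`, or all levels up to `L`
are bad. In the latter case a single free cell bounds `1 / P` by the order of `m * q ^ L`, and `P =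
0` is harmless because its inverse is `0`. -/
theorem inv_freeArea_le_split (hq : 1 < q) {a : ℕ} (ha : 1 ≤ a) (h : ℕ) {U : ℕ}
    (T : Finset (Fin U)) (ω : Fin U → Hit m L) {j₀ : ℕ} (hj₀ : j₀ ≤ L) {g : ℝ} (hg : 0 ≤ g)
    (hgood : 2 * totalReach j₀ T ω < m → (freeArea q a h T ω)⁻¹ ≤ g) :
    (freeArea q a h T ω)⁻¹ ≤ g + ((1 - q⁻¹) * q⁻¹ / 2)⁻¹ *
      (∑ j ∈ Finset.Ico j₀ L, q ^ (j + 1) * {ω | m ≤ 2 * totalReach j T ω}.indicator 1 ω +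
        m * q ^ L * {ω | m ≤ 2 * totalReach L T ω}.indicator 1 ω) := by
  have h2 := one_sub_inv_pos hq
  have h3 : 0 < q := by linarith
  have hc : 0 < (1 - q⁻¹) * q⁻¹ / 2 := by positivity
  have hm : (0 : ℝ) < m := by exact_mod_cast NeZero.pos m
  have hi : ∀ j, 0 ≤ ({ω | m ≤ 2 * totalReach j T ω} : Set (Fin U → Hit m L)).indicator
      (1 : (Fin U → Hit m L) → ℝ) ω :=
    fun j => Set.indicator_nonneg (fun _ _ => zero_le_one) _
  have hsum : 0 ≤ ∑ j ∈ Finset.Ico j₀ L,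
      q ^ (j + 1) * ({ω | m ≤ 2 * totalReach j T ω} : Set (Fin U → Hit m L)).indicator 1 ω :=
    Finset.sum_nonneg fun j _ => mul_nonneg (by positivity) (hi j)
  have hlast : 0 ≤ m * q ^ L *
      ({ω | m ≤ 2 * totalReach L T ω} : Set (Fin U → Hit m L)).indicator 1 ω :=
    mul_nonneg (by positivity) (hi L)
  by_cases hb0 : 2 * totalReach j₀ T ω < m
  · have := hgood hb0
    have : 0 ≤ ((1 - q⁻¹) * q⁻¹ / 2)⁻¹ * (∑ j ∈ Finset.Ico j₀ L,
      q ^ (j + 1) * ({ω | m ≤ 2 * totalReach j T ω} : Set (Fin U → Hit m L)).indicator 1 ω +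
        m * q ^ L * ({ω | m ≤ 2 * totalReach L T ω} : Set (Fin U → Hit m L)).indicator 1 ω) := by
      positivity
    linarith
  · rw [not_lt] at hb0
    by_cases hbL : m ≤ 2 * totalReach L T ω
    · have e : ({ω | m ≤ 2 * totalReach L T ω} : Set (Fin U → Hit m L)).indicator
          (1 : (Fin U → Hit m L) → ℝ) ω = 1 := by
        rw [Set.indicator_of_mem (by exact hbL)]; rfl
      rw [e, mul_one]
      have key : (freeArea q a h T ω)⁻¹ ≤ ((1 - q⁻¹) * q⁻¹ / 2)⁻¹ * (m * q ^ L) := by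
        rcases freeArea_eq_zero_or_le hq ha h T ω with h0 | h0
        · rw [h0, inv_zero]; positivity
        · calc (freeArea q a h T ω)⁻¹ ≤ ((1 - q⁻¹) * q⁻¹ / m * (q ^ L)⁻¹)⁻¹ :=
                inv_anti₀ (by positivity) h0
            _ = ((1 - q⁻¹) * q⁻¹)⁻¹ * (m * q ^ L) := by field_simp
            _ ≤ _ := by
              gcongr
              linarith [mul_pos h2 (inv_pos.2 h3)]
      have : 0 ≤ ((1 - q⁻¹) * q⁻¹ / 2)⁻¹ * ∑ j ∈ Finset.Ico j₀ L,
        q ^ (j + 1) * ({ω | m ≤ 2 * totalReach j T ω} : Set (Fin U → Hit m L)).indicator 1 ω := by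
        positivity
      rw [mul_add]
      linarith
    · obtain ⟨j, hj, hbj, hbj1⟩ : ∃ j ∈ Finset.Ico j₀ L, m ≤ 2 * totalReach j T ω ∧
          2 * totalReach (j + 1) T ω < m := by
        by_contra hcon
        push Not at hcon
        apply hbL
        obtain ⟨n, rfl⟩ := Nat.exists_eq_add_of_le hj₀
        have : ∀ n' ≤ n, m ≤ 2 * totalReach (j₀ + n') T ω := by
          intro n'
          induction n' with
          | zero => intro _; exact hb0
          | succ n' ih =>
            intro hn
            exact hcon (j₀ + n') (by rw [Finset.mem_Ico]; omega) (ih (by omega))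
        exact this n le_rfl
      rw [Finset.mem_Ico] at hj
      have h4 := le_freeArea_of_totalReach hq ha h T ω (j := j + 1) (by omega) hbj1
      have e : ({ω | m ≤ 2 * totalReach j T ω} : Set (Fin U → Hit m L)).indicator
          (1 : (Fin U → Hit m L) → ℝ) ω = 1 := by
        rw [Set.indicator_of_mem (by exact hbj)]; rfl
      have h5 : q ^ (j + 1) ≤ ∑ j ∈ Finset.Ico j₀ L,
          q ^ (j + 1) * ({ω | m ≤ 2 * totalReach j T ω} : Set (Fin U → Hit m L)).indicator 1 ω := by
        have := Finset.single_le_sum (f := fun j => q ^ (j + 1) *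
          ({ω | m ≤ 2 * totalReach j T ω} : Set (Fin U → Hit m L)).indicator
            (1 : (Fin U → Hit m L) → ℝ) ω)
          (fun j _ => mul_nonneg (by positivity) (hi j)) (Finset.mem_Ico.2 hj)
        simpa only [e, mul_one] using this
      calc (freeArea q a h T ω)⁻¹ ≤ ((1 - q⁻¹) * q⁻¹ / 2 * (q ^ (j + 1))⁻¹)⁻¹ :=
            inv_anti₀ (by positivity) h4
        _ = ((1 - q⁻¹) * q⁻¹ / 2)⁻¹ * q ^ (j + 1) := by rw [mul_inv, inv_inv]
        _ ≤ ((1 - q⁻¹) * q⁻¹ / 2)⁻¹ * _ :=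
          mul_le_mul_of_nonneg_left (h5.trans (le_add_of_nonneg_right hlast)) (by positivity)
        _ ≤ _ := le_add_of_nonneg_left hg

/-- The constant of the exponential moment bound. -/
def expConst (s : ℝ) : ℝ := s ^ 6 / (1 - (s ^ 8)⁻¹)

theorem expConst_pos {s : ℝ} (hs : 1 < s) : 0 < expConst s := by
  have hρ1 : (s ^ 8)⁻¹ < 1 := inv_lt_one_of_one_lt₀ (one_lt_pow₀ hs (by norm_num))
  exact div_pos (by positivity) (by linarith)

/-- Extremely small state changing probabilities do not contribute to the expected inverse. -/
theorem integral_inv_freeArea_le {s : ℝ} (hs : 1 < s) (hq : q = s ^ 16) {a : ℕ} (ha : 1 ≤ a)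
    (h : ℕ) {U : ℕ} (T : Finset (Fin U)) {j₀ : ℕ} (hj₀ : j₀ ≤ L)
    (hk : expConst s * (T.card / q ^ j₀) ≤ Real.log s / 2 * m) (hm2 : 2 ≤ s ^ m)
    {g : (Fin U → Hit m L) → ℝ} (hg : ∀ ω, 0 ≤ g ω)
    (hgood : ∀ ω, 2 * totalReach j₀ T ω < m → (freeArea q a h T ω)⁻¹ ≤ g ω) :
    ∫ ω, (freeArea q a h T ω)⁻¹ ∂(hitsLaw q m L U) ≤ ∫ ω, g ω ∂(hitsLaw q m L U) +
      ((1 - q⁻¹) * q⁻¹ / 2)⁻¹ * (2 * expConst s * q) *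
        (T.card * ((L + m : ℝ) * Real.exp (-(Real.log s / 2 * m)))) := by
  have hq1 : 1 < q := hq ▸ one_lt_pow₀ hs (by norm_num)
  have := isProbabilityMeasure_hitLaw (m := m) (L := L) hq1
  have h2 := one_sub_inv_pos hq1
  have h3 : 0 < q := by linarith
  have hC := expConst_pos hs
  set e := Real.exp (-(Real.log s / 2 * m)) with he
  have he0 : 0 < e := Real.exp_pos _
  have hB : ∀ j, j₀ ≤ j → (hitsLaw q m L U).real {ω | m ≤ 2 * totalReach j T ω} ≤
      2 * expConst s * (T.card / q ^ j) * e := by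
    intro j hj
    refine prob_totalReach_le hs hq j T (le_trans ?_ hk) hm2
    rw [expConst] at hC ⊢
    gcongr
    exact hq1.le
  have hI : ∀ j, ∫ ω, ({ω | m ≤ 2 * totalReach j T ω} : Set (Fin U → Hit m L)).indicator
      (1 : (Fin U → Hit m L) → ℝ) ω ∂(hitsLaw q m L U) =
      (hitsLaw q m L U).real {ω | m ≤ 2 * totalReach j T ω} := fun j =>
    integral_indicator_one MeasurableSet.of_discrete
  calc ∫ ω, (freeArea q a h T ω)⁻¹ ∂(hitsLaw q m L U) ≤ ∫ ω, (g ω + ((1 - q⁻¹) * q⁻¹ / 2)⁻¹ *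
      (∑ j ∈ Finset.Ico j₀ L, q ^ (j + 1) * {ω | m ≤ 2 * totalReach j T ω}.indicator 1 ω +
        m * q ^ L * {ω | m ≤ 2 * totalReach L T ω}.indicator 1 ω)) ∂(hitsLaw q m L U) :=
        integral_mono Integrable.of_finite Integrable.of_finite fun ω =>
          inv_freeArea_le_split hq1 ha h T ω hj₀ (hg ω) (hgood ω)
    _ = ∫ ω, g ω ∂(hitsLaw q m L U) + ((1 - q⁻¹) * q⁻¹ / 2)⁻¹ *
      (∑ j ∈ Finset.Ico j₀ L, q ^ (j + 1) *
          (hitsLaw q m L U).real {ω | m ≤ 2 * totalReach j T ω} +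
        m * q ^ L * (hitsLaw q m L U).real {ω | m ≤ 2 * totalReach L T ω}) := by
        rw [integral_add Integrable.of_finite Integrable.of_finite, integral_const_mul,
          integral_add Integrable.of_finite Integrable.of_finite,
          integral_finsetSum _ fun _ _ => Integrable.of_finite, integral_const_mul, hI]
        simp only [integral_const_mul, hI]
    _ ≤ ∫ ω, g ω ∂(hitsLaw q m L U) + ((1 - q⁻¹) * q⁻¹ / 2)⁻¹ *
      (∑ j ∈ Finset.Ico j₀ L, q ^ (j + 1) * (2 * expConst s * (T.card / q ^ j) * e) +
        m * q ^ L * (2 * expConst s * (T.card / q ^ L) * e)) := by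
        gcongr with j hj
        · exact hB j (Finset.mem_Ico.1 hj).1
        · exact hB L hj₀
    -- The weight of each level cancels the factor `q ^ (-j)` of its probability bound, so all
    -- levels contribute alike. The number of levels, and with it `log U`, enters only here.
    _ = ∫ ω, g ω ∂(hitsLaw q m L U) + ((1 - q⁻¹) * q⁻¹ / 2)⁻¹ *
      ((L - j₀ : ℕ) * (q * (2 * expConst s * T.card * e)) +
        m * (2 * expConst s * T.card * e)) := by
        congr 3
        · rw [Finset.sum_congr rfl (g := fun _ => q * (2 * expConst s * T.card * e)),
            Finset.sum_const, Nat.card_Ico, nsmul_eq_mul]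
          intro j _
          rw [pow_succ]; field_simp
        · field_simp
    _ ≤ ∫ ω, g ω ∂(hitsLaw q m L U) + ((1 - q⁻¹) * q⁻¹ / 2)⁻¹ *
      (L * (q * (2 * expConst s * T.card * e)) +
        m * (q * (2 * expConst s * T.card * e))) := by
        have h5 : ((L - j₀ : ℕ) : ℝ) ≤ L := by exact_mod_cast Nat.sub_le _ _
        have h6 : 0 ≤ 2 * expConst s * T.card * e := by positivity
        have h7 : 2 * expConst s * T.card * e ≤ q * (2 * expConst s * T.card * e) :=
          le_mul_of_one_le_left h6 hq1.le
        gcongr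
    _ = _ := by ring

theorem live_freeHits (a h : ℕ) {U : ℕ} (T : Finset (Fin U)) (ω : Fin U → Hit m L) :
    live (freeHits a h toCell) (hitLaw q m L) T ω = if freeArea q a h T ω = 0 then 0 else 1 :=
  rfl

/-- Saturation is exponentially unlikely. -/
theorem integral_one_sub_live_le {s : ℝ} (hs : 1 < s) (hq : q = s ^ 16) {a : ℕ} (ha : 1 ≤ a)
    (h : ℕ) {U : ℕ} (T : Finset (Fin U)) (hTL : (T.card : ℝ) ≤ q ^ L)
    (hk : expConst s ≤ Real.log s / 2 * m) (hm2 : 2 ≤ s ^ m) :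
    ∫ ω, (1 - live (freeHits a h toCell) (hitLaw q m L) T ω) ∂(hitsLaw q m L U) ≤
      2 * expConst s * Real.exp (-(Real.log s / 2 * m)) := by
  have hq1 : 1 < q := hq ▸ one_lt_pow₀ hs (by norm_num)
  have := isProbabilityMeasure_hitLaw (m := m) (L := L) hq1
  have h3 : 0 < q := by linarith
  have hC := expConst_pos hs
  have hr : (T.card : ℝ) / q ^ L ≤ 1 := (div_le_one (by positivity)).2 hTL
  have hr0 : 0 ≤ (T.card : ℝ) / q ^ L := by positivity
  have hI : ∫ ω, ({ω | m ≤ 2 * totalReach L T ω} : Set (Fin U → Hit m L)).indicator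
      (1 : (Fin U → Hit m L) → ℝ) ω ∂(hitsLaw q m L U) =
      (hitsLaw q m L U).real {ω | m ≤ 2 * totalReach L T ω} :=
    integral_indicator_one MeasurableSet.of_discrete
  calc _ ≤ ∫ ω, ({ω | m ≤ 2 * totalReach L T ω} : Set (Fin U → Hit m L)).indicator
        (1 : (Fin U → Hit m L) → ℝ) ω ∂(hitsLaw q m L U) := by
        refine integral_mono Integrable.of_finite Integrable.of_finite fun ω => ?_
        by_cases hb : m ≤ 2 * totalReach L T ω
        · simp only [Set.indicator_of_mem (show ω ∈ {ω | m ≤ 2 * totalReach L T ω} from hb)]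
          have := live_nonneg (Fr := freeHits a h (toCell (m := m) (L := L)))
            (ν := hitLaw q m L) T ω
          simp only [Pi.one_apply]
          linarith
        · have h4 := le_freeArea_of_totalReach hq1 ha h T ω le_rfl (not_le.1 hb)
          have h5 : 0 < (1 - q⁻¹) * q⁻¹ / 2 * (q ^ L)⁻¹ := by
            have := one_sub_inv_pos hq1
            positivity
          simp only [Set.indicator_of_notMem
            (show ω ∉ {ω | m ≤ 2 * totalReach L T ω} from hb), live_freeHits]
          rw [if_neg (by linarith)]
          simp
    _ ≤ 2 * expConst s * (T.card / q ^ L) * Real.exp (-(Real.log s / 2 * m)) := by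
        rw [hI]
        refine prob_totalReach_le hs hq L T (le_trans ?_ hk) hm2
        rw [← expConst]
        nlinarith
    _ ≤ 2 * expConst s * 1 * Real.exp (-(Real.log s / 2 * m)) := by gcongr
    _ = _ := by ring

/-- Integrate the tangent of the inverse at `τ`, namely `1 / P ≥ 2 / τ - P / τ ^ 2`. It fails at `P
= 0`, where Lean's inverse is `0`, so the constant term carries the factor `live`. -/
theorem le_integral_inv_freeArea (hq : 1 < q) {a : ℕ} (h : ℕ) {U : ℕ}
    (T : Finset (Fin U)) {τ : ℝ} (hτ : 0 < τ)
    (hE : ∫ ω, freeArea q a h T ω ∂(hitsLaw q m L U) ≤ τ) :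
    τ⁻¹ * (1 - 2 * ∫ ω, (1 - live (freeHits a h toCell) (hitLaw q m L) T ω) ∂(hitsLaw q m L U)) ≤
      ∫ ω, (freeArea q a h T ω)⁻¹ ∂(hitsLaw q m L U) := by
  have := isProbabilityMeasure_hitLaw (m := m) (L := L) hq
  have h1 : ∀ ω : Fin U → Hit m L, 2 * τ⁻¹ * live (freeHits a h toCell) (hitLaw q m L) T ω -
      τ⁻¹ ^ 2 * freeArea q a h T ω ≤ (freeArea q a h T ω)⁻¹ := by
    intro ω
    rw [live_freeHits]
    split_ifs with h0
    · rw [h0]; simp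
    · have hp : 0 < freeArea q a h T ω := lt_of_le_of_ne (freeArea_nonneg a h T ω) (Ne.symm h0)
      set P := freeArea q a h T ω
      have : P⁻¹ - (2 * τ⁻¹ * 1 - τ⁻¹ ^ 2 * P) = P * (P⁻¹ - τ⁻¹) ^ 2 := by field_simp; ring
      have : 0 ≤ P * (P⁻¹ - τ⁻¹) ^ 2 := by positivity
      linarith
  calc _ = 2 * τ⁻¹ * ∫ ω, live (freeHits a h toCell) (hitLaw q m L) T ω ∂(hitsLaw q m L U) -
        τ⁻¹ ^ 2 * τ := by
        rw [integral_sub Integrable.of_finite Integrable.of_finite]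
        simp only [integral_const, probReal_univ, one_smul]
        field_simp; ring
    _ ≤ 2 * τ⁻¹ * ∫ ω, live (freeHits a h toCell) (hitLaw q m L) T ω ∂(hitsLaw q m L U) -
        τ⁻¹ ^ 2 * ∫ ω, freeArea q a h T ω ∂(hitsLaw q m L U) := by gcongr
    _ = ∫ ω, (2 * τ⁻¹ * live (freeHits a h toCell) (hitLaw q m L) T ω -
        τ⁻¹ ^ 2 * freeArea q a h T ω) ∂(hitsLaw q m L U) := by
        rw [integral_sub Integrable.of_finite Integrable.of_finite, integral_const_mul,
          integral_const_mul]
    _ ≤ _ := integral_mono Integrable.of_finite Integrable.of_finite h1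

/-! ### Moments of the free area -/

/-- The area hit by darts that block the cell `c`. -/
def blkArea (q : ℝ) (L a h : ℕ) (c : Cell m) : ℝ := ∫ o : Hit m L, blk a h c o ∂(hitLaw q m L)

theorem integral_freeInd (hq : 1 < q) (a h : ℕ) {U : ℕ} (T : Finset (Fin U)) (c : Cell m) :
    ∫ ω : Fin U → Hit m L, freeInd a h T ω c ∂(hitsLaw q m L U) =
      (1 - blkArea q L a h c) ^ T.card := by
  have := isProbabilityMeasure_hitLaw (m := m) (L := L) hq
  unfold freeInd blkArea
  rw [integral_prod_hits T (fun o => 1 - blk a h c o),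
    integral_sub Integrable.of_finite Integrable.of_finite]
  simp

theorem blkArea_nonneg (a h : ℕ) (c : Cell m) : 0 ≤ blkArea q L a h c :=
  integral_nonneg fun o => blk_nonneg a h c o

theorem blkArea_le_one (hq : 1 < q) (a h : ℕ) (c : Cell m) : blkArea q L a h c ≤ 1 := by
  have := isProbabilityMeasure_hitLaw (m := m) (L := L) hq
  have h1 : blkArea q L a h c ≤ ∫ _o : Hit m L, (1 : ℝ) ∂(hitLaw q m L) :=
    integral_mono Integrable.of_finite Integrable.of_finite fun o => blk_le_one a h c o
  simpa using h1

theorem integral_freeArea (hq : 1 < q) {a : ℕ} (ha : 1 ≤ a) (h : ℕ) {U : ℕ}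
    (T : Finset (Fin U)) : ∫ ω : Fin U → Hit m L, freeArea q a h T ω ∂(hitsLaw q m L U) =
      ∑ i : Fin m, ∑ j ∈ Finset.range (L + 1),
        area q L i j * (1 - blkArea q L a h (i, j)) ^ T.card := by
  have := isProbabilityMeasure_hitLaw (m := m) (L := L) hq
  simp only [freeArea_eq hq ha]
  rw [integral_finsetSum _ fun _ _ => Integrable.of_finite]
  refine Finset.sum_congr rfl fun i _ => ?_
  rw [integral_finsetSum _ fun _ _ => Integrable.of_finite]
  refine Finset.sum_congr rfl fun j _ => ?_
  rw [integral_const_mul, integral_freeInd hq]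

/-- The free area of the cells `j` of levels `j₁ ≤ j < L`. -/
def partArea (q : ℝ) (a h j₁ : ℕ) {U : ℕ} (T : Finset (Fin U)) (ω : Fin U → Hit m L) : ℝ :=
  ∑ c ∈ Finset.univ ×ˢ Finset.Ico j₁ L, area q L c.1 c.2 * freeInd a h T ω c

theorem partArea_le_freeArea (hq : 1 < q) {a : ℕ} (ha : 1 ≤ a) (h j₁ : ℕ) {U : ℕ}
    (T : Finset (Fin U)) (ω : Fin U → Hit m L) : partArea q a h j₁ T ω ≤ freeArea q a h T ω := by
  rw [freeArea_eq hq ha, partArea, Finset.sum_product]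
  refine Finset.sum_le_sum fun i _ => Finset.sum_le_sum_of_subset_of_nonneg ?_ fun j _ _ =>
    mul_nonneg (area_nonneg hq _ _) (freeInd_nonneg _ _ _ _ _)
  intro j hj
  rw [Finset.mem_Ico] at hj
  rw [Finset.mem_range]; omega

theorem integral_partArea (hq : 1 < q) (a h j₁ : ℕ) {U : ℕ} (T : Finset (Fin U)) :
    ∫ ω : Fin U → Hit m L, partArea q a h j₁ T ω ∂(hitsLaw q m L U) =
      ∑ c ∈ (Finset.univ : Finset (Fin m)) ×ˢ Finset.Ico j₁ L,
        area q L c.1 c.2 * (1 - blkArea q L a h c) ^ T.card := by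
  have := isProbabilityMeasure_hitLaw (m := m) (L := L) hq
  unfold partArea
  rw [integral_finsetSum _ fun _ _ => Integrable.of_finite]
  refine Finset.sum_congr rfl fun c _ => ?_
  rw [integral_const_mul, integral_freeInd hq]

theorem pow_sub_pow_le_mul {x y d : ℝ} (hx0 : 0 ≤ x) (hx1 : x ≤ 1) (hy0 : 0 ≤ y) (hy1 : y ≤ 1)
    (hd : 0 ≤ d) (hxy : x - y ≤ d) (k : ℕ) : x ^ k - y ^ k ≤ k * d := by
  induction k with
  | zero => simp
  | succ k ih =>
    have h1 : y ^ k ≤ 1 := pow_le_one₀ hy0 hy1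
    have h2 : 0 ≤ y ^ k := by positivity
    have h3 : 0 ≤ (k : ℝ) * d := by positivity
    have e : x ^ (k + 1) - y ^ (k + 1) = x * (x ^ k - y ^ k) + y ^ k * (x - y) := by ring
    rw [e]; push_cast
    have h4 : x * (x ^ k - y ^ k) ≤ k * d := by
      calc x * (x ^ k - y ^ k) ≤ x * (k * d) := by gcongr
        _ ≤ 1 * (k * d) := by gcongr
        _ = k * d := one_mul _
    have h5 : y ^ k * (x - y) ≤ d := by
      calc y ^ k * (x - y) ≤ y ^ k * d := by gcongr
        _ ≤ 1 * d := by gcongr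
        _ = d := one_mul _
    linarith

/-- For a single dart the covariance is `E[B * B'] - b * b'`, with `B`, `B'` the blocking indicators
and `b`, `b'` their means. Independence raises the two expectations to the power `k`, and `x ↦ x ^
k` has slope at most `k` on the unit interval. -/
theorem integral_freeInd_mul_sub_le (hq : 1 < q) (a h : ℕ) {U : ℕ} (T : Finset (Fin U))
    (c c' : Cell m) :
    ∫ ω : Fin U → Hit m L, freeInd a h T ω c * freeInd a h T ω c' ∂(hitsLaw q m L U) -
      (∫ ω : Fin U → Hit m L, freeInd a h T ω c ∂(hitsLaw q m L U)) *
      (∫ ω : Fin U → Hit m L, freeInd a h T ω c' ∂(hitsLaw q m L U)) ≤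
      T.card * ∫ o : Hit m L, blk a h c o * blk a h c' o ∂(hitLaw q m L) := by
  have := isProbabilityMeasure_hitLaw (m := m) (L := L) hq
  have e1 : ∀ ω : Fin U → Hit m L, freeInd a h T ω c * freeInd a h T ω c' =
      ∏ x ∈ T, (1 - blk a h c (ω x)) * (1 - blk a h c' (ω x)) := fun ω =>
    Finset.prod_mul_distrib.symm
  have hb := blkArea_nonneg (q := q) (L := L) a h c
  have hb' := blkArea_nonneg (q := q) (L := L) a h c'
  have hb1 := blkArea_le_one (L := L) hq a h c
  have hb1' := blkArea_le_one (L := L) hq a h c'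
  simp only [e1]
  rw [integral_prod_hits T (fun o => (1 - blk a h c o) * (1 - blk a h c' o)),
    integral_freeInd hq, integral_freeInd hq, ← mul_pow]
  have h0 : ∀ o : Hit m L, 0 ≤ (1 - blk a h c o) * (1 - blk a h c' o) := fun o =>
    mul_nonneg (sub_nonneg.2 (blk_le_one a h c o)) (sub_nonneg.2 (blk_le_one a h c' o))
  have h1 : ∀ o : Hit m L, (1 - blk a h c o) * (1 - blk a h c' o) ≤ 1 := fun o =>
    mul_le_one₀ (by have := blk_nonneg a h c o; linarith)
      (sub_nonneg.2 (blk_le_one a h c' o)) (by have := blk_nonneg a h c' o; linarith)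
  apply pow_sub_pow_le_mul
  · exact integral_nonneg h0
  · have := integral_mono (μ := hitLaw q m L) Integrable.of_finite Integrable.of_finite h1
    simpa using this
  · exact mul_nonneg (by linarith) (by linarith)
  · exact mul_le_one₀ (by linarith) (by linarith) (by linarith)
  · exact integral_nonneg fun o => mul_nonneg (blk_nonneg a h c o) (blk_nonneg a h c' o)
  · have e2 : ∫ o : Hit m L, (1 - blk a h c o) * (1 - blk a h c' o) ∂(hitLaw q m L) =
        1 - blkArea q L a h c - blkArea q L a h c' +
          ∫ o : Hit m L, blk a h c o * blk a h c' o ∂(hitLaw q m L) := by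
      have e3 : ∀ o : Hit m L, (1 - blk a h c o) * (1 - blk a h c' o) =
          1 - blk a h c o - blk a h c' o + blk a h c o * blk a h c' o := fun o => by ring
      simp only [e3]
      rw [integral_add Integrable.of_finite Integrable.of_finite,
        integral_sub Integrable.of_finite Integrable.of_finite,
        integral_sub Integrable.of_finite Integrable.of_finite]
      simp [blkArea]
    rw [e2]
    nlinarith [mul_nonneg hb hb']

/-- The cells shrink by a factor `q` per level and `reach` decreases with the level, so a geometric
series with its first term at level `j₁` bounds the blocked area. -/
theorem sum_area_blk_le (hq : 1 < q) {a : ℕ} (ha : 1 ≤ a) (h j₁ : ℕ) (o : Hit m L) :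
    ∑ c ∈ Finset.univ ×ˢ Finset.Ico j₁ L, area q L c.1 c.2 * blk a h c o ≤
      (q ^ j₁)⁻¹ / (m * (1 - q⁻¹)) * reach j₁ o := by
  have h2 := one_sub_inv_pos hq
  have h3 : 0 < q := by linarith
  have hm : (0 : ℝ) < m := by exact_mod_cast NeZero.pos m
  rw [Finset.sum_product_right]
  have hlevel : ∀ j ∈ Finset.Ico j₁ L, ∑ i : Fin m, area q L i j * blk a h (i, j) o ≤
      (q⁻¹) ^ (j - j₁) * ((q ^ j₁)⁻¹ / m * reach j₁ o) := by
    intro j hj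
    obtain ⟨n, rfl⟩ := Nat.exists_eq_add_of_le (Finset.mem_Ico.1 hj).1
    calc ∑ i : Fin m, area q L i (j₁ + n) * blk a h (i, j₁ + n) o
        ≤ ∑ i : Fin m, (q ^ (j₁ + n))⁻¹ / m * blk a h (i, j₁ + n) o :=
          Finset.sum_le_sum fun i _ => mul_le_mul_of_nonneg_right (area_le hq i _)
            (blk_nonneg _ _ _ _)
      _ = (q ^ (j₁ + n))⁻¹ / m * ∑ i : Fin m, blk a h (i, j₁ + n) o := (Finset.mul_sum _ _ _).symm
      _ ≤ (q ^ (j₁ + n))⁻¹ / m * reach (j₁ + n) o := by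
          gcongr; exact sum_blk_le ha h _ o
      _ ≤ (q ^ (j₁ + n))⁻¹ / m * reach j₁ o := by
          gcongr; exact reach_antitone (by omega) o
      _ = _ := by
          rw [Nat.add_sub_cancel_left, pow_add, mul_inv, inv_pow]; ring
  calc _ ≤ ∑ j ∈ Finset.Ico j₁ L, (q⁻¹) ^ (j - j₁) * ((q ^ j₁)⁻¹ / m * reach j₁ o) :=
        Finset.sum_le_sum hlevel
    _ = (∑ n ∈ Finset.range (L - j₁), (q⁻¹) ^ n) * ((q ^ j₁)⁻¹ / m * reach j₁ o) := by
        rw [← Finset.sum_mul, Finset.sum_Ico_eq_sum_range]; simp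
    _ ≤ (1 - q⁻¹)⁻¹ * ((q ^ j₁)⁻¹ / m * reach j₁ o) := by
        gcongr
        rw [← tsum_geometric_of_lt_one (by positivity) (by linarith)]
        exact (summable_geometric_of_lt_one (by positivity) (by linarith)).sum_le_tsum _
          fun _ _ => by positivity
    _ = _ := by field_simp

/-- The variance of the free area of small cells. -/
theorem variance_partArea_le {s : ℝ} (hs : 1 < s) (hq : q = s ^ 16) {a : ℕ} (ha : 1 ≤ a)
    (h j₁ : ℕ) {U : ℕ} (T : Finset (Fin U)) {t : ℝ}
    (ht : t = ∫ ω : Fin U → Hit m L, partArea q a h j₁ T ω ∂(hitsLaw q m L U)) :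
    ∫ ω : Fin U → Hit m L, (partArea q a h j₁ T ω - t) ^ 2 ∂(hitsLaw q m L U) ≤
      expConst s / (s - 1) ^ 2 / (1 - q⁻¹) ^ 2 * (T.card / m ^ 2 * (q ^ j₁)⁻¹ ^ 3) := by
  have hq1 : 1 < q := hq ▸ one_lt_pow₀ hs (by norm_num)
  have := isProbabilityMeasure_hitLaw (m := m) (L := L) hq1
  have h2 := one_sub_inv_pos hq1
  have h3 : 0 < q := by linarith
  have hm : (0 : ℝ) < m := by exact_mod_cast NeZero.pos m
  set S : Finset (Cell m) := Finset.univ ×ˢ Finset.Ico j₁ L with hS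
  set E : Cell m → ℝ := fun c => ∫ ω : Fin U → Hit m L, freeInd a h T ω c ∂(hitsLaw q m L U)
  have ht' : t = ∑ c ∈ S, area q L c.1 c.2 * E c := by
    rw [ht]; unfold partArea
    rw [integral_finsetSum _ fun _ _ => Integrable.of_finite]
    exact Finset.sum_congr rfl fun c _ => integral_const_mul _ _
  have e1 : ∫ ω : Fin U → Hit m L, (partArea q a h j₁ T ω - t) ^ 2 ∂(hitsLaw q m L U) =
      ∫ ω : Fin U → Hit m L, (partArea q a h j₁ T ω) ^ 2 ∂(hitsLaw q m L U) - t ^ 2 := by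
    have e2 : ∀ ω : Fin U → Hit m L, (partArea q a h j₁ T ω - t) ^ 2 =
        (partArea q a h j₁ T ω) ^ 2 - (2 * t) * partArea q a h j₁ T ω + t ^ 2 := fun ω => by ring
    simp only [e2]
    rw [integral_add Integrable.of_finite Integrable.of_finite,
      integral_sub Integrable.of_finite Integrable.of_finite, integral_const_mul, ← ht]
    simp only [integral_const, probReal_univ, one_smul]
    ring
  have e3 : ∫ ω : Fin U → Hit m L, (partArea q a h j₁ T ω) ^ 2 ∂(hitsLaw q m L U) =
      ∑ c ∈ S, ∑ c' ∈ S, area q L c.1 c.2 * area q L c'.1 c'.2 *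
        ∫ ω : Fin U → Hit m L, freeInd a h T ω c * freeInd a h T ω c' ∂(hitsLaw q m L U) := by
    have e4 : ∀ ω : Fin U → Hit m L, (partArea q a h j₁ T ω) ^ 2 =
        ∑ c ∈ S, ∑ c' ∈ S, area q L c.1 c.2 * area q L c'.1 c'.2 *
          (freeInd a h T ω c * freeInd a h T ω c') := by
      intro ω
      rw [sq, partArea, Finset.sum_mul_sum]
      exact Finset.sum_congr rfl fun c _ => Finset.sum_congr rfl fun c' _ => by ring
    simp only [e4]
    rw [integral_finsetSum _ fun _ _ => Integrable.of_finite]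
    refine Finset.sum_congr rfl fun c _ => ?_
    rw [integral_finsetSum _ fun _ _ => Integrable.of_finite]
    exact Finset.sum_congr rfl fun c' _ => integral_const_mul _ _
  have e5 : t ^ 2 = ∑ c ∈ S, ∑ c' ∈ S, area q L c.1 c.2 * area q L c'.1 c'.2 * (E c * E c') := by
    rw [ht', sq, Finset.sum_mul_sum]
    exact Finset.sum_congr rfl fun c _ => Finset.sum_congr rfl fun c' _ => by ring
  -- The weighted double sum of the covariance bounds is the second moment of the area blocked by
  -- one dart. The variance is thus at most `k` times this second moment.
  have e6 : ∫ o : Hit m L, (∑ c ∈ S, area q L c.1 c.2 * blk a h c o) ^ 2 ∂(hitLaw q m L) =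
      ∑ c ∈ S, ∑ c' ∈ S, area q L c.1 c.2 * area q L c'.1 c'.2 *
        ∫ o : Hit m L, blk a h c o * blk a h c' o ∂(hitLaw q m L) := by
    have e4 : ∀ o : Hit m L, (∑ c ∈ S, area q L c.1 c.2 * blk a h c o) ^ 2 =
        ∑ c ∈ S, ∑ c' ∈ S, area q L c.1 c.2 * area q L c'.1 c'.2 *
          (blk a h c o * blk a h c' o) := by
      intro o
      rw [sq, Finset.sum_mul_sum]
      exact Finset.sum_congr rfl fun c _ => Finset.sum_congr rfl fun c' _ => by ring
    simp only [e4]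
    rw [integral_finsetSum _ fun _ _ => Integrable.of_finite]
    refine Finset.sum_congr rfl fun c _ => ?_
    rw [integral_finsetSum _ fun _ _ => Integrable.of_finite]
    exact Finset.sum_congr rfl fun c' _ => integral_const_mul _ _
  calc _ = ∑ c ∈ S, ∑ c' ∈ S, area q L c.1 c.2 * area q L c'.1 c'.2 *
        (∫ ω : Fin U → Hit m L, freeInd a h T ω c * freeInd a h T ω c' ∂(hitsLaw q m L U) -
          E c * E c') := by
        rw [e1, e3, e5, ← Finset.sum_sub_distrib]
        refine Finset.sum_congr rfl fun c _ => ?_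
        rw [← Finset.sum_sub_distrib]
        exact Finset.sum_congr rfl fun c' _ => by ring
    _ ≤ ∑ c ∈ S, ∑ c' ∈ S, area q L c.1 c.2 * area q L c'.1 c'.2 *
        (T.card * ∫ o : Hit m L, blk a h c o * blk a h c' o ∂(hitLaw q m L)) :=
        Finset.sum_le_sum fun c _ => Finset.sum_le_sum fun c' _ =>
          mul_le_mul_of_nonneg_left (integral_freeInd_mul_sub_le hq1 a h T c c')
            (mul_nonneg (area_nonneg hq1 _ _) (area_nonneg hq1 _ _))
    _ = T.card * ∫ o : Hit m L, (∑ c ∈ S, area q L c.1 c.2 * blk a h c o) ^ 2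
          ∂(hitLaw q m L) := by
        rw [e6, Finset.mul_sum]
        refine Finset.sum_congr rfl fun c _ => ?_
        rw [Finset.mul_sum]
        exact Finset.sum_congr rfl fun c' _ => by ring
    _ ≤ T.card * ∫ o : Hit m L, ((q ^ j₁)⁻¹ / (m * (1 - q⁻¹))) ^ 2 * (reach j₁ o : ℝ) ^ 2
          ∂(hitLaw q m L) := by
        refine mul_le_mul_of_nonneg_left
          (integral_mono Integrable.of_finite Integrable.of_finite fun o => ?_) (Nat.cast_nonneg _)
        simp only [← mul_pow]
        exact pow_le_pow_left₀ (Finset.sum_nonneg fun c _ =>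
          mul_nonneg (area_nonneg hq1 _ _) (blk_nonneg _ _ _ _)) (sum_area_blk_le hq1 ha h j₁ o) 2
    _ = T.card * (((q ^ j₁)⁻¹ / (m * (1 - q⁻¹))) ^ 2 * ∫ o : Hit m L, (reach j₁ o : ℝ) ^ 2
          ∂(hitLaw q m L)) := by rw [integral_const_mul]
    _ ≤ T.card * (((q ^ j₁)⁻¹ / (m * (1 - q⁻¹))) ^ 2 *
          (s ^ 6 / (1 - (s ^ 8)⁻¹) / (s - 1) ^ 2 * (q ^ j₁)⁻¹)) := by
        gcongr
        exact integral_sq_reach_le hs hq j₁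
    _ = _ := by
        rw [← expConst]
        field_simp

/-- Pointwise Chebyshev: if `P < t / (1 + η)`, then `P'` misses `t` by at least `t * η / (1 + η)`,
and the squared deviation, suitably scaled, exceeds the crude bound `1 / c`. -/
theorem inv_le_of_le {P P' t c η : ℝ} (hc : 0 < c) (hcP : c ≤ P) (hP : P' ≤ P) (ht : 0 < t)
    (hη : 0 < η) :
    P⁻¹ ≤ (1 + η) / t + (1 + η) ^ 2 / (c * t ^ 2 * η ^ 2) * (P' - t) ^ 2 := by
  have hP0 : 0 < P := hc.trans_le hcP
  by_cases h1 : t / (1 + η) ≤ P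
  · have : P⁻¹ ≤ (t / (1 + η))⁻¹ := inv_anti₀ (by positivity) h1
    rw [inv_div] at this
    have : 0 ≤ (1 + η) ^ 2 / (c * t ^ 2 * η ^ 2) * (P' - t) ^ 2 := by positivity
    linarith
  · rw [not_le] at h1
    have h2 : t * η / (1 + η) ≤ t - P' := by
      have : t * η / (1 + η) = t - t / (1 + η) := by field_simp; ring
      linarith
    have h3 : (t * η / (1 + η)) ^ 2 ≤ (P' - t) ^ 2 := by
      rw [← neg_sq (P' - t), neg_sub]
      exact pow_le_pow_left₀ (by positivity) h2 2
    have h4 : P⁻¹ ≤ c⁻¹ := inv_anti₀ hc hcP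
    calc P⁻¹ ≤ c⁻¹ := h4
      _ = (1 + η) ^ 2 / (c * t ^ 2 * η ^ 2) * (t * η / (1 + η)) ^ 2 := by field_simp
      _ ≤ (1 + η) ^ 2 / (c * t ^ 2 * η ^ 2) * (P' - t) ^ 2 := by gcongr
      _ ≤ _ := by
        have : 0 ≤ (1 + η) / t := by positivity
        linarith

end InverseMean

/-! ### The area of the cells that block a given cell -/

section BlkArea

variable {q : ℝ} {m L : ℕ}

theorem sum_area_eq_tailArea (i : Fin m) (J : ℕ) :
    ∑ j ∈ Finset.range (L + 1), (if J ≤ j then area q L i j else 0) = tailArea q L i J := by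
  have hL : ∀ n, L < n → tailArea q L i n = 0 := fun n hn => by
    unfold tailArea; rw [if_neg (by omega)]
  rcases le_or_gt J (L + 1) with hJ | hJ
  · rw [← Finset.sum_filter]
    have e : (Finset.range (L + 1)).filter (fun j => J ≤ j) = Finset.Ico J (L + 1) := by
      ext x; simp only [Finset.mem_filter, Finset.mem_range, Finset.mem_Ico]; omega
    rw [e]
    unfold area
    rw [Finset.sum_Ico_eq_sum_range]
    have := Finset.sum_range_sub' (fun k => tailArea q L i (J + k)) (L + 1 - J)
    simp only [← add_assoc] at this
    rw [this, add_zero, Nat.add_sub_cancel' hJ, hL (L + 1) (by omega), sub_zero]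
  · rw [hL J (by omega)]
    refine Finset.sum_eq_zero fun j hj => ?_
    rw [Finset.mem_range] at hj
    rw [if_neg (by omega)]

/-- The distance of two columns. -/
def colDist (i i' : Fin m) : ℕ := (i.val - i'.val) + (i'.val - i.val)

theorem abs_sub_eq_colDist (i i' : Fin m) :
    |(i.val : ℚ) - (i'.val : ℚ)| = (colDist i i' : ℚ) := by
  unfold colDist
  rcases le_total i.val i'.val with h | h
  · have h' : (i.val : ℚ) ≤ i'.val := by exact_mod_cast h
    rw [abs_of_nonpos (by linarith), Nat.sub_eq_zero_of_le h, zero_add, Nat.cast_sub h]; ring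
  · have h' : (i'.val : ℚ) ≤ i.val := by exact_mod_cast h
    rw [abs_of_nonneg (by linarith), Nat.sub_eq_zero_of_le h, add_zero, Nat.cast_sub h]

theorem sum_colDist (i : Fin m) (f : ℕ → ℝ) :
    ∑ i' : Fin m, (if i' = i then 0 else f (colDist i i')) =
      ∑ d ∈ Finset.range i.val, f (d + 1) + ∑ d ∈ Finset.range (m - 1 - i.val), f (d + 1) := by
  have h1 : ∑ i' : Fin m, (if i' = i then 0 else f (colDist i i')) =
      ∑ n ∈ Finset.range m, (if n = i.val then 0 else f ((i.val - n) + (n - i.val))) := by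
    rw [← Fin.sum_univ_eq_sum_range
      (fun n => if n = i.val then 0 else f ((i.val - n) + (n - i.val)))]
    refine Finset.sum_congr rfl fun i' _ => ?_
    simp only [colDist, Fin.ext_iff]
  rw [h1, Finset.range_eq_Ico, ← Finset.sum_Ico_consecutive _ (Nat.zero_le i.val) i.isLt.le,
    Finset.sum_eq_sum_Ico_succ_bot i.isLt, if_pos rfl, zero_add, Finset.sum_Ico_eq_sum_range,
    Finset.sum_Ico_eq_sum_range]
  congr 1
  · rw [← Finset.sum_range_reflect (fun d => f (d + 1)), Nat.sub_zero]
    refine Finset.sum_congr rfl fun n hn => ?_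
    rw [Finset.mem_range] at hn
    rw [if_neg (by omega)]
    congr 1; omega
  · have e : m - (i.val + 1) = m - 1 - i.val := by omega
    rw [e]
    refine Finset.sum_congr rfl fun n _ => ?_
    rw [if_neg (by omega)]
    congr 1; omega

/-- In every other column, the cells that block a given cell are those from some level on. -/
theorem exists_blocks_iff {a : ℕ} (ha : 1 ≤ a) (h : ℕ) {i i' : Fin m} (hi : i' ≠ i) (j : ℕ) :
    ∃ J : ℕ, (∀ j', Blocks a h (i, j) (i', j') ↔ J ≤ j') ∧
      2 * J + i'.val % 2 + colDist i i' = 2 * j + i.val % 2 + 2 * h + 2 * (a * colDist i i') := by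
  have hd : 1 ≤ colDist i i' := by
    have : i'.val ≠ i.val := fun h => hi (Fin.ext h)
    unfold colDist; omega
  have hP : colDist i i' ≤ a * colDist i i' := Nat.le_mul_of_pos_left _ ha
  -- The half-integral part of the slope over distance `d` matches the parity change of the
  -- sawtooth, so the threshold `J` is an integer. `hP` keeps the natural subtraction in its formula
  -- from being truncated.
  have hpar : (i.val + i'.val + colDist i i') % 2 = 0 := by unfold colDist; omega
  obtain ⟨J, hJ⟩ : ∃ J : ℕ, 2 * J + i'.val % 2 + colDist i i' =
      2 * j + i.val % 2 + 2 * h + 2 * (a * colDist i i') := by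
    generalize a * colDist i i' = P at *
    generalize colDist i i' = d at *
    refine ⟨(2 * j + i.val % 2 + 2 * h + 2 * P - d - i'.val % 2) / 2, ?_⟩
    omega
  refine ⟨J, fun j' => ?_, hJ⟩
  have hJ' : 2 * (J : ℚ) + (i'.val % 2 : ℕ) + colDist i i' =
      2 * j + (i.val % 2 : ℕ) + 2 * h + 2 * (a * colDist i i') := by exact_mod_cast hJ
  have s1 := two_mul_shift i
  have s2 := two_mul_shift i'
  constructor
  · rintro (h1 | ⟨h1, -⟩ | ⟨-, h1⟩)
    · exact absurd (congrArg Prod.fst h1) hi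
    · exact absurd h1 hi
    · unfold height at h1
      rw [abs_sub_eq_colDist] at h1
      simp only at h1
      have : (J : ℚ) ≤ j' := by linarith
      exact_mod_cast this
  · intro h1
    refine Or.inr (Or.inr ⟨hi, ?_⟩)
    unfold height
    rw [abs_sub_eq_colDist]
    simp only
    have : (J : ℚ) ≤ j' := by exact_mod_cast h1
    linarith

/-- The jump of `1/2` at odd columns occurs both in the heights and in the offsets. It cancels, and
only the slow drift of the offsets remains as an error. -/
theorem smoothing_add_eq {a h j J : ℕ} {i i' : Fin m}
    (hJ : 2 * J + i'.val % 2 + colDist i i' =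
      2 * j + i.val % 2 + 2 * h + 2 * (a * colDist i i')) :
    smoothing i' + (J : ℝ) = smoothing i + j + h + colDist i i' * ((a : ℝ) - 1 / 2) +
      (((i'.val / 2 : ℕ) : ℝ) - ((i.val / 2 : ℕ) : ℝ)) / m := by
  have hJ' : 2 * (J : ℝ) + (i'.val % 2 : ℕ) + colDist i i' =
      2 * j + (i.val % 2 : ℕ) + 2 * h + 2 * (a * colDist i i') := by exact_mod_cast hJ
  have s1 : 2 * ((shift i : ℚ) : ℝ) = ((i.val % 2 : ℕ) : ℝ) := by
    exact_mod_cast congrArg (fun x : ℚ => (x : ℝ)) (two_mul_shift i)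
  have s2 : 2 * ((shift i' : ℚ) : ℝ) = ((i'.val % 2 : ℕ) : ℝ) := by
    exact_mod_cast congrArg (fun x : ℚ => (x : ℝ)) (two_mul_shift i')
  unfold smoothing
  rw [sub_div]
  linarith

/-- The drift is at most `d / m` at distance `d`, so it amounts to changing the slope `a - 1/2` by
at most `1 / m`. -/
theorem abs_half_sub_le (i i' : Fin m) :
    |((i'.val / 2 : ℕ) : ℝ) - ((i.val / 2 : ℕ) : ℝ)| ≤ colDist i i' := by
  have h1 : i'.val / 2 ≤ i.val / 2 + colDist i i' := by unfold colDist; omega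
  have h2 : i.val / 2 ≤ i'.val / 2 + colDist i i' := by unfold colDist; omega
  have h1' : ((i'.val / 2 : ℕ) : ℝ) ≤ ((i.val / 2 : ℕ) : ℝ) + colDist i i' := by exact_mod_cast h1
  have h2' : ((i.val / 2 : ℕ) : ℝ) ≤ ((i'.val / 2 : ℕ) : ℝ) + colDist i i' := by exact_mod_cast h2
  rw [abs_le]; constructor <;> linarith

/-- The constant governing the area of the cells that block a cell, with `D` columns on each side
taken into account, and with slopes perturbed by `η`. -/
def blkConst (q : ℝ) (a h : ℕ) (η : ℝ) (D : ℕ) : ℝ :=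
  1 - q⁻¹ + (q ^ (h + 1))⁻¹ +
    2 * ((q ^ h)⁻¹ * ∑ d ∈ Finset.range D, (q ^ (-((a : ℝ) - 1 / 2 + η))) ^ (d + 1))

theorem rpow_slope (hq : 1 < q) (x : ℝ) (h d : ℕ) (b : ℝ) :
    q ^ (-(x + h + d * b)) = q ^ (-x) * ((q ^ h)⁻¹ * (q ^ (-b)) ^ d) := by
  have hq0 : 0 < q := by linarith
  rw [neg_add, neg_add, Real.rpow_add hq0, Real.rpow_add hq0, Real.rpow_neg hq0.le (h : ℝ),
    Real.rpow_natCast, ← Real.rpow_natCast (q ^ (-b)), ← Real.rpow_mul hq0.le, mul_assoc]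
  congr 3
  ring

variable [NeZero m]

theorem blkArea_eq_sum (hq : 1 < q) (a h : ℕ) (c : Cell m) : blkArea q L a h c =
    ∑ i', ∑ j' ∈ Finset.range (L + 1),
      open Classical in if Blocks a h c (i', j') then area q L i' j' else 0 := by
  classical
  unfold blkArea
  rw [integral_hitLaw hq]
  have h0 : blk a h c (none : Hit m L) = 0 := by simp [blk, toCell]
  rw [h0, mul_zero, zero_add]
  refine Finset.sum_congr rfl fun i' _ => ?_
  rw [← Fin.sum_univ_eq_sum_range (fun j' => if Blocks a h c (i', j') then area q L i' j' else 0)]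
  refine Finset.sum_congr rfl fun j' _ => ?_
  have : blk a h c (some (i', j') : Hit m L) = if Blocks a h c (i', (j' : ℕ)) then 1 else 0 := by
    unfold blk
    simp [toCell]
  rw [this]
  split_ifs <;> simp

theorem sum_own_column {a h : ℕ} (i : Fin m) {j : ℕ} (hj : j ≤ L) :
    (∑ j' ∈ Finset.range (L + 1), open Classical in
      if Blocks a h (i, j) (i, j') then area q L i j' else 0) =
      area q L i j + tailArea q L i (j + h + 1) := by
  classical
  have h1 : ∀ j', (if Blocks a h (i, j) (i, j') then area q L i j' else 0) =
      (if j' = j then area q L i j' else 0) + (if j + h + 1 ≤ j' then area q L i j' else 0) := by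
    intro j'
    have : Blocks a h (i, j) (i, j') ↔ j' = j ∨ j + h + 1 ≤ j' := by
      unfold Blocks
      simp
    by_cases h2 : j' = j
    · rw [if_pos (this.2 (Or.inl h2)), if_pos h2, if_neg (by omega), add_zero]
    · by_cases h3 : j + h + 1 ≤ j'
      · rw [if_pos (this.2 (Or.inr h3)), if_neg h2, if_pos h3, zero_add]
      · rw [if_neg (by rw [this]; tauto), if_neg h2, if_neg h3, zero_add]
  simp only [h1]
  rw [Finset.sum_add_distrib, sum_area_eq_tailArea, Finset.sum_ite_eq' (Finset.range (L + 1)) j,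
    if_pos (Finset.mem_range.2 (by omega))]

theorem sum_other_column_le (hq : 1 < q) {a : ℕ} (ha : 1 ≤ a) (h : ℕ) {i i' : Fin m}
    (hi : i' ≠ i) (j : ℕ) :
    (∑ j' ∈ Finset.range (L + 1), open Classical in
      if Blocks a h (i, j) (i', j') then area q L i' j' else 0) ≤
      q ^ (-(smoothing i + (j : ℝ))) / m *
        ((q ^ h)⁻¹ * (q ^ (-((a : ℝ) - 1 / 2 + -(1 / m)))) ^ colDist i i') := by
  obtain ⟨J, hJ, hJe⟩ := exists_blocks_iff ha h hi j
  have hm : (0 : ℝ) < m := by exact_mod_cast NeZero.pos m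
  simp only [hJ]
  rw [sum_area_eq_tailArea]
  refine (tailArea_le hq i' J).trans ?_
  rw [div_mul_eq_mul_div, ← rpow_slope hq, smoothing_add_eq hJe]
  refine div_le_div_of_nonneg_right (Real.rpow_le_rpow_of_exponent_le hq.le ?_) hm.le
  · have := (abs_le.1 (abs_half_sub_le i i')).1
    have h3 : -((colDist i i' : ℝ) / m) ≤
        (((i'.val / 2 : ℕ) : ℝ) - ((i.val / 2 : ℕ) : ℝ)) / m := by
      rw [← neg_div]; gcongr
    have e : (colDist i i' : ℝ) * ((a : ℝ) - 1 / 2 + -(1 / m)) =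
        colDist i i' * ((a : ℝ) - 1 / 2) - colDist i i' / m := by ring
    rw [e]
    linarith

/-- `hL` keeps the threshold `J` within the board, where the tail has its full area. -/
theorem le_sum_other_column (hq : 1 < q) {a : ℕ} (ha : 1 ≤ a) (h : ℕ) {i i' : Fin m}
    (hi : i' ≠ i) {j : ℕ} (hL : j + h + a * colDist i i' ≤ L) :
    q ^ (-(smoothing i + (j : ℝ))) / m *
        ((q ^ h)⁻¹ * (q ^ (-((a : ℝ) - 1 / 2 + 1 / m))) ^ colDist i i') ≤
    ∑ j' ∈ Finset.range (L + 1), open Classical in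
      if Blocks a h (i, j) (i', j') then area q L i' j' else 0 := by
  obtain ⟨J, hJ, hJe⟩ := exists_blocks_iff ha h hi j
  have hm : (0 : ℝ) < m := by exact_mod_cast NeZero.pos m
  have hd : 1 ≤ colDist i i' := by
    have : i'.val ≠ i.val := fun h => hi (Fin.ext h)
    unfold colDist; omega
  simp only [hJ]
  rw [sum_area_eq_tailArea, tailArea, if_pos (by omega), div_mul_eq_mul_div, ← rpow_slope hq,
    smoothing_add_eq hJe]
  refine div_le_div_of_nonneg_right (Real.rpow_le_rpow_of_exponent_le hq.le ?_) hm.le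
  · have := (abs_le.1 (abs_half_sub_le i i')).2
    have h3 : (((i'.val / 2 : ℕ) : ℝ) - ((i.val / 2 : ℕ) : ℝ)) / m ≤
        (colDist i i' : ℝ) / m := by gcongr
    have e : (colDist i i' : ℝ) * ((a : ℝ) - 1 / 2 + 1 / m) =
        colDist i i' * ((a : ℝ) - 1 / 2) + colDist i i' / m := by ring
    rw [e]
    linarith

theorem area_add_tailArea_of_lt (hq : 1 < q) (h : ℕ) (i : Fin m) {j : ℕ} (hj : j + h + 1 ≤ L) :
    area q L i j + tailArea q L i (j + h + 1) =
      q ^ (-(smoothing i + (j : ℝ))) / m * (1 - q⁻¹ + (q ^ (h + 1))⁻¹) := by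
  rw [area_eq_of_lt hq i (by omega), tailArea, if_pos hj, rpow_neg_smoothing_add hq,
    rpow_neg_smoothing_add hq, add_assoc, pow_add, mul_inv]
  ring

/-- Allowing `m` neighbours on each side only increases the bound, so no column is exceptional. The
last level is excluded since its cells carry a whole tail. -/
theorem blkArea_le (hq : 1 < q) {a : ℕ} (ha : 1 ≤ a) (h : ℕ) (i : Fin m) {j : ℕ} (hj : j < L) :
    blkArea q L a h (i, j) ≤
      q ^ (-(smoothing i + (j : ℝ))) / m * blkConst q a h (-(1 / m)) m := by
  classical
  have hm : (0 : ℝ) < m := by exact_mod_cast NeZero.pos m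
  have hq0 : 0 < q := by linarith
  set y := q ^ (-(smoothing i + (j : ℝ))) with hy
  have hy0 : 0 < y := Real.rpow_pos_of_pos hq0 _
  set f : ℕ → ℝ := fun d => y / m *
    ((q ^ h)⁻¹ * (q ^ (-((a : ℝ) - 1 / 2 + -(1 / m)))) ^ d) with hf
  have hf0 : ∀ d, 0 ≤ f d := fun d => by positivity
  rw [blkArea_eq_sum hq, ← Finset.add_sum_erase _ _ (Finset.mem_univ i), sum_own_column i hj.le]
  have h1 : area q L i j + tailArea q L i (j + h + 1) ≤
      y / m * (1 - q⁻¹ + (q ^ (h + 1))⁻¹) := by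
    rw [area_eq_of_lt hq i hj]
    have := tailArea_le (L := L) hq i (j + h + 1)
    rw [add_assoc j h 1] at this ⊢
    have e : q ^ (-(smoothing i + ((j + (h + 1) : ℕ) : ℝ))) = y * (q ^ (h + 1))⁻¹ := by
      rw [hy, rpow_neg_smoothing_add hq, rpow_neg_smoothing_add hq, pow_add, mul_inv]; ring
    rw [e] at this
    calc _ ≤ (1 - q⁻¹) * y / m + y * (q ^ (h + 1))⁻¹ / m := by rw [← hy]; linarith
      _ = _ := by ring
  have h2 : (∑ i' ∈ Finset.univ.erase i, ∑ j' ∈ Finset.range (L + 1),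
      if Blocks a h (i, j) (i', j') then area q L i' j' else 0) ≤
      2 * ∑ d ∈ Finset.range m, f (d + 1) := by
    calc _ ≤ ∑ i' ∈ Finset.univ.erase i, f (colDist i i') :=
          Finset.sum_le_sum fun i' hi' =>
            sum_other_column_le hq ha h (Finset.ne_of_mem_erase hi') j
      _ = ∑ i' : Fin m, (if i' = i then 0 else f (colDist i i')) := by
          rw [← Finset.add_sum_erase _ _ (Finset.mem_univ i), if_pos rfl, zero_add]
          exact Finset.sum_congr rfl fun i' hi' => (if_neg (Finset.ne_of_mem_erase hi')).symm
      _ = _ := sum_colDist i f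
      _ ≤ ∑ d ∈ Finset.range m, f (d + 1) + ∑ d ∈ Finset.range m, f (d + 1) := by
          have := i.isLt
          exact add_le_add
            (Finset.sum_le_sum_of_subset_of_nonneg
              (Finset.range_subset_range.2 (by omega)) fun _ _ _ => hf0 _)
            (Finset.sum_le_sum_of_subset_of_nonneg
              (Finset.range_subset_range.2 (by omega)) fun _ _ _ => hf0 _)
      _ = _ := by ring
  calc _ ≤ y / m * (1 - q⁻¹ + (q ^ (h + 1))⁻¹) + 2 * ∑ d ∈ Finset.range m, f (d + 1) :=
        add_le_add h1 h2
    _ = _ := by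
        simp only [hf, blkConst, ← Finset.mul_sum]; ring

/-- Only `D` neighbours on each side are kept. They all exist if the column is `D` away from the
borders, and their thresholds stay below `L` if the level is low enough. -/
theorem le_blkArea (hq : 1 < q) {a : ℕ} (ha : 1 ≤ a) (h D : ℕ) {i : Fin m} {j : ℕ}
    (hj : j + h + 1 + a * D ≤ L) (hi : D ≤ i.val) (hi' : i.val + D < m) :
    q ^ (-(smoothing i + (j : ℝ))) / m * blkConst q a h (1 / m) D ≤ blkArea q L a h (i, j) := by
  classical
  have hm : (0 : ℝ) < m := by exact_mod_cast NeZero.pos m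
  have hq0 : 0 < q := by linarith
  set y := q ^ (-(smoothing i + (j : ℝ))) with hy
  have hy0 : 0 < y := Real.rpow_pos_of_pos hq0 _
  set f : ℕ → ℝ := fun d => if d ≤ D then y / m *
    ((q ^ h)⁻¹ * (q ^ (-((a : ℝ) - 1 / 2 + 1 / m))) ^ d) else 0 with hf
  have hf0 : ∀ d, 0 ≤ f d := fun d => by simp only [hf]; split_ifs <;> positivity
  rw [blkArea_eq_sum hq, ← Finset.add_sum_erase _ _ (Finset.mem_univ i),
    sum_own_column i (by omega), area_add_tailArea_of_lt hq h i (by omega), ← hy]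
  have h2 : 2 * ∑ d ∈ Finset.range D, f (d + 1) ≤
      ∑ i' ∈ Finset.univ.erase i, ∑ j' ∈ Finset.range (L + 1),
      if Blocks a h (i, j) (i', j') then area q L i' j' else 0 := by
    calc 2 * ∑ d ∈ Finset.range D, f (d + 1) =
          ∑ d ∈ Finset.range D, f (d + 1) + ∑ d ∈ Finset.range D, f (d + 1) := by ring
      _ ≤ ∑ d ∈ Finset.range i.val, f (d + 1) +
          ∑ d ∈ Finset.range (m - 1 - i.val), f (d + 1) := by
          exact add_le_add
            (Finset.sum_le_sum_of_subset_of_nonneg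
              (Finset.range_subset_range.2 (by omega)) fun _ _ _ => hf0 _)
            (Finset.sum_le_sum_of_subset_of_nonneg
              (Finset.range_subset_range.2 (by omega)) fun _ _ _ => hf0 _)
      _ = ∑ i' : Fin m, (if i' = i then 0 else f (colDist i i')) := (sum_colDist i f).symm
      _ = ∑ i' ∈ Finset.univ.erase i, f (colDist i i') := by
          rw [← Finset.add_sum_erase _ _ (Finset.mem_univ i), if_pos rfl, zero_add]
          exact Finset.sum_congr rfl fun i' hi' => if_neg (Finset.ne_of_mem_erase hi')
      _ ≤ _ := by
          refine Finset.sum_le_sum fun i' hi' => ?_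
          simp only [hf]
          split_ifs with hD
          · have : a * colDist i i' ≤ a * D := Nat.mul_le_mul_left _ hD
            exact le_sum_other_column hq ha h (Finset.ne_of_mem_erase hi') (by omega)
          · refine Finset.sum_nonneg fun j' _ => ?_
            split_ifs
            · exact area_nonneg hq _ _
            · exact le_rfl
  have h3 : ∑ d ∈ Finset.range D, f (d + 1) = ∑ d ∈ Finset.range D, y / m *
      ((q ^ h)⁻¹ * (q ^ (-((a : ℝ) - 1 / 2 + 1 / m))) ^ (d + 1)) := by
    refine Finset.sum_congr rfl fun d hd => ?_
    rw [Finset.mem_range] at hd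
    simp only [hf]
    rw [if_pos (by omega)]
  calc _ = y / m * (1 - q⁻¹ + (q ^ (h + 1))⁻¹) + 2 * ∑ d ∈ Finset.range D, f (d + 1) := by
        rw [h3, blkConst, ← Finset.mul_sum, ← Finset.mul_sum]; ring
    _ ≤ _ := by gcongr

theorem area_le_blkArea (hq : 1 < q) (a h : ℕ) (i : Fin m) {j : ℕ} (hj : j ≤ L) :
    area q L i j ≤ blkArea q L a h (i, j) := by
  classical
  rw [blkArea_eq_sum hq, ← Finset.add_sum_erase _ _ (Finset.mem_univ i), sum_own_column i hj]
  have h1 := tailArea_nonneg (L := L) hq i (j + h + 1)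
  have h2 : 0 ≤ ∑ i' ∈ Finset.univ.erase i, ∑ j' ∈ Finset.range (L + 1),
      if Blocks a h (i, j) (i', j') then area q L i' j' else 0 := by
    refine Finset.sum_nonneg fun i' _ => Finset.sum_nonneg fun j' _ => ?_
    split_ifs
    · exact area_nonneg hq _ _
    · exact le_rfl
  linarith

end BlkArea

/-! ### Smoothing: Riemann sums over the sawtooth offsets -/

section Riemann

variable {q : ℝ}

/-- A primitive of `x ↦ q ^ (-x) * exp (-κ * q ^ (-x))`. -/
def gumbel (q κ x : ℝ) : ℝ := Real.exp (-(κ * q ^ (-x))) / (κ * Real.log q)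

theorem hasDerivAt_gumbel (hq : 1 < q) {κ : ℝ} (hκ : 0 < κ) (x : ℝ) :
    HasDerivAt (gumbel q κ) (q ^ (-x) * Real.exp (-(κ * q ^ (-x)))) x := by
  have hl : 0 < Real.log q := Real.log_pos hq
  have h1 : HasDerivAt (fun x : ℝ => q ^ (-x)) (Real.log q * (-1) * q ^ (-x)) x :=
    (hasDerivAt_neg x).const_rpow (by linarith)
  have h2 := ((h1.const_mul κ).neg.exp).div_const (κ * Real.log q)
  refine h2.congr_deriv ?_
  simp only [Pi.neg_apply]
  field_simp

theorem gumbel_sub (hq : 1 < q) {κ η y : ℝ} (hκ : 0 < κ) (hη : 0 < η) :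
    ∃ ξ, y - η < ξ ∧ ξ < y ∧ gumbel q κ y - gumbel q κ (y - η) =
      η * (q ^ (-ξ) * Real.exp (-(κ * q ^ (-ξ)))) := by
  obtain ⟨ξ, hξ, he⟩ := exists_hasDerivAt_eq_slope (gumbel q κ)
    (fun x => q ^ (-x) * Real.exp (-(κ * q ^ (-x)))) (show y - η < y by linarith)
    (fun x _ => (hasDerivAt_gumbel hq hκ x).continuousAt.continuousWithinAt)
    (fun x _ => hasDerivAt_gumbel hq hκ x)
  refine ⟨ξ, hξ.1, hξ.2, ?_⟩
  rw [he, sub_sub_cancel, mul_div_cancel₀ _ hη.ne']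

/-- The integrand is not monotone. But `q ^ (-x)` changes by a factor at most `q ^ η` over the
interval, and this is absorbed separately into the prefactor and into `κ`, at any intermediate
point. -/
theorem riemann_term_le (hq : 1 < q) {κ η x y : ℝ} (hκ : 0 < κ) (hη : 0 < η) (h1 : y - η ≤ x)
    (h2 : x ≤ y) : η * (q ^ (-x) * Real.exp (-(κ * q ^ (-x)))) ≤
      q ^ η * (gumbel q (κ * q ^ (-η)) y - gumbel q (κ * q ^ (-η)) (y - η)) := by
  have hq0 : 0 < q := by linarith
  obtain ⟨ξ, k1, k2, he⟩ := gumbel_sub hq (y := y)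
    (mul_pos hκ (Real.rpow_pos_of_pos hq0 (-η))) hη
  rw [he]
  have e1 : q ^ (-x) ≤ q ^ η * q ^ (-ξ) := by
    rw [← Real.rpow_add hq0]
    exact Real.rpow_le_rpow_of_exponent_le hq.le (by linarith)
  have e2 : q ^ (-η) * q ^ (-ξ) ≤ q ^ (-x) := by
    rw [← Real.rpow_add hq0]
    exact Real.rpow_le_rpow_of_exponent_le hq.le (by linarith)
  calc η * (q ^ (-x) * Real.exp (-(κ * q ^ (-x))))
      ≤ η * (q ^ η * q ^ (-ξ) * Real.exp (-(κ * (q ^ (-η) * q ^ (-ξ))))) := by gcongr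
    _ = _ := by rw [← mul_assoc κ]; ring

theorem le_riemann_term (hq : 1 < q) {κ η x y : ℝ} (hκ : 0 < κ) (hη : 0 < η) (h1 : y - η ≤ x)
    (h2 : x ≤ y) : q ^ (-η) * (gumbel q (κ * q ^ η) y - gumbel q (κ * q ^ η) (y - η)) ≤
      η * (q ^ (-x) * Real.exp (-(κ * q ^ (-x)))) := by
  have hq0 : 0 < q := by linarith
  obtain ⟨ξ, k1, k2, he⟩ := gumbel_sub hq (y := y)
    (mul_pos hκ (Real.rpow_pos_of_pos hq0 η)) hη
  rw [he]
  have e1 : q ^ (-x) ≤ q ^ η * q ^ (-ξ) := by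
    rw [← Real.rpow_add hq0]
    exact Real.rpow_le_rpow_of_exponent_le hq.le (by linarith)
  have e2 : q ^ (-η) * q ^ (-ξ) ≤ q ^ (-x) := by
    rw [← Real.rpow_add hq0]
    exact Real.rpow_le_rpow_of_exponent_le hq.le (by linarith)
  calc q ^ (-η) * (η * (q ^ (-ξ) * Real.exp (-(κ * q ^ η * q ^ (-ξ)))))
      = η * (q ^ (-η) * q ^ (-ξ) * Real.exp (-(κ * (q ^ η * q ^ (-ξ))))) := by
        rw [← mul_assoc κ]; ring
    _ ≤ η * (q ^ (-x) * Real.exp (-(κ * q ^ (-x)))) := by gcongr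

theorem gumbel_nonneg (hq : 1 < q) {κ : ℝ} (hκ : 0 < κ) (x : ℝ) : 0 ≤ gumbel q κ x := by
  have := Real.log_pos hq
  unfold gumbel; positivity

theorem gumbel_le (hq : 1 < q) {κ : ℝ} (hκ : 0 < κ) (x : ℝ) :
    gumbel q κ x ≤ 1 / (κ * Real.log q) := by
  have := Real.log_pos hq
  have h2 : 0 < q ^ (-x) := Real.rpow_pos_of_pos (by linarith) _
  unfold gumbel
  gcongr
  exact Real.exp_le_one_iff.2 (by have := mul_pos hκ h2; linarith)

theorem sum_Ico_telescope (f : ℕ → ℝ) {j₁ j₂ : ℕ} (h : j₁ ≤ j₂) :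
    ∑ j ∈ Finset.Ico j₁ j₂, (f (j + 1) - f j) = f j₂ - f j₁ := by
  rw [Finset.sum_Ico_eq_sum_range]
  have := Finset.sum_range_sub (fun k => f (j₁ + k)) (j₂ - j₁)
  simp only [← add_assoc] at this
  rw [this, Nat.add_sub_cancel' h, add_zero]

/-- A single column. -/
theorem sum_column_le (hq : 1 < q) {κ : ℝ} (hκ : 0 < κ) (r : ℝ) (n : ℕ) :
    ∑ j ∈ Finset.range n, q ^ (-(r + (j : ℝ))) * Real.exp (-(κ * q ^ (-(r + (j : ℝ))))) ≤
      q ^ 2 / (κ * Real.log q) := by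
  have hq0 : 0 < q := by linarith
  have hl := Real.log_pos hq
  have hκ' : 0 < κ * q ^ (-(1 : ℝ)) := by positivity
  calc _ ≤ ∑ j ∈ Finset.range n, q ^ (1 : ℝ) * (gumbel q (κ * q ^ (-(1 : ℝ))) (r + ((j + 1 : ℕ) : ℝ) - 1) -
        gumbel q (κ * q ^ (-(1 : ℝ))) (r + (j : ℝ) - 1)) := by
        refine Finset.sum_le_sum fun j _ => ?_
        have := riemann_term_le hq hκ one_pos (x := r + (j : ℝ)) (y := r + (j : ℝ))
          (by linarith) le_rfl
        rw [one_mul] at this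
        refine this.trans (le_of_eq ?_)
        congr 3
        push_cast; ring
    _ = q ^ (1 : ℝ) * (gumbel q (κ * q ^ (-(1 : ℝ))) (r + (n : ℝ) - 1) -
        gumbel q (κ * q ^ (-(1 : ℝ))) (r + ((0 : ℕ) : ℝ) - 1)) := by
        rw [← Finset.mul_sum,
          Finset.sum_range_sub (fun j : ℕ => gumbel q (κ * q ^ (-(1 : ℝ))) (r + (j : ℝ) - 1))]
    _ ≤ q ^ (1 : ℝ) * (1 / (κ * q ^ (-(1 : ℝ)) * Real.log q) - 0) := by
        gcongr
        · exact gumbel_le hq hκ' _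
        · exact gumbel_nonneg hq hκ' _
    _ = _ := by
        rw [Real.rpow_neg_one, Real.rpow_one]; field_simp; ring

variable {m : ℕ} [NeZero m]

/-- The rank of the offset of a column. -/
def rank (i : Fin m) : ℕ := if i.val % 2 = 0 then i.val / 2 else (m + 1) / 2 + i.val / 2

theorem rank_lt (i : Fin m) : rank i < m := by
  have := i.isLt
  unfold rank; split_ifs <;> omega

theorem rank_injective {i i' : Fin m} (h : rank i = rank i') : i = i' := by
  have := i.isLt
  have := i'.isLt
  unfold rank at h
  apply Fin.ext
  split_ifs at h <;> omega

theorem sum_rank (f : ℕ → ℝ) : ∑ i : Fin m, f (rank i) = ∑ s ∈ Finset.range m, f s := by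
  rw [← Fin.sum_univ_eq_sum_range]
  have hb : Function.Bijective (fun i : Fin m => (⟨rank i, rank_lt i⟩ : Fin m)) :=
    Finite.injective_iff_bijective.1 fun i i' h => rank_injective (by simpa using h)
  exact hb.sum_comp (fun s : Fin m => f s)

/-- For even `m` the offset is exactly `rank i / m`; for odd `m` the odd columns lie half a grid
step below it. Either way each grid interval receives exactly one column. -/
theorem smoothing_mem (i : Fin m) :
    (rank i : ℝ) / m - 1 / m ≤ smoothing i ∧ smoothing i ≤ (rank i : ℝ) / m := by
  have hm : (0 : ℝ) < m := by exact_mod_cast NeZero.pos m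
  have hs : 2 * ((shift i : ℚ) : ℝ) = ((i.val % 2 : ℕ) : ℝ) := by
    exact_mod_cast congrArg (fun x : ℚ => (x : ℝ)) (two_mul_shift i)
  have e : smoothing i = (((i.val / 2 : ℕ) : ℝ) + shift i * m) / m := by
    unfold smoothing; field_simp
  rw [e, ← sub_div, div_le_div_iff_of_pos_right hm, div_le_div_iff_of_pos_right hm]
  unfold rank
  split_ifs with h
  · rw [h] at hs
    have : ((shift i : ℚ) : ℝ) = 0 := by push_cast at hs; linarith
    rw [this]; constructor <;> linarith
  · have h1 : i.val % 2 = 1 := by omega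
    rw [h1] at hs
    have : ((shift i : ℚ) : ℝ) = 1 / 2 := by push_cast at hs; linarith
    rw [this]
    have h2 : (m : ℝ) ≤ 2 * ((m + 1) / 2 : ℕ) := by
      have : m ≤ 2 * ((m + 1) / 2) := by omega
      exact_mod_cast this
    have h3 : 2 * (((m + 1) / 2 : ℕ) : ℝ) ≤ m + 1 := by
      have : 2 * ((m + 1) / 2) ≤ m + 1 := by omega
      exact_mod_cast this
    push_cast at h2 h3 ⊢
    constructor <;> linarith

/-- Levels and ranks together tile the interval from `j₁ - 1 / m` to `j₂ - 1 / m`, so the sum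
telescopes twice. -/
theorem sum_gumbel_sub (κ : ℝ) {j₁ j₂ : ℕ} (hj : j₁ ≤ j₂) :
    ∑ j ∈ Finset.Ico j₁ j₂, ∑ i : Fin m, (gumbel q κ ((j : ℝ) + (rank i : ℝ) / m) -
      gumbel q κ ((j : ℝ) + (rank i : ℝ) / m - 1 / m)) =
      gumbel q κ ((j₂ : ℝ) - 1 / m) - gumbel q κ ((j₁ : ℝ) - 1 / m) := by
  have hm : (0 : ℝ) < m := by exact_mod_cast NeZero.pos m
  rw [← sum_Ico_telescope (fun j : ℕ => gumbel q κ ((j : ℝ) - 1 / m)) hj]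
  refine Finset.sum_congr rfl fun j _ => ?_
  rw [sum_rank (fun s => gumbel q κ ((j : ℝ) + (s : ℝ) / m) -
      gumbel q κ ((j : ℝ) + (s : ℝ) / m - 1 / m))]
  have := Finset.sum_range_sub (fun s : ℕ => gumbel q κ ((j : ℝ) + (s : ℝ) / m - 1 / m)) m
  have e : ∀ s : ℕ, (j : ℝ) + ((s + 1 : ℕ) : ℝ) / m - 1 / m = (j : ℝ) + (s : ℝ) / m := by
    intro s; push_cast; ring
  simp only [e] at this
  rw [this]
  congr 2
  · push_cast; field_simp
  · simp

theorem riemann_sum_le (hq : 1 < q) {κ : ℝ} (hκ : 0 < κ) (n : ℕ) :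
    ∑ i : Fin m, ∑ j ∈ Finset.range n, 1 / (m : ℝ) * (q ^ (-(smoothing i + (j : ℝ))) *
      Real.exp (-(κ * q ^ (-(smoothing i + (j : ℝ)))))) ≤
      q ^ (2 / (m : ℝ)) / (κ * Real.log q) := by
  have hm : (0 : ℝ) < m := by exact_mod_cast NeZero.pos m
  have hq0 : 0 < q := by linarith
  have hl := Real.log_pos hq
  have hκ' : 0 < κ * q ^ (-(1 / (m : ℝ))) := by positivity
  rw [Finset.sum_comm, Finset.range_eq_Ico]
  calc _ ≤ ∑ j ∈ Finset.Ico 0 n, ∑ i : Fin m, q ^ (1 / (m : ℝ)) *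
        (gumbel q (κ * q ^ (-(1 / (m : ℝ)))) ((j : ℝ) + (rank i : ℝ) / m) -
          gumbel q (κ * q ^ (-(1 / (m : ℝ)))) ((j : ℝ) + (rank i : ℝ) / m - 1 / m)) := by
        refine Finset.sum_le_sum fun j _ => Finset.sum_le_sum fun i _ => ?_
        have := smoothing_mem i
        exact riemann_term_le hq hκ (by positivity) (by linarith) (by linarith)
    _ = q ^ (1 / (m : ℝ)) * (gumbel q (κ * q ^ (-(1 / (m : ℝ)))) ((n : ℝ) - 1 / m) -
          gumbel q (κ * q ^ (-(1 / (m : ℝ)))) (((0 : ℕ) : ℝ) - 1 / m)) := by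
        simp only [← Finset.mul_sum]
        rw [sum_gumbel_sub _ (Nat.zero_le n)]
    _ ≤ q ^ (1 / (m : ℝ)) * (1 / (κ * q ^ (-(1 / (m : ℝ))) * Real.log q) - 0) := by
        gcongr
        · exact gumbel_le hq hκ' _
        · exact gumbel_nonneg hq hκ' _
    _ = _ := by
        have e : q ^ (2 / (m : ℝ)) = q ^ (1 / (m : ℝ)) * q ^ (1 / (m : ℝ)) := by
          rw [← Real.rpow_add hq0]; congr 1; ring
        rw [e, Real.rpow_neg hq0.le]
        field_simp
        ring

theorem le_riemann_sum (hq : 1 < q) {κ : ℝ} (hκ : 0 < κ) {j₁ j₂ : ℕ} (hj : j₁ ≤ j₂) :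
    q ^ (-(1 / (m : ℝ))) * (gumbel q (κ * q ^ (1 / (m : ℝ))) ((j₂ : ℝ) - 1 / m) -
      gumbel q (κ * q ^ (1 / (m : ℝ))) ((j₁ : ℝ) - 1 / m)) ≤
    ∑ i : Fin m, ∑ j ∈ Finset.Ico j₁ j₂, 1 / (m : ℝ) * (q ^ (-(smoothing i + (j : ℝ))) *
      Real.exp (-(κ * q ^ (-(smoothing i + (j : ℝ)))))) := by
  have hm : (0 : ℝ) < m := by exact_mod_cast NeZero.pos m
  rw [Finset.sum_comm, ← sum_gumbel_sub _ hj, Finset.mul_sum]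
  refine Finset.sum_le_sum fun j _ => ?_
  rw [Finset.mul_sum]
  refine Finset.sum_le_sum fun i _ => ?_
  have := smoothing_mem i
  exact le_riemann_term hq hκ (by positivity) (by linarith) (by linarith)

end Riemann

/-! ### The expected free area -/

section MeanArea

variable {q : ℝ} {m L : ℕ} [NeZero m]

theorem blkConst_pos (hq : 1 < q) (a h : ℕ) (η : ℝ) (D : ℕ) : 0 < blkConst q a h η D := by
  have h1 := one_sub_inv_pos hq
  have hq0 : 0 < q := by linarith
  have h2 : 0 ≤ ∑ d ∈ Finset.range D, (q ^ (-((a : ℝ) - 1 / 2 + η))) ^ (d + 1) :=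
    Finset.sum_nonneg fun d _ => by positivity
  unfold blkConst
  positivity

theorem one_sub_pow_le_exp {b : ℝ} (hb : b ≤ 1) (k : ℕ) : (1 - b) ^ k ≤ Real.exp (-(k * b)) := by
  have h1 := Real.one_sub_le_exp_neg b
  calc (1 - b) ^ k ≤ (Real.exp (-b)) ^ k := pow_le_pow_left₀ (by linarith) h1 k
    _ = _ := by rw [← Real.exp_nat_mul]; congr 1; ring

/-- It comes down to `(1 - b) * (1 + b + 2 * b ^ 2) = 1 + b ^ 2 * (1 - 2 * b) ≥ 1`. -/
theorem exp_le_one_sub_pow {b : ℝ} (_ : 0 ≤ b) (hb : b ≤ 1 / 2) (k : ℕ) :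
    Real.exp (-(k * (b * (1 + 2 * b)))) ≤ (1 - b) ^ k := by
  have h1 : Real.exp (-(b * (1 + 2 * b))) ≤ 1 - b := by
    have h2 := Real.add_one_le_exp (b * (1 + 2 * b))
    rw [Real.exp_neg]
    have h3 : (0 : ℝ) < 1 - b := by linarith
    rw [inv_le_comm₀ (Real.exp_pos _) h3]
    refine le_trans ?_ h2
    rw [inv_eq_one_div, div_le_iff₀ h3]
    nlinarith [mul_nonneg (sq_nonneg b) (show (0 : ℝ) ≤ 1 - 2 * b by linarith)]
  calc Real.exp (-(k * (b * (1 + 2 * b)))) = (Real.exp (-(b * (1 + 2 * b)))) ^ k := by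
        rw [← Real.exp_nat_mul]; congr 1; ring
    _ ≤ _ := pow_le_pow_left₀ (Real.exp_pos _).le h1 k

/-- Upper bound for the expected free area; all error terms vanish as `m → ∞`. -/
theorem mean_freeArea_le (hq : 1 < q) {a : ℕ} (ha : 1 ≤ a) (h D : ℕ) {k : ℕ} (hk : 0 < k)
    (hkL : (k : ℝ) ≤ q ^ L) :
    ∑ i : Fin m, ∑ j ∈ Finset.range (L + 1), area q L i j * (1 - blkArea q L a h (i, j)) ^ k ≤
      (m : ℝ) / k * ((1 - q⁻¹) * q ^ (2 / (m : ℝ)) / (blkConst q a h (1 / m) D * Real.log q) +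
        2 * D * q ^ 2 / Real.log q / m + (h + 1 + a * D : ℕ) * q ^ (h + 1 + a * D) / m) := by
  classical
  have hm : (0 : ℝ) < m := by exact_mod_cast NeZero.pos m
  have hk' : (0 : ℝ) < k := by exact_mod_cast hk
  have hq0 : 0 < q := by linarith
  have hβ := one_sub_inv_pos hq
  have hl := Real.log_pos hq
  have hK := blkConst_pos hq a h (1 / m) D
  set β := 1 - q⁻¹ with hβd
  set K := blkConst q a h (1 / m) D with hKd
  set H := h + 1 + a * D with hH
  set w : Fin m → ℕ → ℝ := fun i j => q ^ (-(smoothing i + (j : ℝ))) with hw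
  have hw0 : ∀ i j, 0 < w i j := fun i j => Real.rpow_pos_of_pos hq0 _
  -- The three terms serve the bulk, the `D` columns at each border, where a cell is only known to
  -- block itself, and the last `H` levels, where the area alone is used.
  have hterm : ∀ i : Fin m, ∀ j ∈ Finset.range (L + 1),
      area q L i j * (1 - blkArea q L a h (i, j)) ^ k ≤
      β * (1 / m * (w i j * Real.exp (-(k / m * K * w i j)))) +
      (if i.val < D ∨ m ≤ i.val + D then β / m * (w i j * Real.exp (-(k / m * β * w i j))) else 0) +
      (if L < j + H then (q ^ j)⁻¹ / m else 0) := by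
    intro i j hj
    have hjL : j ≤ L := by rw [Finset.mem_range] at hj; omega
    have t1 : 0 ≤ β * (1 / m * (w i j * Real.exp (-(k / m * K * w i j)))) := by
      have := hw0 i j; positivity
    have t2 : 0 ≤ if i.val < D ∨ m ≤ i.val + D then
        β / m * (w i j * Real.exp (-(k / m * β * w i j))) else 0 := by
      have := hw0 i j; split_ifs <;> positivity
    have t3 : 0 ≤ if L < j + H then (q ^ j)⁻¹ / m else 0 := by split_ifs <;> positivity
    have hb1 := blkArea_le_one (L := L) hq a h (i, j)
    have hb0 := blkArea_nonneg (q := q) (L := L) a h (i, j)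
    have ha0 := area_nonneg (L := L) hq i j
    by_cases h3 : L < j + H
    · rw [if_pos h3]
      have h4 : (1 - blkArea q L a h (i, j)) ^ k ≤ 1 := pow_le_one₀ (by linarith) (by linarith)
      have h5 := area_le (L := L) hq i j
      have h6 := mul_le_of_le_one_right ha0 h4
      linarith
    · rw [if_neg h3]
      have hlt : j < L := by omega
      by_cases h4 : i.val < D ∨ m ≤ i.val + D
      · rw [if_pos h4]
        have h5 := area_le_blkArea hq a h i hjL
        have h6 := one_sub_pow_le_exp hb1 k
        have h7 : Real.exp (-(k * blkArea q L a h (i, j))) ≤ Real.exp (-(k / m * β * w i j)) := by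
          apply Real.exp_le_exp.2
          rw [area_eq_of_lt hq i hlt] at h5
          have e : (k : ℝ) / m * β * w i j = k * (β * w i j / m) := by ring
          rw [e]
          have := mul_le_mul_of_nonneg_left h5 hk'.le
          linarith
        have h8 := mul_le_mul_of_nonneg_left (h6.trans h7) ha0
        have e : area q L i j * Real.exp (-(k / m * β * w i j)) =
            β / m * (w i j * Real.exp (-(k / m * β * w i j))) := by
          rw [area_eq_of_lt hq i hlt]; ring
        linarith
      · rw [if_neg h4]
        push Not at h4
        have h5 := le_blkArea (L := L) hq ha h D (i := i) (j := j) (by omega) h4.1 h4.2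
        have h6 := one_sub_pow_le_exp hb1 k
        have h7 : Real.exp (-(k * blkArea q L a h (i, j))) ≤ Real.exp (-(k / m * K * w i j)) := by
          apply Real.exp_le_exp.2
          have e : (k : ℝ) / m * K * w i j = k * (w i j / m * K) := by ring
          rw [e]
          have := mul_le_mul_of_nonneg_left h5 hk'.le
          linarith
        have h8 := mul_le_mul_of_nonneg_left (h6.trans h7) ha0
        have e : area q L i j * Real.exp (-(k / m * K * w i j)) =
            β * (1 / m * (w i j * Real.exp (-(k / m * K * w i j)))) := by
          rw [area_eq_of_lt hq i hlt]; ring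
        linarith
  have s1 : ∑ i : Fin m, ∑ j ∈ Finset.range (L + 1),
      β * (1 / m * (w i j * Real.exp (-(k / m * K * w i j)))) ≤
      (m : ℝ) / k * (β * q ^ (2 / (m : ℝ)) / (K * Real.log q)) := by
    have e : ∑ i : Fin m, ∑ j ∈ Finset.range (L + 1),
        β * (1 / m * (w i j * Real.exp (-(k / m * K * w i j)))) =
        β * ∑ i : Fin m, ∑ j ∈ Finset.range (L + 1),
          1 / (m : ℝ) * (w i j * Real.exp (-(k / m * K * w i j))) := by
      simp only [Finset.mul_sum]
    rw [e]
    have := riemann_sum_le (m := m) hq (κ := k / m * K) (by positivity) (L + 1)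
    calc _ ≤ β * (q ^ (2 / (m : ℝ)) / (k / m * K * Real.log q)) := by gcongr
      _ = _ := by field_simp
  -- One column contributes at most the order of `1 / k`, a fraction `1 / m` of the main term, and
  -- at most `2 * D` columns are concerned.
  have s2 : ∑ i : Fin m, ∑ j ∈ Finset.range (L + 1),
      (if i.val < D ∨ m ≤ i.val + D then β / m * (w i j * Real.exp (-(k / m * β * w i j))) else 0) ≤
      (m : ℝ) / k * (2 * D * q ^ 2 / Real.log q / m) := by
    have hcol : ∀ i : Fin m, ∑ j ∈ Finset.range (L + 1),
        (if i.val < D ∨ m ≤ i.val + D then β / m * (w i j * Real.exp (-(k / m * β * w i j))) else 0) ≤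
        if i.val < D ∨ m ≤ i.val + D then q ^ 2 / (k * Real.log q) else 0 := by
      intro i
      split_ifs
      · rw [← Finset.mul_sum]
        have := sum_column_le hq (κ := k / m * β) (by positivity) (smoothing i) (L + 1)
        calc _ ≤ β / m * (q ^ 2 / (k / m * β * Real.log q)) := by gcongr
          _ = _ := by field_simp
      · simp
    have hcard : ((Finset.univ.filter fun i : Fin m => i.val < D ∨ m ≤ i.val + D).card : ℝ) ≤
        2 * D := by
      have : (Finset.univ.filter fun i : Fin m => i.val < D ∨ m ≤ i.val + D).card ≤ 2 * D := by
        calc _ ≤ (Finset.range D ∪ Finset.Ico (m - D) m).card := by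
              refine Finset.card_le_card_of_injOn (fun i => i.val) ?_
                (fun x _ y _ hxy => Fin.ext hxy)
              intro i hi
              simp only [Finset.coe_filter, Finset.mem_univ, true_and, Set.mem_ofPred_eq] at hi
              simp only [Finset.coe_union, Finset.coe_range, Finset.coe_Ico, Set.mem_union,
                Set.mem_Iio, Set.mem_Ico]
              have := i.isLt
              omega
          _ ≤ D + (m - (m - D)) := by
              refine (Finset.card_union_le _ _).trans ?_
              rw [Finset.card_range, Nat.card_Ico]
          _ ≤ _ := by omega
      exact_mod_cast this
    calc _ ≤ ∑ i : Fin m, (if i.val < D ∨ m ≤ i.val + D then q ^ 2 / (k * Real.log q) else 0) :=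
          Finset.sum_le_sum fun i _ => hcol i
      _ = (Finset.univ.filter fun i : Fin m => i.val < D ∨ m ≤ i.val + D).card *
          (q ^ 2 / (k * Real.log q)) := by
          rw [← Finset.sum_filter, Finset.sum_const, nsmul_eq_mul]
      _ ≤ 2 * D * (q ^ 2 / (k * Real.log q)) := by gcongr
      _ = _ := by field_simp
  -- On the last levels `q ^ (-j) ≤ q ^ H / k`, because `k ≤ q ^ L`.
  have s3 : ∑ i : Fin m, ∑ j ∈ Finset.range (L + 1), (if L < j + H then (q ^ j)⁻¹ / m else 0) ≤
      (m : ℝ) / k * (H * q ^ H / m) := by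
    rw [Finset.sum_const, Finset.card_univ, Fintype.card_fin, nsmul_eq_mul]
    have hcard : (((Finset.range (L + 1)).filter fun j => L < j + H).card : ℝ) ≤ H := by
      have : ((Finset.range (L + 1)).filter fun j => L < j + H).card ≤ H := by
        calc _ ≤ (Finset.Ico (L + 1 - H) (L + 1)).card := by
              refine Finset.card_le_card fun j hj => ?_
              simp only [Finset.mem_filter, Finset.mem_range] at hj
              rw [Finset.mem_Ico]; omega
          _ ≤ _ := by rw [Nat.card_Ico]; omega
      exact_mod_cast this
    calc _ ≤ (m : ℝ) * (((Finset.range (L + 1)).filter fun j => L < j + H).card *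
          (q ^ H / k / m)) := by
          rw [← Finset.sum_filter, ← nsmul_eq_mul (Finset.card _), ← Finset.sum_const]
          gcongr with j hj
          rw [Finset.mem_filter] at hj
          rw [inv_eq_one_div, div_le_div_iff₀ (by positivity) hk', one_mul]
          calc (k : ℝ) ≤ q ^ L := hkL
            _ ≤ q ^ (H + j) := pow_le_pow_right₀ hq.le (by omega)
            _ = _ := pow_add _ _ _
      _ ≤ (m : ℝ) * (H * (q ^ H / k / m)) := by gcongr
      _ = _ := by field_simp
  calc _ ≤ ∑ i : Fin m, ∑ j ∈ Finset.range (L + 1),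
      (β * (1 / m * (w i j * Real.exp (-(k / m * K * w i j)))) +
      (if i.val < D ∨ m ≤ i.val + D then β / m * (w i j * Real.exp (-(k / m * β * w i j))) else 0) +
      (if L < j + H then (q ^ j)⁻¹ / m else 0)) :=
        Finset.sum_le_sum fun i _ => Finset.sum_le_sum fun j hj => hterm i j hj
    _ ≤ _ := by
        simp only [Finset.sum_add_distrib]
        rw [mul_add, mul_add]
        exact add_le_add (add_le_add s1 s2) s3

/-- Lower bound for the expected free area of small cells. -/
theorem le_mean_partArea (hq : 1 < q) {a : ℕ} (ha : 1 ≤ a) (h : ℕ) {k j₁ : ℕ} {M Kup : ℝ}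
    (hKup : blkConst q a h (-(1 / m)) m ≤ Kup) (hmk : m ≤ k)
    (hkL : (k : ℝ) ≤ q ^ L) (hj : j₁ ≤ L) (hM : 0 < M) (hj1 : (k : ℝ) / m ≤ M * q ^ j₁)
    (hj2 : q ^ j₁ * M ≤ q * (k / m)) (hsmall : Kup * M / m ≤ 1 / 2)
    {A : ℝ} (hA : A = Kup * (1 + 2 * (Kup * M / m)) * q ^ (1 / (m : ℝ))) :
    (m : ℝ) / k * ((1 - q⁻¹) * q ^ (-(1 / (m : ℝ))) * (Real.exp (-(A * q ^ (1 / (m : ℝ)) / m)) -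
      Real.exp (-(A * M / q))) / (A * Real.log q)) ≤
    ∑ c ∈ (Finset.univ : Finset (Fin m)) ×ˢ Finset.Ico j₁ L,
        area q L c.1 c.2 * (1 - blkArea q L a h c) ^ k := by
  have hm : (0 : ℝ) < m := by exact_mod_cast NeZero.pos m
  have hmk' : (m : ℝ) ≤ k := by exact_mod_cast hmk
  have hk' : (0 : ℝ) < k := by linarith
  have hq0 : 0 < q := by linarith
  have hβ := one_sub_inv_pos hq
  have hl := Real.log_pos hq
  have hK : 0 < Kup := (blkConst_pos hq a h _ _).trans_le hKup
  set β := 1 - q⁻¹ with hβd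
  set δ := Kup * M / m with hδ
  have hδ0 : 0 < δ := by positivity
  set κ := (k : ℝ) / m * (Kup * (1 + 2 * δ)) with hκ
  have hκ0 : 0 < κ := by positivity
  have hA0 : 0 < A := by rw [hA]; positivity
  have hκA : κ * q ^ (1 / (m : ℝ)) = k / m * A := by rw [hκ, hA]; ring
  have hterm : ∀ i : Fin m, ∀ j ∈ Finset.Ico j₁ L,
      β * (1 / (m : ℝ) * (q ^ (-(smoothing i + (j : ℝ))) *
        Real.exp (-(κ * q ^ (-(smoothing i + (j : ℝ))))))) ≤
      area q L i j * (1 - blkArea q L a h (i, j)) ^ k := by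
    intro i j hjm
    rw [Finset.mem_Ico] at hjm
    set y := q ^ (-(smoothing i + (j : ℝ))) with hy
    have hy0 : 0 < y := Real.rpow_pos_of_pos hq0 _
    have hb : blkArea q L a h (i, j) ≤ y / m * Kup :=
      (blkArea_le hq ha h i hjm.2).trans (by gcongr)
    have hb0 := blkArea_nonneg (q := q) (L := L) a h (i, j)
    set b := blkArea q L a h (i, j)
    have hyj : y ≤ (q ^ j₁)⁻¹ := by
      rw [hy, rpow_neg_smoothing_add hq]
      have h1 := rpow_neg_smoothing_le hq i
      have h2 : (q ^ j)⁻¹ ≤ (q ^ j₁)⁻¹ :=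
        inv_anti₀ (by positivity) (pow_le_pow_right₀ hq.le hjm.1)
      have h3 : 0 < (q ^ j)⁻¹ := by positivity
      nlinarith
    -- `hj1` gives `y ≤ M * m / k`, which is at most `M` as `m ≤ k`. So every blocking area here is
    -- at most `δ`, and replacing `1 - b` by an exponential costs a factor at most `1 + 2 * δ` in
    -- the exponent.
    have hyM : y ≤ M := by
      refine hyj.trans ?_
      rw [inv_eq_one_div, div_le_iff₀ (by positivity)]
      refine le_trans ?_ hj1
      rwa [le_div_iff₀ hm, one_mul]
    have hbδ : b ≤ δ := by
      refine hb.trans ?_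
      rw [hδ, div_mul_eq_mul_div]
      exact div_le_div_of_nonneg_right (by nlinarith) hm.le
    have h1 := exp_le_one_sub_pow hb0 (hbδ.trans hsmall) k
    rw [area_eq_of_lt hq i hjm.2, ← hy]
    have h2 : Real.exp (-(κ * y)) ≤ (1 - b) ^ k := by
      refine le_trans (Real.exp_le_exp.2 (neg_le_neg ?_)) h1
      calc (k : ℝ) * (b * (1 + 2 * b)) ≤ k * (y / m * Kup * (1 + 2 * δ)) := by gcongr
        _ = κ * y := by rw [hκ]; ring
    calc β * (1 / (m : ℝ) * (y * Real.exp (-(κ * y)))) = β * y / m * Real.exp (-(κ * y)) := by ring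
      _ ≤ β * y / m * (1 - b) ^ k := by gcongr
  have hR := le_riemann_sum (m := m) hq hκ0 hj
  rw [hκA] at hR
  -- Truncation at level `L` is harmless: `k ≤ q ^ L` leaves an exponent of order `1 / m`.
  have hg2 : Real.exp (-(A * q ^ (1 / (m : ℝ)) / m)) / (k / m * A * Real.log q) ≤
      gumbel q (k / m * A) ((L : ℝ) - 1 / m) := by
    unfold gumbel
    gcongr
    have e : q ^ (-((L : ℝ) - 1 / m)) = q ^ (1 / (m : ℝ)) / q ^ L := by
      rw [neg_sub, Real.rpow_sub hq0, Real.rpow_natCast]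
    rw [e]
    calc (k : ℝ) / m * A * (q ^ (1 / (m : ℝ)) / q ^ L)
        = A * q ^ (1 / (m : ℝ)) / m * (k / q ^ L) := by ring
      _ ≤ A * q ^ (1 / (m : ℝ)) / m * 1 := by
          gcongr
          exact (div_le_one (by positivity)).2 hkL
      _ = _ := mul_one _
  -- By `hj2` the omitted levels below `j₁` carry only a fraction of order `exp (-(A * M / q))`, as
  -- most of their cells are occupied.
  have hg1 : gumbel q (k / m * A) ((j₁ : ℝ) - 1 / m) ≤
      Real.exp (-(A * M / q)) / (k / m * A * Real.log q) := by
    unfold gumbel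
    gcongr
    have e : q ^ (-((j₁ : ℝ) - 1 / m)) = q ^ (1 / (m : ℝ)) / q ^ j₁ := by
      rw [neg_sub, Real.rpow_sub hq0, Real.rpow_natCast]
    rw [e]
    have e2 : 1 ≤ q ^ (1 / (m : ℝ)) := Real.one_le_rpow hq.le (by positivity)
    have e3 : M / q ≤ k / m * (1 / q ^ j₁) := by
      rw [mul_one_div, div_le_div_iff₀ hq0 (by positivity)]
      calc M * q ^ j₁ = q ^ j₁ * M := mul_comm _ _
        _ ≤ q * (k / m) := hj2
        _ = _ := mul_comm _ _
    calc A * M / q = A * (M / q) := by ring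
      _ ≤ A * (k / m * (1 / q ^ j₁)) := by gcongr
      _ = k / m * A * (1 / q ^ j₁) := by ring
      _ ≤ _ := by gcongr
  rw [Finset.sum_product]
  calc _ = β * (q ^ (-(1 / (m : ℝ))) * (Real.exp (-(A * q ^ (1 / (m : ℝ)) / m)) /
        (k / m * A * Real.log q) - Real.exp (-(A * M / q)) / (k / m * A * Real.log q))) := by
        field_simp
    _ ≤ β * ∑ i : Fin m, ∑ j ∈ Finset.Ico j₁ L, 1 / (m : ℝ) * (q ^ (-(smoothing i + (j : ℝ))) *
      Real.exp (-(κ * q ^ (-(smoothing i + (j : ℝ)))))) := by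
        refine mul_le_mul_of_nonneg_left (le_trans ?_ hR) hβ.le
        gcongr
    _ ≤ _ := by
        rw [Finset.mul_sum]
        refine Finset.sum_le_sum fun i _ => ?_
        rw [Finset.mul_sum]
        exact Finset.sum_le_sum fun j hj => hterm i j hj

end MeanArea

/-! ### Limits of the constants -/

section Limits

open Filter Topology

variable {q : ℝ}

/-- The limit of `blkConst` for infinitely many neighbouring columns. -/
def closedConst (q : ℝ) (a h : ℕ) (η : ℝ) : ℝ :=
  1 - q⁻¹ + (q ^ (h + 1))⁻¹ + 2 * ((q ^ h)⁻¹ * (q ^ ((a : ℝ) - 1 / 2 + η) - 1)⁻¹)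

theorem hasSum_geometric_rpow (hq : 1 < q) {α : ℝ} (hα : 0 < α) :
    HasSum (fun d : ℕ => (q ^ (-α)) ^ (d + 1)) (q ^ α - 1)⁻¹ := by
  have hq0 : 0 < q := by linarith
  have h1 : 1 < q ^ α := Real.one_lt_rpow hq hα
  have h2 : q ^ (-α) < 1 := Real.rpow_lt_one_of_one_lt_of_neg hq (by linarith)
  have h3 := (hasSum_geometric_of_lt_one (Real.rpow_pos_of_pos hq0 (-α)).le h2).mul_left (q ^ (-α))
  simp only [← pow_succ'] at h3
  have h4 : q ^ α - 1 ≠ 0 := by linarith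
  have e : q ^ (-α) * (1 - q ^ (-α))⁻¹ = (q ^ α - 1)⁻¹ := by
    rw [Real.rpow_neg hq0.le]
    field_simp
  rwa [e] at h3

theorem blkConst_le_closedConst (hq : 1 < q) {a : ℕ} (h : ℕ) {η : ℝ}
    (hη : 0 < (a : ℝ) - 1 / 2 + η) (D : ℕ) : blkConst q a h η D ≤ closedConst q a h η := by
  have hq0 : 0 < q := by linarith
  have := (hasSum_geometric_rpow hq hη)
  have h1 := sum_le_hasSum (Finset.range D) (fun d _ => by positivity) this
  unfold blkConst closedConst
  gcongr

theorem tendsto_blkConst (hq : 1 < q) {a : ℕ} (ha : 1 ≤ a) (h : ℕ) :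
    Tendsto (fun D => blkConst q a h 0 D) atTop (𝓝 (closedConst q a h 0)) := by
  have ha' : (1 : ℝ) ≤ a := by exact_mod_cast ha
  have := (hasSum_geometric_rpow hq (show 0 < (a : ℝ) - 1 / 2 + 0 by linarith)).tendsto_sum_nat
  exact tendsto_const_nhds.add ((this.const_mul _).const_mul _)

theorem tendsto_rpow_one_div (hq : 1 < q) (x y : ℝ) :
    Tendsto (fun m : ℕ => q ^ (x + y / (m : ℝ))) atTop (𝓝 (q ^ x)) := by
  have h1 : Tendsto (fun m : ℕ => x + y / (m : ℝ)) atTop (𝓝 (x + 0)) :=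
    tendsto_const_nhds.add (tendsto_const_div_atTop_nhds_zero_nat y)
  rw [add_zero] at h1
  exact ((Real.continuous_const_rpow (show q ≠ 0 by linarith)).tendsto x).comp h1

theorem tendsto_rpow_div (hq : 1 < q) (y : ℝ) :
    Tendsto (fun m : ℕ => q ^ (y / (m : ℝ))) atTop (𝓝 1) := by
  have := tendsto_rpow_one_div hq 0 y
  simpa using this

theorem tendsto_blkConst_one_div (hq : 1 < q) (a h D : ℕ) :
    Tendsto (fun m : ℕ => blkConst q a h (1 / (m : ℝ)) D) atTop (𝓝 (blkConst q a h 0 D)) := by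
  refine tendsto_const_nhds.add ((Tendsto.const_mul _ ?_).const_mul _)
  refine tendsto_finsetSum _ fun d _ => Tendsto.pow ?_ _
  have := tendsto_rpow_one_div hq (-((a : ℝ) - 1 / 2 + 0)) (-1)
  refine this.congr fun m => ?_
  congr 1; ring

theorem tendsto_closedConst (hq : 1 < q) {a : ℕ} (ha : 1 ≤ a) (h : ℕ) :
    Tendsto (fun m : ℕ => closedConst q a h (-(1 / (m : ℝ)))) atTop (𝓝 (closedConst q a h 0)) := by
  have ha' : (1 : ℝ) ≤ a := by exact_mod_cast ha
  refine tendsto_const_nhds.add ((Tendsto.const_mul _ (Tendsto.inv₀ (Tendsto.sub_const ?_ _) ?_)).const_mul _)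
  · have := tendsto_rpow_one_div hq ((a : ℝ) - 1 / 2 + 0) (-1)
    refine this.congr fun m => ?_
    congr 1; ring
  · have := Real.one_lt_rpow hq (show 0 < (a : ℝ) - 1 / 2 + 0 by linarith)
    linarith

theorem closedConst_pos (hq : 1 < q) {a : ℕ} (ha : 1 ≤ a) (h : ℕ) : 0 < closedConst q a h 0 := by
  have ha' : (1 : ℝ) ≤ a := by exact_mod_cast ha
  exact (blkConst_pos hq a h 0 0).trans_le (blkConst_le_closedConst hq h (by linarith) 0)

theorem varConst_eq (hq : 1 < q) (a h : ℕ) :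
    varConst q a h = q * Real.log q / (2 * (q - 1)) * closedConst q a h 0 := by
  have hq0 : 0 < q := by linarith
  unfold varConst closedConst
  rw [add_zero]
  congr 1
  rw [div_eq_mul_inv 2, mul_inv, one_div, sub_div, div_self hq0.ne', one_div]
  ring

theorem varConst_pos (hq : 1 < q) {a : ℕ} (ha : 1 ≤ a) (h : ℕ) : 0 < varConst q a h := by
  rw [varConst_eq hq]
  have := closedConst_pos hq ha h
  have := Real.log_pos hq
  have : 0 < q - 1 := by linarith
  have : 0 < q := by linarith
  positivity

/-- The left side is the limit of `k / m` times the expected free area, so the expected inverse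
should be near `2 * C * (k / m)`. -/
theorem inv_two_mul_varConst (hq : 1 < q) {a : ℕ} (ha : 1 ≤ a) (h : ℕ) :
    (1 - q⁻¹) / (closedConst q a h 0 * Real.log q) = (2 * varConst q a h)⁻¹ := by
  rw [varConst_eq hq]
  have h1 := closedConst_pos hq ha h
  have h2 := Real.log_pos hq
  have h3 : 0 < q - 1 := by linarith
  have h4 : 0 < q := by linarith
  field_simp

theorem exists_level (hq : 1 < q) {x : ℝ} (hx : 0 < x) :
    x ≤ q ^ ⌈Real.logb q x⌉₊ ∧ q ^ ⌈Real.logb q x⌉₊ ≤ max 1 (q * x) := by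
  have hq0 : 0 < q := by linarith
  constructor
  · rw [← Real.rpow_natCast, ← Real.logb_le_iff_le_rpow hq hx]
    exact Nat.le_ceil _
  · rcases le_or_gt (Real.logb q x) 0 with h | h
    · rw [Nat.ceil_eq_zero.2 h, pow_zero]; exact le_max_left _ _
    · refine le_trans ?_ (le_max_right _ _)
      rw [← Real.rpow_natCast, ← Real.le_logb_iff_rpow_le hq (by positivity),
        Real.logb_mul hq0.ne' hx.ne', Real.logb_self_eq_one hq]
      have := Nat.ceil_lt_add_one h.le
      linarith

theorem le_pow_levels (hq : 1 < q) (U : ℕ) : (U : ℝ) ≤ q ^ levels q U := by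
  rcases Nat.eq_zero_or_pos U with rfl | hU
  · have : 0 < q := by linarith
    simp only [Nat.cast_zero]; positivity
  · exact (exists_level hq (by exact_mod_cast hU)).1

theorem level_le_levels (hq : 1 < q) {x : ℝ} (hx : 0 < x) {U : ℕ} (h : x ≤ U) :
    ⌈Real.logb q x⌉₊ ≤ levels q U :=
  Nat.ceil_mono (Real.logb_le_logb_of_le hq hx h)

theorem levels_le (hq : 1 < q) {U : ℕ} (hU : 0 < U) :
    (levels q U : ℝ) ≤ Real.log U / Real.log q + 1 := by
  have h1 : 0 ≤ Real.logb q U := Real.logb_nonneg hq (by exact_mod_cast hU)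
  exact (Nat.ceil_lt_add_one h1).le

/-- The levels are few compared with the probability that the estimator is inaccurate. -/
theorem eventually_levels_mul_exp_le (hq : 1 < q) {c ε : ℝ} (hc : 0 < c) (hε : 0 < ε) :
    ∀ᶠ m : ℕ in atTop, ∀ U : ℕ, 0 < U → Real.log (Real.log U) ≤ c / 2 * m →
      m * ((levels q U + m) * Real.exp (-(c * m))) ≤ ε := by
  have hl := Real.log_pos hq
  have h0 : ∀ (n : ℕ) (b : ℝ), 0 < b → Tendsto (fun m : ℕ => (m : ℝ) ^ n * Real.exp (-(b * m))) atTop (𝓝 0) := by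
    intro n b hb
    have := (Real.tendsto_pow_mul_exp_neg_atTop_nhds_zero n).comp
      (tendsto_natCast_atTop_atTop (R := ℝ) |>.const_mul_atTop hb)
    have := this.const_mul (b ^ n)⁻¹
    rw [mul_zero] at this
    refine this.congr fun m => ?_
    simp only [Function.comp]
    rw [mul_pow]; field_simp
  have h1 := (h0 1 (c / 2) (by linarith)).const_mul (Real.log q)⁻¹
  have h2 := ((h0 1 c hc).add (h0 2 c hc))
  have h3 := h1.add h2
  simp only [mul_zero, add_zero] at h3
  filter_upwards [h3.eventually_le_const hε] with m hm U hU hlog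
  refine le_trans ?_ hm
  -- Half of the exponential decay pays for the number of levels; the other half still beats every
  -- power of `m`.
  have h5 : Real.log U ≤ Real.exp (c / 2 * m) := by
    rcases le_or_gt (Real.log U) 0 with h | h
    · exact h.trans (Real.exp_pos _).le
    · rwa [← Real.log_le_iff_le_exp h]
  have h6 := levels_le hq hU
  have h7 : Real.exp (c / 2 * m) * Real.exp (-(c * m)) = Real.exp (-(c / 2 * m)) := by
    rw [← Real.exp_add]; congr 1; ring
  calc (m : ℝ) * ((levels q U + m) * Real.exp (-(c * m)))
      ≤ m * ((Real.exp (c / 2 * m) / Real.log q + 1 + m) * Real.exp (-(c * m))) := by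
        gcongr
        exact h6.trans (by gcongr)
    _ = m * ((Real.exp (c / 2 * m) * Real.exp (-(c * m))) / Real.log q) +
        m * ((1 + m) * Real.exp (-(c * m))) := by ring
    _ = _ := by rw [h7]; ring

end Limits

/-! ### Asymptotics of the expected free area -/

section AsymptoticMean

open Filter Topology

variable {q : ℝ}

/-- First `D` is fixed so that the truncated geometric series is accurate; then `m → ∞` removes the
border terms, which grow with `D`. -/
theorem eventually_mean_freeArea_le (hq : 1 < q) {a : ℕ} (ha : 1 ≤ a) (h : ℕ) {ε : ℝ}
    (hε : 0 < ε) : ∀ᶠ m : ℕ in atTop, ∀ [NeZero m] (L U : ℕ) (T : Finset (Fin U)),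
      0 < T.card → (T.card : ℝ) ≤ q ^ L →
      ∫ ω, freeArea q a h T ω ∂(hitsLaw q m L U) ≤
        m / T.card * ((2 * varConst q a h)⁻¹ + ε) := by
  have hl := Real.log_pos hq
  have hK := closedConst_pos hq ha h
  have h1 : Tendsto (fun D => (1 - q⁻¹) / (blkConst q a h 0 D * Real.log q)) atTop
      (𝓝 (2 * varConst q a h)⁻¹) := by
    rw [← inv_two_mul_varConst hq ha h]
    exact tendsto_const_nhds.div ((tendsto_blkConst hq ha h).mul_const _) (by positivity)
  obtain ⟨D, hD⟩ := (h1.eventually_lt_const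
    (show (2 * varConst q a h)⁻¹ < (2 * varConst q a h)⁻¹ + ε by linarith)).exists
  have hKD := blkConst_pos hq a h 0 D
  have h2 : Tendsto (fun m : ℕ => (1 - q⁻¹) * q ^ (2 / (m : ℝ)) /
      (blkConst q a h (1 / m) D * Real.log q) + 2 * D * q ^ 2 / Real.log q / m +
      (h + 1 + a * D : ℕ) * q ^ (h + 1 + a * D) / m) atTop
      (𝓝 ((1 - q⁻¹) * 1 / (blkConst q a h 0 D * Real.log q) + 0 + 0)) := by
    refine Tendsto.add (Tendsto.add (Tendsto.div ?_ ?_ (by positivity)) ?_) ?_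
    · exact (tendsto_rpow_div hq 2).const_mul _
    · exact (tendsto_blkConst_one_div hq a h D).mul_const _
    · exact tendsto_const_div_atTop_nhds_zero_nat _
    · exact tendsto_const_div_atTop_nhds_zero_nat _
  rw [mul_one, add_zero, add_zero] at h2
  filter_upwards [h2.eventually_le_const hD] with m hm _ L U T hT hTL
  rw [integral_freeArea hq ha]
  exact (mean_freeArea_le hq ha h D hT hTL).trans (by gcongr)

/-- First `M` is fixed so large that discarding the levels below `j₁` costs little; then `Kup * M /
m` tends to zero. -/
theorem eventually_le_mean_partArea (hq : 1 < q) {a : ℕ} (ha : 1 ≤ a) (h : ℕ) {ε : ℝ}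
    (hε : 0 < ε) : ∃ M : ℝ, 1 ≤ M ∧ ∀ᶠ m : ℕ in atTop, ∀ [NeZero m] (L U j₁ : ℕ)
      (T : Finset (Fin U)), m ≤ T.card → (T.card : ℝ) ≤ q ^ L → j₁ ≤ L →
      (T.card : ℝ) / m ≤ M * q ^ j₁ → q ^ j₁ * M ≤ q * (T.card / m) →
      m / T.card * ((2 * varConst q a h)⁻¹ - ε) ≤
        ∫ ω, partArea q a h j₁ T ω ∂(hitsLaw q m L U) := by
  have hl := Real.log_pos hq
  have hq0 : 0 < q := by linarith
  have hK := closedConst_pos hq ha h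
  have ha' : (1 : ℝ) ≤ a := by exact_mod_cast ha
  set K := closedConst q a h 0 with hKd
  have h1 : Tendsto (fun M : ℝ => (1 - q⁻¹) * 1 * (1 - Real.exp (-(K * M / q))) /
      (K * Real.log q)) atTop (𝓝 ((1 - q⁻¹) * 1 * (1 - 0) / (K * Real.log q))) := by
    refine (Tendsto.const_mul _ (tendsto_const_nhds.sub ?_)).div_const _
    refine Real.tendsto_exp_neg_atTop_nhds_zero.comp ?_
    exact (tendsto_id.const_mul_atTop hK).atTop_div_const hq0
  rw [mul_one, sub_zero, mul_one, inv_two_mul_varConst hq ha h] at h1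
  obtain ⟨M, hM, hM1⟩ := ((h1.eventually_const_lt
    (show (2 * varConst q a h)⁻¹ - ε < (2 * varConst q a h)⁻¹ by linarith)).and
      (eventually_ge_atTop 1)).exists
  refine ⟨M, hM1, ?_⟩
  have hM0 : 0 < M := by linarith
  set Kup : ℕ → ℝ := fun m => closedConst q a h (-(1 / (m : ℝ))) with hKup
  have t1 : Tendsto Kup atTop (𝓝 K) := tendsto_closedConst hq ha h
  have t2 : Tendsto (fun m : ℕ => Kup m * M / m) atTop (𝓝 0) := by
    have := (t1.mul_const M).mul (tendsto_const_div_atTop_nhds_zero_nat 1)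
    rw [mul_zero] at this
    exact this.congr fun m => by ring
  set A : ℕ → ℝ := fun m => Kup m * (1 + 2 * (Kup m * M / m)) * q ^ (1 / (m : ℝ)) with hA
  have t3 : Tendsto A atTop (𝓝 K) := by
    have := (t1.mul ((t2.const_mul 2).const_add 1)).mul (tendsto_rpow_div hq 1)
    rwa [mul_zero, add_zero, mul_one, mul_one] at this
  have t4 : Tendsto (fun m : ℕ => Real.exp (-(A m * q ^ (1 / (m : ℝ)) / m))) atTop (𝓝 1) := by
    have := (t3.mul (tendsto_rpow_div hq 1)).mul (tendsto_const_div_atTop_nhds_zero_nat 1)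
    rw [mul_zero] at this
    have := (Real.continuous_exp.tendsto _).comp this.neg
    rw [neg_zero, Real.exp_zero] at this
    refine this.congr fun m => ?_
    simp only [Function.comp]
    congr 1; ring
  have t5 : Tendsto (fun m : ℕ => Real.exp (-(A m * M / q))) atTop
      (𝓝 (Real.exp (-(K * M / q)))) :=
    (Real.continuous_exp.tendsto _).comp ((t3.mul_const M).div_const q).neg
  have t6 : Tendsto (fun m : ℕ => q ^ (-(1 / (m : ℝ)))) atTop (𝓝 1) :=
    (tendsto_rpow_div hq (-1)).congr fun m => by congr 1; ring
  have t7 : Tendsto (fun m : ℕ => (1 - q⁻¹) * q ^ (-(1 / (m : ℝ))) *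
      (Real.exp (-(A m * q ^ (1 / (m : ℝ)) / m)) - Real.exp (-(A m * M / q))) /
      (A m * Real.log q)) atTop (𝓝 ((1 - q⁻¹) * 1 * (1 - Real.exp (-(K * M / q))) /
      (K * Real.log q))) :=
    ((t6.const_mul _).mul (t4.sub t5)).div (t3.mul_const _) (by positivity)
  rw [mul_one] at t7
  filter_upwards [t7.eventually_const_le hM, t2.eventually_le_const
    (show (0 : ℝ) < 1 / 2 by norm_num), eventually_ge_atTop 3] with m hm1 hm2 hm3 _ L U j₁ T
    hmT hTL hj k1 k2
  rw [integral_partArea hq]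
  refine le_trans ?_ (le_mean_partArea hq ha h (Kup := Kup m) ?_ hmT hTL hj hM0 k1 k2 hm2 rfl)
  · gcongr
  · apply blkConst_le_closedConst hq
    have : (3 : ℝ) ≤ m := by exact_mod_cast hm3
    have : 1 / (m : ℝ) ≤ 1 / 3 := by gcongr
    linarith

end AsymptoticMean

/-! ### Asymptotics of the expected inverse free area -/

section AsymptoticInverse

open Filter Topology

variable {q s : ℝ}

theorem one_lt_of_eq_pow (hs : 1 < s) (hq : q = s ^ 16) : 1 < q :=
  hq ▸ one_lt_pow₀ hs (by norm_num)

theorem eventually_large (hs : 1 < s) :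
    ∀ᶠ m : ℕ in atTop, 2 ≤ s ^ m ∧ expConst s ≤ Real.log s / 2 * m := by
  have h1 := (tendsto_pow_atTop_atTop_of_one_lt hs).eventually_ge_atTop 2
  have h2 : 0 < Real.log s / 2 := half_pos (Real.log_pos hs)
  have h3 := ((tendsto_natCast_atTop_atTop (R := ℝ)).const_mul_atTop h2).eventually_ge_atTop
    (expConst s)
  exact h1.and h3

/-- This `j₀` is the first level at which the exponential tail bound applies. There `q ^ j₀` is of
order at most `1 + k / m`, so good outcomes at `j₀` already give `1 / P` the right order. -/
theorem exists_coarse_level (hs : 1 < s) (hq : q = s ^ 16) {m U k : ℕ} (hm : 0 < m) (hkU : k ≤ U)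
    (hC : expConst s ≤ Real.log s / 2 * m) :
    ∃ j₀ ≤ levels q U, expConst s * (k / q ^ j₀) ≤ Real.log s / 2 * m ∧
      q ^ j₀ ≤ 1 + q * (expConst s / (Real.log s / 2)) * (k / m) := by
  have hq1 := one_lt_of_eq_pow hs hq
  have hq0 : 0 < q := by linarith
  have hm' : (0 : ℝ) < m := by exact_mod_cast hm
  have hc : 0 < Real.log s / 2 := half_pos (Real.log_pos hs)
  have hC1 := expConst_pos hs
  have hl := Real.log_pos hs
  rcases Nat.eq_zero_or_pos k with rfl | hk
  · exact ⟨0, Nat.zero_le _, by simp; positivity, by simp⟩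
  · have hk' : (0 : ℝ) < k := by exact_mod_cast hk
    have hx : 0 < expConst s / (Real.log s / 2) * (k / m) := by positivity
    obtain ⟨e1, e2⟩ := exists_level hq1 hx
    refine ⟨_, level_le_levels hq1 hx (U := U) ?_, ?_, ?_⟩
    · calc expConst s / (Real.log s / 2) * (k / m) = expConst s / (Real.log s / 2 * m) * k := by
            field_simp
        _ ≤ 1 * k := by gcongr; exact (div_le_one (by positivity)).2 hC
        _ ≤ U := by rw [one_mul]; exact_mod_cast hkU
    · rw [← mul_div_assoc, div_le_iff₀ (by positivity)]
      calc expConst s * k = Real.log s / 2 * m * (expConst s / (Real.log s / 2) * (k / m)) := by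
            field_simp
        _ ≤ _ := by gcongr
    · refine e2.trans (max_le ?_ ?_)
      · have : 0 < q * (expConst s / (Real.log s / 2)) * (k / m) := by positivity
        linarith
      · linarith

/-- A crude bound for all numbers of elements. -/
theorem eventually_integral_inv_le_crude (hs : 1 < s) (hq : q = s ^ 16) {a : ℕ} (ha : 1 ≤ a)
    (h : ℕ) : ∃ B : ℝ, 0 < B ∧ ∀ᶠ m : ℕ in atTop, ∀ [NeZero m] (U : ℕ) (T : Finset (Fin U)),
      Real.log (Real.log U) ≤ Real.log s / 2 / 2 * m →
      ∫ ω, (freeArea q a h T ω)⁻¹ ∂(hitsLaw q m (levels q U) U) ≤ B * (1 + T.card / m) := by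
  have hq1 := one_lt_of_eq_pow hs hq
  have hq0 : 0 < q := by linarith
  have hc : 0 < Real.log s / 2 := half_pos (Real.log_pos hs)
  have hC1 := expConst_pos hs
  have hβ := one_sub_inv_pos hq1
  set β := (1 - q⁻¹) * q⁻¹ / 2 with hβd
  have hβ0 : 0 < β := by positivity
  set R := q * (expConst s / (Real.log s / 2)) with hR
  have hR0 : 0 < R := by positivity
  set Q := β⁻¹ * (2 * expConst s * q) with hQ
  have hQ0 : 0 < Q := by positivity
  refine ⟨β⁻¹ * (1 + R) + Q, by positivity, ?_⟩
  filter_upwards [eventually_large hs, eventually_levels_mul_exp_le hq1 hc one_pos,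
    eventually_gt_atTop 0] with m hm1 hm2 hm0 _ U T hU
  have hm' : (0 : ℝ) < m := by exact_mod_cast hm0
  have hTU : T.card ≤ U := by simpa using T.card_le_univ
  obtain ⟨j₀, k1, k2, k3⟩ := exists_coarse_level hs hq hm0 hTU hm1.2
  have : IsProbabilityMeasure (hitLaw q m (levels q U)) := isProbabilityMeasure_hitLaw hq1
  have key := integral_inv_freeArea_le hs hq ha h T k1 k2 hm1.1
    (g := fun _ => (β * (q ^ j₀)⁻¹)⁻¹) (fun _ => by positivity) (fun ω hω =>
      inv_anti₀ (by positivity) (le_freeArea_of_totalReach hq1 ha h T ω k1 hω))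
  rw [integral_const, probReal_univ, one_smul] at key
  have hμ : 0 ≤ (T.card : ℝ) / m := by positivity
  have e1 : (β * (q ^ j₀)⁻¹)⁻¹ ≤ β⁻¹ * (1 + R) * (1 + T.card / m) := by
    rw [mul_inv, inv_inv, mul_assoc]
    gcongr
    nlinarith
  have e2 : (T.card : ℝ) * ((levels q U + m) * Real.exp (-(Real.log s / 2 * m))) ≤
      1 + T.card / m := by
    rcases Nat.eq_zero_or_pos U with h0 | hU0
    · have : T.card = 0 := by omega
      simp [this]
    · have := mul_le_mul_of_nonneg_left (hm2 U hU0 hU) hμ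
      calc _ = (T.card : ℝ) / m * (m * ((levels q U + m) * Real.exp (-(Real.log s / 2 * m)))) := by
            field_simp
        _ ≤ _ := by linarith
  calc _ ≤ _ := key
    _ ≤ β⁻¹ * (1 + R) * (1 + T.card / m) + Q * (1 + T.card / m) := by gcongr
    _ = _ := by ring

theorem eventually_le_integral_inv (hs : 1 < s) (hq : q = s ^ 16) {a : ℕ} (ha : 1 ≤ a) (h : ℕ)
    {ε : ℝ} (hε : 0 < ε) : ∀ᶠ m : ℕ in atTop, ∀ [NeZero m] (U : ℕ) (T : Finset (Fin U)),
      (2 * varConst q a h - ε) * (T.card / m) ≤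
        ∫ ω, (freeArea q a h T ω)⁻¹ ∂(hitsLaw q m (levels q U) U) := by
  have hq1 := one_lt_of_eq_pow hs hq
  have hc : 0 < Real.log s / 2 := half_pos (Real.log_pos hs)
  have hC := varConst_pos hq1 ha h
  have hC1 := expConst_pos hs
  set C := varConst q a h with hCd
  have h1 : Tendsto (fun e : ℝ => ((2 * C)⁻¹ + e)⁻¹) (𝓝[>] 0) (𝓝 (2 * C)) := by
    have : Tendsto (fun e : ℝ => ((2 * C)⁻¹ + e)⁻¹) (𝓝 0) (𝓝 ((2 * C)⁻¹ + 0)⁻¹) :=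
      (tendsto_const_nhds.add tendsto_id).inv₀ (by positivity)
    rw [add_zero, inv_inv] at this
    exact this.mono_left nhdsWithin_le_nhds
  obtain ⟨e, he, he0⟩ := ((h1.eventually_const_lt (show 2 * C - ε < 2 * C by linarith)).and
    self_mem_nhdsWithin).exists
  replace he0 : 0 < e := he0
  have h2 : Tendsto (fun m : ℕ => ((2 * C)⁻¹ + e)⁻¹ *
      (1 - 2 * (2 * expConst s * Real.exp (-(Real.log s / 2 * m))))) atTop
      (𝓝 (((2 * C)⁻¹ + e)⁻¹ * (1 - 2 * (2 * expConst s * 0)))) := by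
    refine Tendsto.const_mul _ (tendsto_const_nhds.sub (Tendsto.const_mul _ (Tendsto.const_mul _ ?_)))
    exact Real.tendsto_exp_neg_atTop_nhds_zero.comp
      (tendsto_natCast_atTop_atTop.const_mul_atTop hc)
  rw [mul_zero, mul_zero, sub_zero, mul_one] at h2
  filter_upwards [eventually_large hs, h2.eventually_const_le he,
    eventually_mean_freeArea_le hq1 ha h he0, eventually_gt_atTop 0] with m hm1 hm2 hm3 hm0 _ U T
  have hm' : (0 : ℝ) < m := by exact_mod_cast hm0
  have : IsProbabilityMeasure (hitLaw q m (levels q U)) := isProbabilityMeasure_hitLaw hq1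
  rcases Nat.eq_zero_or_pos T.card with hT | hT
  · rw [hT, Nat.cast_zero, zero_div, mul_zero]
    exact integral_nonneg fun ω => inv_nonneg.2 measureReal_nonneg
  have hT' : (0 : ℝ) < T.card := by exact_mod_cast hT
  have hTU : T.card ≤ U := by simpa using T.card_le_univ
  have hTL : (T.card : ℝ) ≤ q ^ levels q U :=
    le_trans (by exact_mod_cast hTU) (le_pow_levels hq1 U)
  have k1 := le_integral_inv_freeArea hq1 h T (by positivity) (hm3 _ U T hT hTL)
  have k2 := integral_one_sub_live_le (m := m) hs hq ha h T hTL hm1.2 hm1.1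
  refine le_trans ?_ k1
  calc (2 * C - ε) * (T.card / m) ≤ ((2 * C)⁻¹ + e)⁻¹ *
      (1 - 2 * (2 * expConst s * Real.exp (-(Real.log s / 2 * m)))) * (T.card / m) := by gcongr
    _ = (m / T.card * ((2 * C)⁻¹ + e))⁻¹ *
      (1 - 2 * (2 * expConst s * Real.exp (-(Real.log s / 2 * m)))) := by
        rw [mul_inv ((m : ℝ) / T.card), inv_div]; ring
    _ ≤ _ := by gcongr

/-- An upper bound in terms of a lower bound for the expected area of the small free cells. -/
theorem integral_inv_freeArea_le_of_le_mean (hs : 1 < s) (hq : q = s ^ 16) {m L : ℕ} [NeZero m]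
    {a : ℕ} (ha : 1 ≤ a) (h : ℕ) {U : ℕ} (T : Finset (Fin U)) {j₀ j₁ : ℕ} (hj : j₀ ≤ L)
    (hk : expConst s * (T.card / q ^ j₀) ≤ Real.log s / 2 * m) (hm2 : 2 ≤ s ^ m) {τ η : ℝ}
    (hτ : 0 < τ) (hτm : τ ≤ ∫ ω, partArea q a h j₁ T ω ∂(hitsLaw q m L U)) (hη : 0 < η) :
    ∫ ω, (freeArea q a h T ω)⁻¹ ∂(hitsLaw q m L U) ≤
      (1 + η) / τ + (1 + η) ^ 2 / ((1 - q⁻¹) * q⁻¹ / 2 * (q ^ j₀)⁻¹ * τ ^ 2 * η ^ 2) *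
        (expConst s / (s - 1) ^ 2 / (1 - q⁻¹) ^ 2 * (T.card / (m : ℝ) ^ 2 * (q ^ j₁)⁻¹ ^ 3)) +
      ((1 - q⁻¹) * q⁻¹ / 2)⁻¹ * (2 * expConst s * q) *
        (T.card * ((L + m) * Real.exp (-(Real.log s / 2 * m)))) := by
  have hq1 := one_lt_of_eq_pow hs hq
  have hq0 : 0 < q := by linarith
  have hβ := one_sub_inv_pos hq1
  have : IsProbabilityMeasure (hitLaw q m L) := isProbabilityMeasure_hitLaw hq1
  obtain ⟨t, ht⟩ : ∃ t, t = ∫ ω, partArea q a h j₁ T ω ∂(hitsLaw q m L U) := ⟨_, rfl⟩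
  rw [← ht] at hτm
  have ht0 := hτ.trans_le hτm
  have hvar := variance_partArea_le hs hq ha h j₁ T ht
  have hc0 : 0 < (1 - q⁻¹) * q⁻¹ / 2 * (q ^ j₀)⁻¹ := by positivity
  have key := integral_inv_freeArea_le hs hq ha h T hj hk hm2
    (g := fun ω => (1 + η) / t + (1 + η) ^ 2 / ((1 - q⁻¹) * q⁻¹ / 2 * (q ^ j₀)⁻¹ * t ^ 2 * η ^ 2) *
      (partArea q a h j₁ T ω - t) ^ 2) (fun _ => by positivity) (fun ω hω =>
      inv_le_of_le hc0 (le_freeArea_of_totalReach hq1 ha h T ω hj hω)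
        (partArea_le_freeArea hq1 ha h j₁ T ω) ht0 hη)
  rw [integral_add (integrable_const _) Integrable.of_finite, integral_const, probReal_univ,
    one_smul, integral_const_mul] at key
  refine key.trans ?_
  gcongr

/-- With `μ = k / m`: the mean is `θ / μ`, the crude inverse bound is of order `x`, at most `P * μ`,
and the variance is of order `(μ / m) * (M / μ) ^ 3`. The Chebyshev term is then `μ / m` up to a
constant, smaller than the main term by a factor `m`. -/
theorem coarse_scaling {μ P N β θ η V M m x y k B : ℝ} (hμ : 0 < μ) (hP : 0 < P) (hm : 0 < m)
    (hβ : 0 < β) (hθ : 0 < θ) (hη : 0 < η) (hV : 0 ≤ V) (hN : 0 ≤ N) (hk : k = μ * m)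
    (hx0 : 0 < x) (hx : x ≤ P * μ) (hy0 : 0 < y) (hy : y⁻¹ ≤ M / μ)
    (hB : B = N * P * V * M ^ 3 / (β * θ ^ 2 * η ^ 2)) :
    N / (β * x⁻¹ * (μ⁻¹ * θ) ^ 2 * η ^ 2) * (V * (k / m ^ 2 * y⁻¹ ^ 3)) ≤ B / m * μ := by
  have e : k / m ^ 2 = μ / m := by rw [hk]; field_simp
  rw [e]
  calc _ ≤ N / (β * (P * μ)⁻¹ * (μ⁻¹ * θ) ^ 2 * η ^ 2) * (V * (μ / m * (M / μ) ^ 3)) := by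
        gcongr
    _ = _ := by rw [hB]; field_simp

theorem eventually_integral_inv_le (hs : 1 < s) (hq : q = s ^ 16) {a : ℕ} (ha : 1 ≤ a) (h : ℕ)
    {ε : ℝ} (hε : 0 < ε) : ∃ M : ℝ, 1 ≤ M ∧ ∀ᶠ m : ℕ in atTop, ∀ [NeZero m] (U : ℕ)
      (T : Finset (Fin U)), Real.log (Real.log U) ≤ Real.log s / 2 / 2 * m → M ≤ T.card / m →
      ∫ ω, (freeArea q a h T ω)⁻¹ ∂(hitsLaw q m (levels q U) U) ≤
        (2 * varConst q a h + ε) * (T.card / m) := by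
  have hq1 := one_lt_of_eq_pow hs hq
  have hq0 : 0 < q := by linarith
  have hc : 0 < Real.log s / 2 := half_pos (Real.log_pos hs)
  have hC := varConst_pos hq1 ha h
  have hC1 := expConst_pos hs
  have hβ := one_sub_inv_pos hq1
  set C := varConst q a h with hCd
  have h1 : Tendsto (fun e : ℝ => (1 + e) / ((2 * C)⁻¹ - e)) (𝓝[>] 0) (𝓝 (2 * C)) := by
    have : Tendsto (fun e : ℝ => (1 + e) / ((2 * C)⁻¹ - e)) (𝓝 0)
        (𝓝 ((1 + 0) / ((2 * C)⁻¹ - 0))) :=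
      (tendsto_const_nhds.add tendsto_id).div (tendsto_const_nhds.sub tendsto_id) (by
        rw [sub_zero]; positivity)
    rw [add_zero, sub_zero, one_div, inv_inv] at this
    exact this.mono_left nhdsWithin_le_nhds
  have h2 : ∀ᶠ e : ℝ in 𝓝[>] 0, e < (2 * C)⁻¹ :=
    nhdsWithin_le_nhds (eventually_lt_nhds (by positivity))
  -- One `η` serves both as the defect of the mean and as the slack in the Chebyshev step; together
  -- they must change `2 * C` by less than `ε / 3`.
  obtain ⟨η, ⟨he, hη2⟩, hη⟩ := (((h1.eventually_lt_const
    (show 2 * C < 2 * C + ε / 3 by linarith)).and h2).and self_mem_nhdsWithin).exists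
  replace hη : 0 < η := hη
  obtain ⟨θ, hθ⟩ : ∃ θ, θ = (2 * C)⁻¹ - η := ⟨_, rfl⟩
  have hθ0 : 0 < θ := by linarith
  obtain ⟨M, hM1, hMev⟩ := eventually_le_mean_partArea hq1 ha h hη
  have hM0 : 0 < M := by linarith
  obtain ⟨β, hβd⟩ : ∃ β, β = (1 - q⁻¹) * q⁻¹ / 2 := ⟨_, rfl⟩
  have hβ0 : 0 < β := by rw [hβd]; positivity
  obtain ⟨R, hR⟩ : ∃ R, R = q * (expConst s / (Real.log s / 2)) := ⟨_, rfl⟩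
  have hR0 : 0 < R := by rw [hR]; positivity
  obtain ⟨Q, hQ⟩ : ∃ Q, Q = β⁻¹ * (2 * expConst s * q) := ⟨_, rfl⟩
  have hQ0 : 0 < Q := by rw [hQ]; positivity
  obtain ⟨V, hV⟩ : ∃ V, V = expConst s / (s - 1) ^ 2 / (1 - q⁻¹) ^ 2 := ⟨_, rfl⟩
  have hV0 : 0 ≤ V := by rw [hV]; positivity
  obtain ⟨B, hB⟩ : ∃ B, B = (1 + η) ^ 2 * (1 + R) * V * M ^ 3 / (β * θ ^ 2 * η ^ 2) := ⟨_, rfl⟩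
  have t1 : Tendsto (fun m : ℕ => B / (m : ℝ)) atTop (𝓝 0) :=
    tendsto_const_div_atTop_nhds_zero_nat B
  refine ⟨M, hM1, ?_⟩
  filter_upwards [eventually_large hs, eventually_levels_mul_exp_le hq1 hc
    (show 0 < ε / 3 / Q by positivity), eventually_gt_atTop 0, hMev,
    t1.eventually_le_const (show 0 < ε / 3 by linarith)] with m hm1 hm2 hm0 hm3 hm4 _ U T hU hMT
  clear t1 hMev h1 h2
  have hm' : (0 : ℝ) < m := by exact_mod_cast hm0
  have hTU : T.card ≤ U := by simpa using T.card_le_univ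
  obtain ⟨μ, hμ⟩ : ∃ μ, μ = (T.card : ℝ) / m := ⟨_, rfl⟩
  rw [← hμ] at hMT ⊢
  have hμ1 : 1 ≤ μ := hM1.trans hMT
  have hμ0 : 0 < μ := by linarith
  have hμm : (T.card : ℝ) = μ * m := by rw [hμ]; field_simp
  have hmT : m ≤ T.card := by
    rw [hμ, le_div_iff₀ hm', one_mul] at hμ1
    exact_mod_cast hμ1
  have hT0 : 0 < T.card := by omega
  have hU0 : 0 < U := by omega
  have hT' : (0 : ℝ) < T.card := by exact_mod_cast hT0
  have hTL : (T.card : ℝ) ≤ q ^ levels q U :=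
    le_trans (by exact_mod_cast hTU) (le_pow_levels hq1 U)
  obtain ⟨j₀, k1, k2, k3⟩ := exists_coarse_level hs hq hm0 hTU hm1.2
  -- Because `μ ≥ M`, the level at which `q ^ j₁` first reaches `μ / M` is not clipped at zero, and
  -- `q ^ j₁` is `μ / M` up to a factor `q`.
  have hx1 : 1 ≤ μ / M := (one_le_div hM0).2 hMT
  have hx0 : 0 < μ / M := by linarith
  obtain ⟨l1, l2⟩ := exists_level hq1 hx0
  have l3 : ⌈Real.logb q (μ / M)⌉₊ ≤ levels q U := level_le_levels hq1 hx0 (by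
    calc μ / M ≤ μ := div_le_self hμ0.le hM1
      _ ≤ T.card := by rw [hμ]; exact div_le_self hT'.le (by exact_mod_cast hm0)
      _ ≤ U := by exact_mod_cast hTU)
  generalize ⌈Real.logb q (μ / M)⌉₊ = j₁ at l1 l2 l3
  rw [max_eq_right (one_le_mul_of_one_le_of_one_le hq1.le hx1)] at l2
  have hmean := hm3 (levels q U) U j₁ T hmT hTL l3
    (by rw [← hμ]; rwa [div_le_iff₀ hM0, mul_comm] at l1)
    (by
      rw [← hμ]
      calc q ^ j₁ * M ≤ q * (μ / M) * M := by gcongr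
        _ = q * μ := by field_simp)
  have hmk : (m : ℝ) / T.card = μ⁻¹ := by rw [hμ, inv_div]
  rw [hmk, ← hCd, ← hθ] at hmean
  have key := integral_inv_freeArea_le_of_le_mean hs hq ha h T k1 k2 hm1.1
    (show 0 < μ⁻¹ * θ by positivity) hmean hη
  rw [← hβd, ← hV, ← hQ] at key
  have b1 : (1 + η) / (μ⁻¹ * θ) ≤ (2 * C + ε / 3) * μ := by
    calc (1 + η) / (μ⁻¹ * θ) = (1 + η) / θ * μ := by field_simp
      _ ≤ _ := by rw [hθ]; gcongr
  have b2 : (1 + η) ^ 2 / (β * (q ^ j₀)⁻¹ * (μ⁻¹ * θ) ^ 2 * η ^ 2) *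
      (V * (T.card / (m : ℝ) ^ 2 * (q ^ j₁)⁻¹ ^ 3)) ≤ ε / 3 * μ := by
    refine (coarse_scaling hμ0 (by positivity) hm' hβ0 hθ0 hη hV0 (by positivity) hμm
      (by positivity) ?_ (by positivity) ?_ hB).trans (by gcongr)
    · rw [add_mul, one_mul]
      refine k3.trans ?_
      rw [← hR, ← hμ]
      gcongr
    · rw [← inv_div μ M]
      exact inv_anti₀ hx0 l1
  have b3 : Q * (T.card * ((levels q U + m) * Real.exp (-(Real.log s / 2 * m)))) ≤ ε / 3 * μ := by
    calc _ = Q * (μ * (m * ((levels q U + m) * Real.exp (-(Real.log s / 2 * m))))) := by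
          rw [hμm, mul_assoc μ]
      _ ≤ Q * (μ * (ε / 3 / Q)) := by
          gcongr
          exact hm2 U hU0 hU
      _ = _ := by field_simp
  calc _ ≤ _ := key
    _ ≤ (2 * C + ε / 3) * μ + ε / 3 * μ + ε / 3 * μ := by gcongr
    _ = _ := by ring

end AsymptoticInverse

/-! ### The variance of the estimate -/

section CompensatorDefect

variable {α : Type*} [MeasurableSpace α] [DiscreteMeasurableSpace α] [Finite α] [DecidableEq α]
  {ν : Measure α} [IsProbabilityMeasure ν] {U : ℕ} {Fr : Finset α → Set α}

theorem compens_nonneg (l : List (Fin U)) (ω : Fin U → α) : 0 ≤ compens Fr ν l ω := by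
  induction l with
  | nil => simp [compens]
  | cons x l ih =>
    have := live_nonneg (Fr := Fr) (ν := ν) l.toFinset ω
    by_cases hx : x ∈ l <;> simp only [compens, hx, if_true, if_false] <;> linarith

theorem compens_le (l : List (Fin U)) (ω : Fin U → α) :
    compens Fr ν l ω ≤ l.toFinset.card := by
  induction l with
  | nil => simp [compens]
  | cons x l ih =>
    have := live_le_one (Fr := Fr) (ν := ν) l.toFinset ω
    by_cases hx : x ∈ l
    · simpa [compens, hx] using ih
    · have e : (x :: l).toFinset.card = l.toFinset.card + 1 := by simp [hx]
      simp only [compens, hx, if_false]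
      rw [e]; push_cast; linarith

theorem integral_sub_compens_le {p : ℝ} (l : List (Fin U))
    (h : ∀ T : Finset (Fin U), ∫ ω, (1 - live Fr ν T ω) ∂(Measure.pi fun _ => ν) ≤ p) :
    ∫ ω, (l.toFinset.card - compens Fr ν l ω) ∂(Measure.pi fun _ => ν) ≤ l.toFinset.card * p := by
  induction l with
  | nil => simp [compens]
  | cons x l ih =>
    by_cases hx : x ∈ l
    · simpa [compens, hx] using ih
    · have e : (x :: l).toFinset.card = l.toFinset.card + 1 := by simp [hx]
      have e2 : ∀ ω, ((x :: l).toFinset.card : ℝ) - compens Fr ν (x :: l) ω =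
          (l.toFinset.card - compens Fr ν l ω) + (1 - live Fr ν l.toFinset ω) := by
        intro ω
        rw [e]
        simp only [compens, hx, if_false]
        push_cast; ring
      simp only [e2]
      rw [integral_add Integrable.of_finite Integrable.of_finite, e]
      have := h l.toFinset
      push_cast
      linarith

/-- A random variable is a martingale plus a small defect: its variance is close to the second
moment of the martingale. -/
theorem variance_martEst_near (hFr : ∀ O, ∀ o ∈ O, o ∉ Fr O) {p η : ℝ} (hη : 0 < η)
    (l : List (Fin U))
    (h : ∀ T : Finset (Fin U), ∫ ω, (1 - live Fr ν T ω) ∂(Measure.pi fun _ => ν) ≤ p) :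
    |∫ ω, martEst Fr ν l ω ∂(Measure.pi fun _ => ν) - l.toFinset.card| ≤ l.toFinset.card * p ∧
    |∫ ω, (martEst Fr ν l ω - ∫ ω', martEst Fr ν l ω' ∂(Measure.pi fun _ => ν)) ^ 2
        ∂(Measure.pi fun _ => ν) - bracket Fr ν l| ≤
      η * bracket Fr ν l + (1 + η⁻¹) * (l.toFinset.card ^ 2 * p) := by
  set P : Measure (Fin U → α) := Measure.pi fun _ => ν with hP
  set k : ℝ := ((l.toFinset.card : ℕ) : ℝ) with hk
  have hmean := (martEst_mean (ν := ν) hFr l).2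
  rw [← hP] at hmean
  set e := ∫ ω, martEst Fr ν l ω ∂P with he
  have hV := integral_sub_compens_le l h
  rw [← hP, ← hk] at hV
  have hV0 : 0 ≤ ∫ ω, (k - compens Fr ν l ω) ∂P :=
    integral_nonneg fun ω => by have := compens_le (Fr := Fr) (ν := ν) l ω; simp only [Pi.zero_apply]; linarith
  have hVe : ∫ ω, (k - compens Fr ν l ω) ∂P = k - e := by
    rw [integral_sub (integrable_const _) Integrable.of_finite, ← hmean]
    simp
  rw [hVe] at hV hV0
  refine ⟨by rw [abs_sub_comm, abs_of_nonneg hV0]; exact hV, ?_⟩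
  have hb := integral_sq_martEst_sub_compens (ν := ν) hFr l
  rw [← hP] at hb
  rw [← hb]
  set N : (Fin U → α) → ℝ := fun ω => martEst Fr ν l ω - compens Fr ν l ω with hN
  set W : (Fin U → α) → ℝ := fun ω => compens Fr ν l ω - e with hW
  -- The defect `V = k - compens` lies in `[0, k]`, so `V ^ 2 ≤ k * V`: the fluctuation of the
  -- compensator is controlled by its mean defect.
  have hW2 : ∫ ω, W ω ^ 2 ∂P ≤ k ^ 2 * p := by
    have e1 : ∀ ω, W ω ^ 2 ≤ k * (k - compens Fr ν l ω) -
        2 * (k - e) * (k - compens Fr ν l ω) + (k - e) ^ 2 := by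
      intro ω
      have h1 := compens_le (Fr := Fr) (ν := ν) l ω
      have h2 := compens_nonneg (Fr := Fr) (ν := ν) l ω
      rw [← hk] at h1
      have : 0 ≤ compens Fr ν l ω * (k - compens Fr ν l ω) := mul_nonneg h2 (by linarith)
      simp only [hW]
      nlinarith
    calc ∫ ω, W ω ^ 2 ∂P ≤ ∫ ω, (k * (k - compens Fr ν l ω) -
        2 * (k - e) * (k - compens Fr ν l ω) + (k - e) ^ 2) ∂P :=
          integral_mono Integrable.of_finite Integrable.of_finite e1
      _ = k * (k - e) - (k - e) ^ 2 := by
          rw [integral_add Integrable.of_finite Integrable.of_finite,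
            integral_sub Integrable.of_finite Integrable.of_finite, integral_const_mul,
            integral_const_mul, hVe]
          simp; ring
      _ ≤ k * (k * p) := by
          have hk0 : 0 ≤ k := Nat.cast_nonneg _
          have := mul_le_mul_of_nonneg_left hV hk0
          nlinarith [sq_nonneg (k - e)]
      _ = _ := by ring
  have hdec : ∀ ω, (martEst Fr ν l ω - e) ^ 2 - N ω ^ 2 = 2 * N ω * W ω + W ω ^ 2 := by
    intro ω; simp only [hN, hW]; ring
  rw [← integral_sub Integrable.of_finite Integrable.of_finite]
  -- Young's inequality for the cross term avoids any correlation estimate between the martingale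
  -- and the compensator.
  have hbound : ∀ ω, |2 * N ω * W ω + W ω ^ 2| ≤ η * N ω ^ 2 + (1 + η⁻¹) * W ω ^ 2 := by
    intro ω
    have h1 : 2 * (N ω * W ω) ≤ η * N ω ^ 2 + η⁻¹ * W ω ^ 2 := by
      have := mul_nonneg (inv_nonneg.2 hη.le) (sq_nonneg (η * N ω - W ω))
      have e1 : η⁻¹ * (η * N ω - W ω) ^ 2 = η * N ω ^ 2 - 2 * (N ω * W ω) + η⁻¹ * W ω ^ 2 := by
        field_simp; ring
      linarith
    have h2 : -(2 * (N ω * W ω)) ≤ η * N ω ^ 2 + η⁻¹ * W ω ^ 2 := by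
      have := mul_nonneg (inv_nonneg.2 hη.le) (sq_nonneg (η * N ω + W ω))
      have e1 : η⁻¹ * (η * N ω + W ω) ^ 2 = η * N ω ^ 2 + 2 * (N ω * W ω) + η⁻¹ * W ω ^ 2 := by
        field_simp; ring
      linarith
    rw [abs_le]
    constructor <;> nlinarith [sq_nonneg (W ω)]
  calc _ = |∫ ω, (2 * N ω * W ω + W ω ^ 2) ∂P| :=
        congrArg _ (integral_congr_ae (Filter.Eventually.of_forall hdec))
    _ ≤ ∫ ω, |2 * N ω * W ω + W ω ^ 2| ∂P :=
        abs_integral_le_integral_abs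
    _ ≤ ∫ ω, (η * N ω ^ 2 + (1 + η⁻¹) * W ω ^ 2) ∂P :=
        integral_mono Integrable.of_finite Integrable.of_finite hbound
    _ = η * ∫ ω, N ω ^ 2 ∂P + (1 + η⁻¹) * ∫ ω, W ω ^ 2 ∂P := by
        rw [integral_add Integrable.of_finite Integrable.of_finite, integral_const_mul,
          integral_const_mul]
    _ ≤ _ := by gcongr

end CompensatorDefect

/-! ### Asymptotics of the variance -/

section AsymptoticVariance

open Filter Topology

variable {q s : ℝ}

theorem sum_range_id_cast (n : ℕ) : ∑ k ∈ Finset.range n, (k : ℝ) = ((n : ℝ) ^ 2 - n) / 2 := by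
  induction n with
  | zero => simp
  | succ n ih => rw [Finset.sum_range_succ, ih]; push_cast; ring

/-- Each term is `(2 * C ± ε) * k / m` up to a bounded error; the crude bound covers the early
elements with `k / m < M`. As the integers below `n` sum to about `n ^ 2 / 2`, the main part is `C *
n ^ 2 / m`. -/
theorem eventually_bracket_near (hs : 1 < s) (hq : q = s ^ 16) {a : ℕ} (ha : 1 ≤ a) (h : ℕ)
    {ε : ℝ} (hε : 0 < ε) : ∃ M : ℝ, 1 ≤ M ∧ ∀ᶠ m : ℕ in atTop, ∀ [NeZero m] (U : ℕ)
      (l : List (Fin U)), Real.log (Real.log U) ≤ Real.log s / 2 / 2 * m →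
      M ≤ l.toFinset.card / m →
      |bracket (freeHits a h toCell) (hitLaw q m (levels q U)) l -
        varConst q a h * ((l.toFinset.card : ℝ) ^ 2 / m)| ≤ ε * ((l.toFinset.card : ℝ) ^ 2 / m) := by
  have hq1 := one_lt_of_eq_pow hs hq
  have hC := varConst_pos hq1 ha h
  set C := varConst q a h with hCd
  obtain ⟨B, hB0, hB⟩ := eventually_integral_inv_le_crude hs hq ha h
  obtain ⟨M, hM1, hM⟩ := eventually_integral_inv_le hs hq ha h hε
  have hlow := eventually_le_integral_inv hs hq ha h hε
  -- `B * (1 + M)` bounds the early terms. `C + 1` absorbs the subtracted `live` and the linear part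
  -- of the sum of the integers. The threshold `2 * D / ε` for `n / m` makes `D * n` at most half of
  -- the allowed error.
  set D := max (B * (1 + M)) (C + 1) with hD
  have hD0 : 0 < D := lt_of_lt_of_le (by linarith) (le_max_right _ _)
  refine ⟨max 1 (2 * D / ε), le_max_left _ _, ?_⟩
  filter_upwards [hB, hM, hlow, eventually_gt_atTop 0] with m hBm hMm hlm hm0 _ U l hU hl
  have hm' : (0 : ℝ) < m := by exact_mod_cast hm0
  have hm1 : (1 : ℝ) ≤ m := by exact_mod_cast hm0
  have : IsProbabilityMeasure (hitLaw q m (levels q U)) := isProbabilityMeasure_hitLaw hq1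
  have hl2 := (le_max_right _ _).trans hl
  set n := l.toFinset.card with hn
  have hn0 : (0 : ℝ) ≤ n := Nat.cast_nonneg _
  have hsmall : D * n ≤ ε / 2 * ((n : ℝ) ^ 2 / m) := by
    rw [div_le_iff₀ hε] at hl2
    calc D * n = (2 * D) / 2 * n := by ring
      _ ≤ (n / m * ε) / 2 * n := by gcongr
      _ = _ := by ring
  have hup : bracket (freeHits a h toCell) (hitLaw q m (levels q U)) l ≤
      ∑ k ∈ Finset.range n, ((2 * C + ε) / m * k + D) := by
    refine bracket_le fun T hT => ?_
    have h1 : ∫ ω, (((hitLaw q m (levels q U)).real (freeHits a h toCell (T.image ω)))⁻¹ -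
        live (freeHits a h toCell) (hitLaw q m (levels q U)) T ω)
        ∂(Measure.pi fun _ => hitLaw q m (levels q U)) ≤
        ∫ ω, (freeArea q a h T ω)⁻¹ ∂(hitsLaw q m (levels q U) U) :=
      integral_mono Integrable.of_finite Integrable.of_finite
        fun ω => sub_le_self _ (live_nonneg T ω)
    refine h1.trans ?_
    rcases le_or_gt M ((T.card : ℝ) / m) with hTM | hTM
    · calc _ ≤ _ := hMm U T hU hTM
        _ = (2 * C + ε) / m * T.card := by ring
        _ ≤ _ := by linarith
    · have h2 : 0 ≤ (2 * C + ε) / m * T.card := by positivity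
      calc _ ≤ _ := hBm U T hU
        _ ≤ B * (1 + M) := by gcongr
        _ ≤ D := le_max_left _ _
        _ ≤ _ := by linarith
  have hlo : ∑ k ∈ Finset.range n, ((2 * C - ε) / m * k + (-1)) ≤
      bracket (freeHits a h toCell) (hitLaw q m (levels q U)) l := by
    refine le_bracket fun T hT => ?_
    have h1 := hlm U T
    have h2 : ∫ ω, live (freeHits a h toCell) (hitLaw q m (levels q U)) T ω
        ∂(hitsLaw q m (levels q U) U) ≤ 1 := by
      calc _ ≤ ∫ _, (1 : ℝ) ∂(hitsLaw q m (levels q U) U) :=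
            integral_mono Integrable.of_finite Integrable.of_finite fun ω => live_le_one T ω
        _ = 1 := by simp
    rw [integral_sub Integrable.of_finite Integrable.of_finite]
    have h3 : (2 * C - ε) / m * T.card = (2 * C - ε) * (T.card / m) := by ring
    rw [h3]
    exact add_le_add h1 (neg_le_neg h2)
  rw [Finset.sum_add_distrib, ← Finset.mul_sum, sum_range_id_cast, Finset.sum_const,
    Finset.card_range, nsmul_eq_mul] at hup hlo
  have hDC : (C + 1) * n ≤ D * n := by gcongr; exact le_max_right _ _
  have hCm : C / m * n ≤ C * n := by
    gcongr; exact div_le_self hC.le hm1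
  have hεm : 0 ≤ ε / m * n := by positivity
  have hCm0 : 0 ≤ C / m * n := by positivity
  have e1 : (2 * C + ε) / m * (((n : ℝ) ^ 2 - n) / 2) =
      C * ((n : ℝ) ^ 2 / m) + ε / 2 * ((n : ℝ) ^ 2 / m) - C / m * n - ε / m * n / 2 := by ring
  have e2 : (2 * C - ε) / m * (((n : ℝ) ^ 2 - n) / 2) =
      C * ((n : ℝ) ^ 2 / m) - ε / 2 * ((n : ℝ) ^ 2 / m) - C / m * n + ε / m * n / 2 := by ring
  rw [abs_le]
  constructor <;> linarith

theorem abs_sub_le_of_near {C η ε x v b : ℝ} (hC : 0 < C) (hη0 : 0 < η) (hη1 : η ≤ 1)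
    (hη : η ≤ ε / 8) (hx : 0 < x) (hb : |b - C * x| ≤ η * C * x)
    (hv : |v - b| ≤ η * b + ε / 2 * C * x) : |v - C * x| ≤ ε * C * x := by
  have hCx : 0 < C * x := by positivity
  have h1 : η * (C * x) ≤ ε / 8 * (C * x) := by gcongr
  have h2 : η * (C * x) ≤ 1 * (C * x) := by gcongr
  have h3 : b ≤ 2 * (C * x) := by have := (abs_le.1 hb).2; linarith
  have h4 : η * b ≤ η * (2 * (C * x)) := by gcongr
  have h5 : 0 < ε * (C * x) := mul_pos (by linarith) hCx
  have := abs_sub_le v b (C * x)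
  linarith

/-- The saturation probability is exponentially small in `m`, in particular at most `γ / m`. So the
bias and the fluctuation of the compensator are negligible beside the quadratic increments. -/
theorem eventually_estimate_near (hs : 1 < s) (hq : q = s ^ 16) {a : ℕ} (ha : 1 ≤ a) (h : ℕ)
    {ε : ℝ} (hε : 0 < ε) : ∃ M : ℝ, 1 ≤ M ∧ ∀ᶠ m : ℕ in atTop, ∀ (U : ℕ) (l : List (Fin U)),
      Real.log (Real.log U) ≤ Real.log s / 2 / 2 * m → M ≤ cardinality l / m →
      MemLp (estimate q (levels q U) a h l) 2 (oracle m U) ∧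
      |∫ hash, estimate q (levels q U) a h l hash ∂(oracle m U) - (cardinality l : ℝ)| ≤
        ε * ((cardinality l : ℝ) / m) ∧
      |relVar q (levels q U) a h m l - varConst q a h / m| ≤ ε * (varConst q a h / m) := by
  have hq1 := one_lt_of_eq_pow hs hq
  have hc : 0 < Real.log s / 2 := half_pos (Real.log_pos hs)
  have hC := varConst_pos hq1 ha h
  have hC1 := expConst_pos hs
  set C := varConst q a h with hCd
  obtain ⟨η, hη0, hη1, hη⟩ : ∃ η : ℝ, 0 < η ∧ η ≤ 1 ∧ η ≤ ε / 8 :=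
    ⟨min 1 (ε / 8), lt_min one_pos (by linarith), min_le_left _ _, min_le_right _ _⟩
  obtain ⟨M, hM1, hM⟩ := eventually_bracket_near hs hq ha h (show 0 < η * C by positivity)
  obtain ⟨γ, hγ0, hγ1, hγ2⟩ : ∃ γ : ℝ, 0 < γ ∧ γ ≤ ε ∧ (1 + η⁻¹) * γ ≤ ε / 2 * C :=
    ⟨min ε (ε / 2 * C / (1 + η⁻¹)), lt_min hε (by positivity), min_le_left _ _, by
      calc _ ≤ (1 + η⁻¹) * (ε / 2 * C / (1 + η⁻¹)) := by gcongr; exact min_le_right _ _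
        _ = _ := by field_simp⟩
  have hexp : Tendsto (fun m : ℕ => 2 * expConst s * ((m : ℝ) * Real.exp (-(Real.log s / 2 * m))))
      atTop (𝓝 0) := by
    have := (Real.tendsto_pow_mul_exp_neg_atTop_nhds_zero 1).comp
      ((tendsto_natCast_atTop_atTop (R := ℝ)).const_mul_atTop hc)
    have := this.const_mul (2 * expConst s * (Real.log s / 2)⁻¹)
    rw [mul_zero] at this
    refine this.congr fun m => ?_
    simp only [Function.comp, pow_one]
    have := (Real.log_pos hs).ne'
    field_simp
  refine ⟨M, hM1, ?_⟩
  filter_upwards [hM, eventually_large hs, hexp.eventually_le_const hγ0, eventually_gt_atTop 0]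
    with m hMm hm1 hme hm0 U l hU hl
  have hm' : (0 : ℝ) < m := by exact_mod_cast hm0
  have : NeZero m := ⟨hm0.ne'⟩
  have : IsProbabilityMeasure (hitLaw q m (levels q U)) := isProbabilityMeasure_hitLaw hq1
  have hmeas := measurable_hitOf (m := m) hq1 (levels q U)
  have hest : estimate q (levels q U) a h l = fun hash =>
      martEst (freeHits a h toCell) (hitLaw q m (levels q U)) l.reverse
        (fun x => hitOf q (levels q U) (hash x)) :=
    funext fun hash => estimate_eq (toCell_hitOf hq1 _) hmeas ha h hash l
  have hcard : (cardinality l : ℝ) = l.reverse.toFinset.card := by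
    rw [List.toFinset_reverse]; rfl
  set p := 2 * expConst s * Real.exp (-(Real.log s / 2 * m)) with hp
  have hpm : p ≤ γ / m := by
    rw [le_div_iff₀ hm', hp]
    calc _ = _ := by ring
      _ ≤ γ := hme
  have hlive : ∀ T : Finset (Fin U), ∫ ω, (1 - live (freeHits a h toCell)
      (hitLaw q m (levels q U)) T ω) ∂(hitsLaw q m (levels q U) U) ≤ p := fun T =>
    integral_one_sub_live_le hs hq ha h T
      (le_trans (by exact_mod_cast (by simpa using T.card_le_univ)) (le_pow_levels hq1 U)) hm1.2 hm1.1
  obtain ⟨key1, key2⟩ := variance_martEst_near (Fr := freeHits a h toCell)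
    (notMem_freeHits a h toCell) hη0 l.reverse hlive
  have hbr := hMm U l.reverse hU (by rw [← hcard]; exact hl)
  rw [← hcard] at key1 key2 hbr
  set n : ℝ := (cardinality l : ℝ) with hn
  have hn0 : 0 < n := by
    have : 0 < n / m := by linarith
    by_contra hcon
    have := div_nonpos_of_nonpos_of_nonneg (not_lt.1 hcon) hm'.le
    linarith
  have hmean : ∫ hash, estimate q (levels q U) a h l hash ∂(oracle m U) =
      ∫ ω, martEst (freeHits a h toCell) (hitLaw q m (levels q U)) l.reverse ω
        ∂(hitsLaw q m (levels q U) U) := by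
    rw [hest]
    exact integral_oracle hmeas _
  have hmem : MemLp (estimate q (levels q U) a h l) 2 (oracle m U) := by
    rw [hest]
    exact memLp_oracle hmeas (MemLp.of_discrete)
  refine ⟨hmem, ?_, ?_⟩
  · rw [hmean]
    refine key1.trans ?_
    calc n * p ≤ n * (γ / m) := by gcongr
      _ ≤ n * (ε / m) := by gcongr
      _ = _ := by ring
  · have hvar : variance (estimate q (levels q U) a h l) (oracle m U) =
        ∫ ω, (martEst (freeHits a h toCell) (hitLaw q m (levels q U)) l.reverse ω -
          ∫ ω', martEst (freeHits a h toCell) (hitLaw q m (levels q U)) l.reverse ω'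
            ∂(hitsLaw q m (levels q U) U)) ^ 2 ∂(hitsLaw q m (levels q U) U) := by
      rw [variance_eq_integral hmem.aestronglyMeasurable.aemeasurable, hmean, hest]
      exact integral_oracle hmeas (fun ω => (martEst (freeHits a h toCell)
        (hitLaw q m (levels q U)) l.reverse ω - _) ^ 2)
    rw [← hvar] at key2
    have hx : 0 < n ^ 2 / m := by positivity
    have hrel : relVar q (levels q U) a h m l - C / m =
        (variance (estimate q (levels q U) a h l) (oracle m U) - C * (n ^ 2 / m)) / n ^ 2 := by
      unfold relVar
      rw [← hn]
      field_simp
    rw [hrel, abs_div, abs_of_pos (show 0 < n ^ 2 by positivity), div_le_iff₀ (by positivity)]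
    have h1 : (1 + η⁻¹) * (n ^ 2 * p) ≤ ε / 2 * C * (n ^ 2 / m) := by
      calc (1 + η⁻¹) * (n ^ 2 * p) ≤ (1 + η⁻¹) * (n ^ 2 * (γ / m)) := by gcongr
        _ = (1 + η⁻¹) * γ * (n ^ 2 / m) := by ring
        _ ≤ _ := by gcongr
    have e1 : ε * (C / m) * n ^ 2 = ε * C * (n ^ 2 / m) := by ring
    rw [e1]
    exact abs_sub_le_of_near hC hη0 hη1 hη hx hbr (key2.trans (by gcongr))

end AsymptoticVariance

/-! ### Memory -/

section Memory

/-- The sketch with the given curtain height in the first column, offsets and bits. -/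
def decode (L a n h : ℕ) (x : Fin (L + 2) × (Fin n → Fin (2 * a)) × (Fin h → Fin (n + 1) → Bool)) :
    State (n + 1) h where
  curt := Fin.induction (motive := fun _ => ℚ) ((x.1.val : ℚ) - 1)
    (fun k y => y + (((x.2.1 k).val : ℚ) - ((a : ℚ) - 1 / 2)))
  bits := x.2.2

theorem decode_curt_zero {L a n h : ℕ}
    (x : Fin (L + 2) × (Fin n → Fin (2 * a)) × (Fin h → Fin (n + 1) → Bool)) :
    (decode L a n h x).curt 0 = (x.1.val : ℚ) - 1 := rfl

theorem decode_curt_succ {L a n h : ℕ}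
    (x : Fin (L + 2) × (Fin n → Fin (2 * a)) × (Fin h → Fin (n + 1) → Bool)) (k : Fin n) :
    (decode L a n h x).curt k.succ =
      (decode L a n h x).curt k.castSucc + (((x.2.1 k).val : ℚ) - ((a : ℚ) - 1 / 2)) :=
  rfl

theorem decode_injective (L a n h : ℕ) : Function.Injective (decode L a n h) := by
  intro x y hxy
  have h0 : (decode L a n h x).curt 0 = (decode L a n h y).curt 0 := by rw [hxy]
  rw [decode_curt_zero, decode_curt_zero] at h0
  have h1 : x.1 = y.1 := Fin.ext (by
    have : (x.1.val : ℚ) = y.1.val := by linarith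
    exact_mod_cast this)
  have h2 : x.2.1 = y.2.1 := by
    funext k
    have e1 := decode_curt_succ x k
    have e2 := decode_curt_succ y k
    rw [hxy] at e1
    have : ((x.2.1 k).val : ℚ) = (y.2.1 k).val := by linarith
    exact Fin.ext (by exact_mod_cast this)
  have h3 : x.2.2 = y.2.2 := congrArg State.bits hxy
  exact Prod.ext h1 (Prod.ext h2 h3)

theorem range_decode (L a n h : ℕ) : Set.range (decode L a n h) = codes L a (n + 1) h := by
  ext s
  constructor
  · rintro ⟨x, rfl⟩
    refine ⟨fun i hi => ⟨x.1.val, by have := x.1.isLt; omega, ?_⟩, fun i j hij => ?_⟩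
    · have : i = 0 := Fin.ext hi
      rw [this, decode_curt_zero]
    · have hi : i.val < n := by have := j.isLt; omega
      have ei : i = Fin.castSucc ⟨i.val, hi⟩ := rfl
      have ej : j = Fin.succ ⟨i.val, hi⟩ := Fin.ext (by simp [hij])
      rw [ej, decode_curt_succ, ← ei, add_sub_cancel_left]
      exact ⟨_, (x.2.1 ⟨i.val, hi⟩).isLt, rfl⟩
  · rintro ⟨h0, hv⟩
    obtain ⟨j, hj, hj0⟩ := h0 0 rfl
    have hoff : ∀ k : Fin n, ∃ f : Fin (2 * a),
        s.curt k.succ - s.curt k.castSucc = (f.val : ℚ) - ((a : ℚ) - 1 / 2) := fun k => by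
      obtain ⟨f, hf, he⟩ := hv k.castSucc k.succ (by simp)
      exact ⟨⟨f, hf⟩, he⟩
    choose f hf using hoff
    refine ⟨(⟨j, by omega⟩, f, s.bits), State.ext ?_ rfl⟩
    funext i
    induction i using Fin.induction with
    | zero => rw [decode_curt_zero, hj0]
    | succ k ih =>
      rw [decode_curt_succ, ih]
      have := hf k
      linarith

/-- The initial height takes the `L + 2` values `-1, …, L`, and `n + 1` columns have `n` offsets. -/
theorem ncard_codes (L a n h : ℕ) :
    (codes L a (n + 1) h).ncard = (L + 2) * ((2 * a) ^ n * (2 ^ (n + 1)) ^ h) := by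
  rw [← range_decode, ← Set.image_univ, Set.ncard_image_of_injective _ (decode_injective L a n h),
    Set.ncard_univ, Nat.card_eq_fintype_card]
  simp

theorem clog_two_near {n : ℕ} (hn : 0 < n) :
    Real.logb 2 n ≤ Nat.clog 2 n ∧ (Nat.clog 2 n : ℝ) ≤ Real.logb 2 n + 1 := by
  have h0 : 0 ≤ Real.logb 2 (n : ℝ) := Real.logb_nonneg (by norm_num) (by exact_mod_cast hn)
  have h1 : Nat.clog 2 n = ⌈Real.logb 2 n⌉₊ := by
    have := Real.natCeil_logb_natCast 2 n
    exact_mod_cast this.symm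
  rw [h1]
  exact ⟨Nat.le_ceil _, (Nat.ceil_lt_add_one h0).le⟩

theorem logb_two_le_div {x : ℝ} (hx : 0 < x) : Real.logb 2 x ≤ x / Real.log 2 := by
  have h2 : 0 < Real.log 2 := Real.log_pos (by norm_num)
  unfold Real.logb
  gcongr
  exact (Real.log_le_sub_one_of_pos hx).trans (by linarith)

/-- The number of bits per column is close to `log₂ (2 * a) + h`. -/
theorem memory_near {q : ℝ} (hq : 1 < q) {a : ℕ} (ha : 1 ≤ a) (h : ℕ) {m U : ℕ} (hm : 0 < m)
    (hU : 0 < U) :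
    |(memory q a h m U : ℝ) - m * (Real.logb 2 (2 * a) + h)| ≤
      (Real.log U / Real.log q + 3) / Real.log 2 + Real.log U / Real.log 2 +
        Real.logb 2 (2 * a) + 2 := by
  obtain ⟨n, rfl⟩ : ∃ n, m = n + 1 := ⟨m - 1, by omega⟩
  have h2 : 0 < Real.log 2 := Real.log_pos (by norm_num)
  set L := levels q U with hL
  have ha0 : (0 : ℝ) < a := by exact_mod_cast ha
  have ha1 : (1 : ℝ) ≤ a := by exact_mod_cast ha
  have hN : 0 < (codes L a (n + 1) h).ncard := by rw [ncard_codes]; positivity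
  obtain ⟨c1, c2⟩ := clog_two_near hN
  obtain ⟨d1, d2⟩ := clog_two_near hU
  have hlog : Real.logb 2 ((codes L a (n + 1) h).ncard : ℝ) =
      Real.logb 2 (L + 2) + (n * Real.logb 2 (2 * a) + h * (n + 1)) := by
    rw [ncard_codes]
    push_cast
    rw [Real.logb_mul (by positivity) (by positivity), Real.logb_mul (by positivity) (by positivity),
      Real.logb_pow, Real.logb_pow, Real.logb_pow, Real.logb_self_eq_one (by norm_num)]
    push_cast; ring
  rw [hlog] at c1 c2
  have e1 : Real.logb 2 ((L : ℝ) + 2) ≤ (Real.log U / Real.log q + 3) / Real.log 2 := by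
    refine (logb_two_le_div (by positivity)).trans ?_
    have := levels_le hq hU
    exact div_le_div_of_nonneg_right (by linarith) h2.le
  have e0 : 0 ≤ Real.logb 2 ((L : ℝ) + 2) := Real.logb_nonneg (by norm_num) (by
    have : (0 : ℝ) ≤ L := Nat.cast_nonneg _
    linarith)
  have e2 : Real.logb 2 (U : ℝ) = Real.log U / Real.log 2 := rfl
  have e3 : 0 ≤ Real.logb 2 (U : ℝ) := Real.logb_nonneg (by norm_num) (by exact_mod_cast hU)
  have e4 : 0 ≤ Real.logb 2 (2 * (a : ℝ)) := Real.logb_nonneg (by norm_num) (by linarith)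
  have hmem : (memory q a h (n + 1) U : ℝ) =
      (Nat.clog 2 (codes L a (n + 1) h).ncard : ℝ) + (Nat.clog 2 U : ℝ) := by
    unfold memory; push_cast; rfl
  rw [hmem, abs_le]
  push_cast
  constructor <;> nlinarith

end Memory

/-! ### The limits of the theorem -/

section Main

open Filter Topology

variable {q : ℝ}

theorem exists_root (hq : 1 < q) : ∃ s : ℝ, 1 < s ∧ q = s ^ 16 := by
  refine ⟨q ^ ((16 : ℕ) : ℝ)⁻¹, Real.one_lt_rpow hq (by norm_num), ?_⟩
  rw [Real.rpow_inv_natCast_pow (by linarith) (by norm_num)]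

theorem exists_small {c M : ℝ} (hc : 0 < c) (N : ℕ) :
    ∃ δ : ℝ, 0 < δ ∧ δ ≤ c ∧ M ≤ 1 / δ ∧ (N : ℝ) ≤ 1 / δ := by
  have hP : 0 < max 1 (max M N) := lt_of_lt_of_le one_pos (le_max_left _ _)
  refine ⟨min c (1 / max 1 (max M N)), lt_min hc (by positivity), min_le_left _ _, ?_, ?_⟩ <;>
  · have h1 : max 1 (max M (N : ℝ)) ≤ 1 / min c (1 / max 1 (max M N)) := by
      rw [le_one_div hP (lt_min hc (by positivity))]
      exact min_le_right _ _
    refine le_trans ?_ h1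
    simp

theorem estimate_asymptotics (hq : 1 < q) {a : ℕ} (ha : 1 ≤ a) (h : ℕ) {ε : ℝ} (hε : 0 < ε) :
    ∃ δ : ℝ, 0 < δ ∧ ∀ (m U : ℕ) (l : List (Fin U)),
      1 / δ ≤ (m : ℝ) → 1 / δ ≤ (cardinality l : ℝ) / m →
      Real.log (Real.log (U : ℝ)) ≤ δ * m →
        MemLp (estimate q (levels q U) a h l) 2 (oracle m U) ∧
        |∫ hash, estimate q (levels q U) a h l hash ∂(oracle m U) - (cardinality l : ℝ)| ≤
          ε * ((cardinality l : ℝ) / m) ∧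
        |relVar q (levels q U) a h m l - varConst q a h / m| ≤ ε * (varConst q a h / m) := by
  obtain ⟨s, hs, hqs⟩ := exists_root hq
  have hc : 0 < Real.log s / 2 / 2 := half_pos (half_pos (Real.log_pos hs))
  obtain ⟨M, -, hM⟩ := eventually_estimate_near hs hqs ha h hε
  obtain ⟨N, hN⟩ := eventually_atTop.1 hM
  obtain ⟨δ, hδ, h1, h2, h3⟩ := exists_small (M := M) hc N
  refine ⟨δ, hδ, fun m U l k1 k2 k3 => hN m (by exact_mod_cast h3.trans k1) U l
    (k3.trans (by gcongr)) (h2.trans k2)⟩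

theorem abs_mul_sub_le {x y A C ε₁ ε₂ : ℝ} (hA : 0 ≤ A) (hC : 0 ≤ C) (hx : |x - A| ≤ ε₁)
    (hy : |y - C| ≤ ε₂ * C) (hε₁ : 0 ≤ ε₁) : |x * y - A * C| ≤ ε₁ * (C + ε₂ * C) + A * (ε₂ * C) := by
  have e : x * y - A * C = (x - A) * y + A * (y - C) := by ring
  have hy2 : |y| ≤ C + ε₂ * C := by
    have := abs_add_le (y - C) C
    rw [sub_add_cancel, abs_of_nonneg hC] at this
    linarith
  rw [e]
  refine (abs_add_le _ _).trans ?_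
  rw [abs_mul, abs_mul, abs_of_nonneg hA]
  gcongr

theorem memory_mul_relVar_asymptotics (hq : 1 < q) {a : ℕ} (ha : 1 ≤ a) (h : ℕ) {ε : ℝ}
    (hε : 0 < ε) : ∃ δ : ℝ, 0 < δ ∧ ∀ (m U : ℕ) (l : List (Fin U)),
      1 / δ ≤ (m : ℝ) → 1 / δ ≤ (cardinality l : ℝ) / m → Real.log (U : ℝ) ≤ δ * m →
        |(memory q a h m U : ℝ) * relVar q (levels q U) a h m l - mvpConst q a h| ≤ ε := by
  have hC := varConst_pos hq ha h
  have hlq := Real.log_pos hq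
  have hl2 : 0 < Real.log 2 := Real.log_pos (by norm_num)
  have ha1 : (1 : ℝ) ≤ a := by exact_mod_cast ha
  have hb : 0 ≤ Real.logb 2 (2 * (a : ℝ)) := Real.logb_nonneg (by norm_num) (by linarith)
  obtain ⟨C, hCd⟩ : ∃ C, C = varConst q a h := ⟨_, rfl⟩
  obtain ⟨A, hAd⟩ : ∃ A, A = Real.logb 2 (2 * (a : ℝ)) + h := ⟨_, rfl⟩
  rw [← hCd] at hC
  have hA : 0 ≤ A := by rw [hAd]; positivity
  obtain ⟨B, hBd⟩ : ∃ B, B = (1 / Real.log q + 3) / Real.log 2 + 1 / Real.log 2 +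
      Real.logb 2 (2 * (a : ℝ)) + 2 := ⟨_, rfl⟩
  have hB : 0 < B := by rw [hBd]; positivity
  obtain ⟨e, he⟩ : ∃ e, e = min 1 (ε / 2 / ((A + 1) * C)) := ⟨_, rfl⟩
  have he0 : 0 < e := by rw [he]; exact lt_min one_pos (by positivity)
  have he1 : e ≤ 1 := by rw [he]; exact min_le_left _ _
  have he2 : A * (e * C) ≤ ε / 2 := by
    have : e ≤ ε / 2 / ((A + 1) * C) := by rw [he]; exact min_le_right _ _
    rw [le_div_iff₀ (by positivity)] at this
    have h0 : 0 ≤ e * C := by positivity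
    linarith
  obtain ⟨δ₀, hδ₀, hest⟩ := estimate_asymptotics hq ha h he0
  obtain ⟨δ, hδ, k1, -, -⟩ := exists_small (M := 1)
    (c := min δ₀ (ε / 2 / (B * (2 * C)))) (lt_min hδ₀ (by positivity)) 1
  have hδδ₀ := k1.trans (min_le_left _ _)
  have hδB := k1.trans (min_le_right _ _)
  rw [le_div_iff₀ (by positivity)] at hδB
  refine ⟨δ, hδ, fun m U l hm hl hU => ?_⟩
  have hm0 : (0 : ℝ) < m := lt_of_lt_of_le (by positivity) hm
  have hmn : 0 < m := by exact_mod_cast hm0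
  -- An empty universe has only the empty stream, which is excluded by `1 / δ ≤ cardinality l / m`.
  have hU0 : 0 < U := by
    rcases Nat.eq_zero_or_pos U with rfl | hU0
    · have : l.toFinset = ∅ := Finset.eq_empty_of_isEmpty _
      have h1 : 0 < 1 / δ := by positivity
      simp only [cardinality, this, Finset.card_empty, Nat.cast_zero, zero_div] at hl
      linarith
    · exact hU0
  have hδinv : 1 / δ₀ ≤ 1 / δ := one_div_le_one_div_of_le hδ hδδ₀
  have hloglog : Real.log (Real.log (U : ℝ)) ≤ δ₀ * m := by
    have h0 : 0 ≤ Real.log (U : ℝ) := Real.log_natCast_nonneg U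
    have h1 := (Real.log_le_self h0).trans hU
    exact h1.trans (by gcongr)
  have hr := (hest m U l (hδinv.trans hm) (hδinv.trans hl) hloglog).2.2
  rw [← hCd] at hr
  have hmem := memory_near hq ha h hmn hU0
  rw [← hAd] at hmem
  -- This lets the additive constants in the memory bound be absorbed into a multiple of `δ * m`.
  have h1 : 1 ≤ δ * m := by
    rw [div_le_iff₀ hδ] at hm
    linarith
  have hx : |(memory q a h m U : ℝ) / m - A| ≤ B * δ := by
    have e1 : (memory q a h m U : ℝ) / m - A = ((memory q a h m U : ℝ) - m * A) / m := by
      field_simp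
    rw [e1, abs_div, abs_of_pos hm0, div_le_iff₀ hm0]
    refine hmem.trans ?_
    have f1 : Real.log U / Real.log q ≤ δ * m * (1 / Real.log q) := by
      rw [mul_one_div]; gcongr
    have f2 : (Real.log U / Real.log q + 3) / Real.log 2 ≤
        δ * m * ((1 / Real.log q + 3) / Real.log 2) := by
      rw [← mul_div_assoc]
      gcongr
      linarith
    have f3 : Real.log U / Real.log 2 ≤ δ * m * (1 / Real.log 2) := by
      rw [mul_one_div]; gcongr
    have f4 : Real.logb 2 (2 * (a : ℝ)) ≤ δ * m * Real.logb 2 (2 * (a : ℝ)) :=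
      le_mul_of_one_le_left hb h1
    have f5 : B * δ * m = δ * m * ((1 / Real.log q + 3) / Real.log 2) +
        δ * m * (1 / Real.log 2) + δ * m * Real.logb 2 (2 * (a : ℝ)) + δ * m * 2 := by
      rw [hBd]; ring
    rw [f5]
    linarith
  have hy : |m * relVar q (levels q U) a h m l - C| ≤ e * C := by
    have e1 : m * relVar q (levels q U) a h m l - C =
        m * (relVar q (levels q U) a h m l - C / m) := by field_simp
    rw [e1, abs_mul, abs_of_pos hm0]
    calc _ ≤ (m : ℝ) * (e * (C / m)) := by gcongr
      _ = _ := by field_simp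
  have key := abs_mul_sub_le hA hC.le hx hy (by positivity)
  have e2 : (memory q a h m U : ℝ) / m * (m * relVar q (levels q U) a h m l) =
      (memory q a h m U : ℝ) * relVar q (levels q U) a h m l := by field_simp
  have e3 : mvpConst q a h = A * C := by rw [hAd, hCd]; rfl
  rw [e3, ← e2]
  refine key.trans ?_
  have g1 : B * δ * (C + e * C) ≤ ε / 2 := by
    calc B * δ * (C + e * C) ≤ B * δ * (C + 1 * C) := by gcongr
      _ = δ * (B * (2 * C)) := by ring
      _ ≤ _ := hδB
  linarith

end Main

/-! ### The numerical value -/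

/-- The constant is about `2.3137`, near the upper end of the admitted interval, so the upper bound
has to be the sharper one. -/
theorem log_bounds : 1.065 < Real.log 2.91 ∧ Real.log 2.91 < 1.0684 := by
  have h1 := Real.exp_one_gt_d9
  have h2 := Real.exp_one_lt_d9
  constructor
  · rw [Real.lt_log_iff_exp_lt (by norm_num),
      show (1.065 : ℝ) = 1 + 0.065 by norm_num, Real.exp_add]
    have h3 : Real.exp 0.065 ≤ 1 / (1 - 0.065) := by
      rw [le_one_div (Real.exp_pos _) (by norm_num), one_div, ← Real.exp_neg]
      have := Real.add_one_le_exp (-0.065 : ℝ)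
      linarith
    calc Real.exp 1 * Real.exp 0.065 ≤ 2.7182818286 * (1 / (1 - 0.065)) := by gcongr
      _ < _ := by norm_num
  · rw [Real.log_lt_iff_lt_exp (by norm_num),
      show (1.0684 : ℝ) = 1 + 0.0684 by norm_num, Real.exp_add]
    have h3 := Real.quadratic_le_exp_of_nonneg (show (0 : ℝ) ≤ 0.0684 by norm_num)
    calc (2.91 : ℝ) < 2.7182818283 * (1 + 0.0684 + 0.0684 ^ 2 / 2) := by norm_num
      _ ≤ _ := by gcongr

theorem rpow_three_halves_bounds :
    4.9638 < (2.91 : ℝ) ^ ((2 : ℕ) - 1 / 2 : ℝ) ∧ (2.91 : ℝ) ^ ((2 : ℕ) - 1 / 2 : ℝ) < 4.9643 := by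
  have e : (2.91 : ℝ) ^ ((2 : ℕ) - 1 / 2 : ℝ) = 2.91 * √2.91 := by
    rw [show ((2 : ℕ) - 1 / 2 : ℝ) = 1 + 1 / 2 by norm_num,
      Real.rpow_add (by norm_num), Real.rpow_one, Real.sqrt_eq_rpow]
  have h1 : 1.7058 < √(2.91 : ℝ) := Real.lt_sqrt_of_sq_lt (by norm_num)
  have h2 : √(2.91 : ℝ) < 1.7059 := (Real.sqrt_lt' (by norm_num)).2 (by norm_num)
  rw [e]
  constructor <;> linarith

theorem mvpConst_value : |mvpConst 2.91 2 1 - 2.31| ≤ 0.005 := by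
  obtain ⟨l1, l2⟩ := log_bounds
  obtain ⟨r1, r2⟩ := rpow_three_halves_bounds
  have e : mvpConst 2.91 2 1 = 3 * varConst 2.91 2 1 := by
    unfold mvpConst
    have : Real.logb 2 (2 * ((2 : ℕ) : ℝ)) = 2 := by
      rw [show (2 * ((2 : ℕ) : ℝ)) = 2 ^ (2 : ℕ) by norm_num, Real.logb_pow,
        Real.logb_self_eq_one (by norm_num)]
      norm_num
    rw [this]; norm_num
  rw [e]
  unfold varConst
  generalize (2.91 : ℝ) ^ ((2 : ℕ) - 1 / 2 : ℝ) = r at r1 r2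
  generalize Real.log 2.91 = x at l1 l2
  have b1 : 2 / ((2.91 : ℝ) ^ 1 * (r - 1)) ≤ 2 / (2.91 ^ 1 * (4.9638 - 1)) := by gcongr
  have b2 : 2 / ((2.91 : ℝ) ^ 1 * (4.9643 - 1)) ≤ 2 / (2.91 ^ 1 * (r - 1)) := by
    have : 0 < r - 1 := by linarith
    gcongr
  generalize 2 / ((2.91 : ℝ) ^ 1 * (r - 1)) = y at b1 b2
  have c1 : (0.1733 : ℝ) ≤ y := le_trans (by norm_num) b2
  have c2 : y ≤ 0.1734 := b1.trans (by norm_num)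
  norm_num only
  rw [abs_le]
  constructor <;> nlinarith

end MartingaleCurtain

end

open MartingaleCurtain in
theorem theorem1 (q : ℝ) (hq : 1 < q) (a : ℕ) (ha : 1 ≤ a) (h : ℕ) :
    -- exact unbiasedness on the dartboard with infinitely many cells
    (∀ (m U : ℕ) (l : List (Fin U)), 0 < m →
      Integrable (estimate q ⊤ a h l) (oracle m U) ∧
      ∫ hash, estimate q ⊤ a h l hash ∂(oracle m U) = (cardinality l : ℝ)) ∧
    -- on a finite dartboard: the expected number of distinct elements that meet a state which
    -- can still change
    (∀ (L m U : ℕ) (l : List (Fin U)), 0 < m →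
      Integrable (estimate q L a h l) (oracle m U) ∧
      ∫ hash, estimate q L a h l hash ∂(oracle m U) =
        ∑ k : Fin l.length, if l.get k ∈ l.take k then 0 else
          (oracle m U).real
            {hash | changeProb q L a (stateAfter q L a h hash (l.take k) : State m h) ≠ 0}) ∧
    -- asymptotic relative variance, and negligible bias, as `m`, `cardinality l / m` tend to `∞`
    -- and `log (log U) / m` tends to `0`
    (∀ ε : ℝ, 0 < ε → ∃ δ : ℝ, 0 < δ ∧ ∀ (m U : ℕ) (l : List (Fin U)),
      1 / δ ≤ (m : ℝ) → 1 / δ ≤ (cardinality l : ℝ) / m →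
      Real.log (Real.log (U : ℝ)) ≤ δ * m →
        MemLp (estimate q (levels q U) a h l) 2 (oracle m U) ∧
        |∫ hash, estimate q (levels q U) a h l hash ∂(oracle m U) - (cardinality l : ℝ)| ≤
          ε * ((cardinality l : ℝ) / m) ∧
        |relVar q (levels q U) a h m l - varConst q a h / m| ≤ ε * (varConst q a h / m)) ∧
    -- limiting memory-variance product, if moreover `log U / m` tends to `0`
    (∀ ε : ℝ, 0 < ε → ∃ δ : ℝ, 0 < δ ∧ ∀ (m U : ℕ) (l : List (Fin U)),
      1 / δ ≤ (m : ℝ) → 1 / δ ≤ (cardinality l : ℝ) / m → Real.log (U : ℝ) ≤ δ * m →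
        |(memory q a h m U : ℝ) * relVar q (levels q U) a h m l - mvpConst q a h| ≤ ε) ∧
    -- the numerical value for `(q, a, h) = (2.91, 2, 1)`
    |mvpConst 2.91 2 1 - 2.31| ≤ 0.005 := by
  refine ⟨fun m U l hm => estimate_unbiased hq ha h m U l hm,
    fun L m U l hm => estimate_mean_finite hq ha h L m U l hm,
    fun ε hε => estimate_asymptotics hq ha h hε,
    fun ε hε => memory_mul_relVar_asymptotics hq ha h hε, mvpConst_value⟩
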